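/- **Setting.** A floorplan $F$ consists of $n$ nondegenerate axis-parallel rectangular blocks with pairwise disjoint interiors. Its block adjacency graph $G_b=(V_b,E_b)$ has the blocks as vertices. For monotonically increasing staircases there is an arc $(b_i,b_j)$ whenever $b_i$ is on the left of, or above, $b_j$ and the two blocks share a boundary segment of positive length (for monotonically decreasing staircases: on the left of, or below). It is assumed that $G_b$ has exactly one vertex of in-degree zero, the source. The nets are $k$ arbitrary sets of blocks. A monotone staircase cut is a partition $(L,R)$ of the blocks into two nonempty parts with no arc of $G_b$ from $R$ to $L$. Its segments are the common boundary segments of the arcs from $L$ to $R$; $z$ is its number of bends, i.e. of places where a vertical and a horizontal segment meet end to end; $z_{\max}$ is one less than its number of segments; $k_c$ is the number of nets with blocks in both parts; $balr=\min(A_l,A_r)/\max(A_l,A_r)$, where $A_l,A_r$ are the total areas (or, in the number balanced mode, the numbers) of the blocks in $L$ and $R$. For real parameters $\gamma,\beta$, $$Gain=\gamma\, balr+(1-\gamma-\beta)\Bigl(1-\frac{k_c}{k}\Bigr)+\beta\Bigl(1-\frac{z}{z_{\max}}\Bigr)\qquad(\text{with } 0/0:=0).$$ **Algorithm** MSCut_Bend_RAND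 (input: $G_b$ with its source, the ends and orientations of the boundary segments and the block areas, the nets as an incidence matrix, $\gamma,\beta$, the balance type; cost model: a real RAM, where every operation, memory access, test, assignment and random number costs one time unit). It runs 3 trials. Each trial starts with $L=\{\text{source}\}$ and proceeds in breadth-first levels. At each level the wavefront is the set of blocks that were moved to $L$ at the previous level, initially the source. As long as some arc from the wavefront to $R=V_b\setminus L$ has not been tried in this trial, such an arc $(v_i,v_j)$ is chosen at random and marked as tried; if no arc leads from $R$ to $v_j$, then $v_j$ is moved to $L$ and enqueued. A trial ends after a level that moves no block. For $L=\{\text{source}\}$ and after every move, if $R\neq\varnothing$, net partitioning and bend counting are carried out and $(L,R)$ is stored with its $Gain$. After the trials, a stored staircase of maximum $Gain$ is returned. **Statement.** There is an absolute constant $C$ such that the following holds for all floorplans $F$, both types of staircases, both balance types, all nets and all real $\gamma,\beta$. 1. $|E_b|\le Cn$, and at most $Cn$ pairs of a vertical and a horizontal boundary segment (of arcs of $G_b$) have a common end. If the blocks dissect a rectangle, then the block in its top-left corner (bottom-left corner for decreasing staircases) is the unique vertex of in-degree zero of $G_b$. 2. If $G_b$ has exactly one vertex of in-degree zero, then for every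 order in which the arcs are listed and for every outcome of the random choices: - each call of net partitioning takes at most $C(k+1)$ time, and each call of bend counting takes at most $Cn$ time; - MSCut_Bend_RAND halts within $C(n^2+nk)$ time; - each of the three trials explores and stores exactly $n-1$ monotone staircase cuts, with left parts of $1,2,\dots,n-1$ blocks, each contained in the next, and with the correct values of $Gain$; - if $n\ge2$, the returned staircase is one of these $3(n-1)$ staircases and has the maximum $Gain$ among them. -/

import Mathlib

open Finset

/-! ## Floorplans and block adjacency graphs -/

/-- A floorplan: `n` nondegenerate axis-parallel rectangular blocks `[x₀ i, x₁ i] × [y₀ i, y₁ i]`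
with pairwise disjoint interiors (the `y`-axis points upwards). -/
structure Floorplan (n : ℕ) where
  x₀ : Fin n → ℝ
  x₁ : Fin n → ℝ
  y₀ : Fin n → ℝ
  y₁ : Fin n → ℝ
  hx : ∀ i, x₀ i < x₁ i
  hy : ∀ i, y₀ i < y₁ i
  interiors_disjoint : ∀ i j, i ≠ j →
    Disjoint (Set.Ioo (x₀ i) (x₁ i) ×ˢ Set.Ioo (y₀ i) (y₁ i))
      (Set.Ioo (x₀ j) (x₁ j) ×ˢ Set.Ioo (y₀ j) (y₁ j))

/-- Monotonically increasing / decreasing staircases. -/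
inductive StairType where
  | mis
  | mds

/-- Area balanced / number balanced bipartitioning. -/
inductive BalType where
  | area
  | number

namespace Floorplan

variable {n k : ℕ}

/-- The closed rectangle occupied by block `i`. -/
def block (F : Floorplan n) (i : Fin n) : Set (ℝ × ℝ) :=
  Set.Icc (F.x₀ i) (F.x₁ i) ×ˢ Set.Icc (F.y₀ i) (F.y₁ i)

/-- The blocks dissect the rectangle `[X₀, X₁] × [Y₀, Y₁]`. -/
def Dissects (F : Floorplan n) (X₀ X₁ Y₀ Y₁ : ℝ) : Prop :=
  X₀ < X₁ ∧ Y₀ < Y₁ ∧ (⋃ i, F.block i) = Set.Icc X₀ X₁ ×ˢ Set.Icc Y₀ Y₁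

/-- Block `i` is on the left of an adjacent block `j`: they share a vertical boundary segment of
positive length. -/
def LeftAdj (F : Floorplan n) (i j : Fin n) : Prop :=
  F.x₁ i = F.x₀ j ∧ max (F.y₀ i) (F.y₀ j) < min (F.y₁ i) (F.y₁ j)

/-- Block `i` is above an adjacent block `j`: they share a horizontal boundary segment of
positive length. -/
def AboveAdj (F : Floorplan n) (i j : Fin n) : Prop :=
  F.y₀ i = F.y₁ j ∧ max (F.x₀ i) (F.x₀ j) < min (F.x₁ i) (F.x₁ j)

/-- The arcs of the block adjacency graph: left-to-right and above-to-below for increasing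
staircases, left-to-right and below-to-above for decreasing staircases. -/
def Arc (F : Floorplan n) : StairType → Fin n → Fin n → Prop
  | .mis, i, j => F.LeftAdj i j ∨ F.AboveAdj i j
  | .mds, i, j => F.LeftAdj i j ∨ F.AboveAdj j i

/-- `s` is the source of the block adjacency graph: the one and only vertex of in-degree zero. -/
def IsSource (F : Floorplan n) (st : StairType) (s : Fin n) : Prop :=
  (∀ i, ¬ F.Arc st i s) ∧ ∀ j, j ≠ s → ∃ i, F.Arc st i j

/-- The corner of `[X₀, X₁] × [Y₀, Y₁]` where the source block lies: top-left for increasing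
staircases, bottom-left for decreasing ones. -/
def sourceCorner (X₀ Y₀ Y₁ : ℝ) : StairType → ℝ × ℝ
  | .mis => (X₀, Y₁)
  | .mds => (X₀, Y₀)

open Classical in
/-- The edge set `E_b` of the block adjacency graph. -/
noncomputable def edges (F : Floorplan n) (st : StairType) : Finset (Fin n × Fin n) :=
  univ.filter fun p => F.Arc st p.1 p.2

/-- The common boundary of two adjacent blocks is a segment; this is its lower or left end. -/
noncomputable def segLo (F : Floorplan n) (p : Fin n × Fin n) : ℝ × ℝ :=
  (max (F.x₀ p.1) (F.x₀ p.2), max (F.y₀ p.1) (F.y₀ p.2))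

/-- The upper or right end of the common boundary segment of two adjacent blocks. -/
noncomputable def segHi (F : Floorplan n) (p : Fin n × Fin n) : ℝ × ℝ :=
  (min (F.x₁ p.1) (F.x₁ p.2), min (F.y₁ p.1) (F.y₁ p.2))

/-- The boundary segments of the two edges have a common end. -/
def Meet (F : Floorplan n) (p q : Fin n × Fin n) : Prop :=
  F.segLo p = F.segLo q ∨ F.segLo p = F.segHi q ∨ F.segHi p = F.segLo q ∨ F.segHi p = F.segHi q

open Classical in
/-- All pairs of edges of the block adjacency graph whose boundary segments, one vertical and one
horizontal, have a common end. -/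
noncomputable def corners (F : Floorplan n) (st : StairType) :
    Finset ((Fin n × Fin n) × (Fin n × Fin n)) :=
  (F.edges st ×ˢ F.edges st).filter fun c =>
    F.LeftAdj c.1.1 c.1.2 ∧ ¬ F.LeftAdj c.2.1 c.2.2 ∧ F.Meet c.1 c.2

/-! ## Monotone staircases and their gain -/

/-- `(L, Lᶜ)` is a monotone staircase cut: both parts are nonempty and no arc is directed from
the right part back to the left part. -/
def IsMSCut (F : Floorplan n) (st : StairType) (L : Finset (Fin n)) : Prop :=
  L.Nonempty ∧ L ≠ univ ∧ ∀ i j, F.Arc st i j → j ∈ L → i ∈ L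

/-- The edge `p` crosses the cut `(L, Lᶜ)` from left to right. -/
def Crosses (L : Finset (Fin n)) (p : Fin n × Fin n) : Prop := p.1 ∈ L ∧ p.2 ∉ L

open Classical in
/-- The cut edges; their boundary segments are the segments of the staircase. -/
noncomputable def cutEdges (F : Floorplan n) (st : StairType) (L : Finset (Fin n)) :
    Finset (Fin n × Fin n) :=
  (F.edges st).filter (Crosses L)

open Classical in
/-- The number `z` of bends: the places where a vertical and a horizontal segment of the staircase
meet end to end. -/
noncomputable def bends (F : Floorplan n) (st : StairType) (L : Finset (Fin n)) : ℕ :=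
  ((F.corners st).filter fun c => Crosses L c.1 ∧ Crosses L c.2).card

/-- What a block contributes to the balance: its area, or 1. -/
def weight (F : Floorplan n) : BalType → Fin n → ℝ
  | .area, i => (F.x₁ i - F.x₀ i) * (F.y₁ i - F.y₀ i)
  | .number, _ => 1

/-- The balance ratio `min(A_l, A_r) / max(A_l, A_r)`. -/
noncomputable def balr (F : Floorplan n) (bt : BalType) (L : Finset (Fin n)) : ℝ :=
  min (∑ i ∈ L, F.weight bt i) (∑ i ∈ Lᶜ, F.weight bt i) /
    max (∑ i ∈ L, F.weight bt i) (∑ i ∈ Lᶜ, F.weight bt i)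

/-- The number `k_c` of nets (sets of blocks) with blocks on both sides of the cut. -/
def cutNets (N : Fin k → Finset (Fin n)) (L : Finset (Fin n)) : ℕ :=
  (univ.filter fun j => (N j ∩ L).Nonempty ∧ (N j ∩ Lᶜ).Nonempty).card

/-- `γ balr + (1 - γ - β) (1 - k_c / k) + β (1 - z / z_max)`, with `z_max` one fewer than the
number of segments. A ratio `0 / 0` (no nets, or a staircase with one segment) counts as 0. -/
noncomputable def gain (F : Floorplan n) (st : StairType) (bt : BalType)
    (N : Fin k → Finset (Fin n)) (γ β : ℝ) (L : Finset (Fin n)) : ℝ :=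
  γ * F.balr bt L + (1 - γ - β) * (1 - (cutNets N L : ℝ) / (k : ℝ)) +
    β * (1 - (F.bends st L : ℝ) / (((F.cutEdges st L).card : ℝ) - 1))

end Floorplan

/-! ## A real RAM

Programs are finite syntactic objects in a structured imperative language with natural number and
real registers, arrays with two indices, and a random number instruction. Every operation,
memory access, assignment and test costs one time unit. -/

namespace RealRAM

/-- Natural number registers. -/
inductive NVar where
  | nBlk | nEdge | nNet | source | byNumber
  | r | v | e | f | j | i
  | head | tail | cur | level | nCand | pick | valid | newV | nLeft
  | nCorner | kc | nCut | z | lamLen | best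
  deriving DecidableEq

/-- Real registers. -/
inductive RVar where
  | gamma | beta | wTot | wLeft | wRight | balr | gain
  deriving DecidableEq

/-- Arrays of natural numbers. -/
inductive NArr where
  | src | dst | ori | pin
  | netDeg | netLeft | inL | inFront | tried | queue | cand | cornV | cornH | lamCut | out
  deriving DecidableEq

/-- Arrays of real numbers. -/
inductive RArr where
  | area | loX | loY | hiX | hiY | wt | lamGain
  deriving DecidableEq

/-- The memory, and the number of random numbers drawn so far. -/
structure Store where
  nat : NVar → ℕ
  real : RVar → ℝ
  natArr : NArr → ℕ → ℕ → ℕ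
  realArr : RArr → ℕ → ℕ → ℝ
  drawn : ℕ

inductive NExp where
  | lit (c : ℕ)
  | var (x : NVar)
  | arr (a : NArr) (p q : NExp)
  | add (p q : NExp)

inductive RExp where
  | cast (p : NExp)
  | var (x : RVar)
  | arr (a : RArr) (p q : NExp)
  | add (p q : RExp)
  | sub (p q : RExp)
  | mul (p q : RExp)
  | div (p q : RExp)

inductive BExp where
  | nlt (p q : NExp)
  | neq (p q : NExp)
  | rle (p q : RExp)
  | rlt (p q : RExp)
  | req (p q : RExp)
  | and (b c : BExp)
  | or (b c : BExp)

inductive Com where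
  | setN (x : NVar) (p : NExp)
  | setR (x : RVar) (p : RExp)
  | setNA (a : NArr) (p q val : NExp)
  | setRA (a : RArr) (p q : NExp) (val : RExp)
  | rand (x : NVar) (p : NExp)
  | seq (c d : Com)
  | skip
  | ite (b : BExp) (c d : Com)
  | loop (b : BExp) (c : Com)

def NExp.eval (σ : Store) : NExp → ℕ
  | lit c => c
  | var x => σ.nat x
  | arr a p q => σ.natArr a (p.eval σ) (q.eval σ)
  | add p q => p.eval σ + q.eval σ

def NExp.cost : NExp → ℕ
  | lit _ => 1
  | var _ => 1
  | arr _ p q => p.cost + q.cost + 1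
  | add p q => p.cost + q.cost + 1

noncomputable def RExp.eval (σ : Store) : RExp → ℝ
  | cast p => (p.eval σ : ℝ)
  | var x => σ.real x
  | arr a p q => σ.realArr a (p.eval σ) (q.eval σ)
  | add p q => p.eval σ + q.eval σ
  | sub p q => p.eval σ - q.eval σ
  | mul p q => p.eval σ * q.eval σ
  | div p q => p.eval σ / q.eval σ

def RExp.cost : RExp → ℕ
  | cast p => p.cost + 1
  | var _ => 1
  | arr _ p q => p.cost + q.cost + 1
  | add p q => p.cost + q.cost + 1
  | sub p q => p.cost + q.cost + 1
  | mul p q => p.cost + q.cost + 1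
  | div p q => p.cost + q.cost + 1

def BExp.Holds (σ : Store) : BExp → Prop
  | nlt p q => p.eval σ < q.eval σ
  | neq p q => p.eval σ = q.eval σ
  | rle p q => p.eval σ ≤ q.eval σ
  | rlt p q => p.eval σ < q.eval σ
  | req p q => p.eval σ = q.eval σ
  | and b c => b.Holds σ ∧ c.Holds σ
  | or b c => b.Holds σ ∨ c.Holds σ

def BExp.cost : BExp → ℕ
  | nlt p q => p.cost + q.cost + 1
  | neq p q => p.cost + q.cost + 1
  | rle p q => p.cost + q.cost + 1
  | rlt p q => p.cost + q.cost + 1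
  | req p q => p.cost + q.cost + 1
  | and b c => b.cost + c.cost + 1
  | or b c => b.cost + c.cost + 1

def Store.setN (σ : Store) (x : NVar) (c : ℕ) : Store :=
  { σ with nat := Function.update σ.nat x c }

def Store.setR (σ : Store) (x : RVar) (c : ℝ) : Store :=
  { σ with real := Function.update σ.real x c }

def Store.setNA (σ : Store) (a : NArr) (p q c : ℕ) : Store :=
  { σ with
    natArr := Function.update σ.natArr a
      (Function.update (σ.natArr a) p (Function.update (σ.natArr a p) q c)) }

def Store.setRA (σ : Store) (a : RArr) (p q : ℕ) (c : ℝ) : Store :=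
  { σ with
    realArr := Function.update σ.realArr a
      (Function.update (σ.realArr a) p (Function.update (σ.realArr a p) q c)) }

/-- A source of random numbers: `ω t b` is the answer to the `t`-th request, if that request is for
a random number in `{0, …, b}`. The answers are meant to be independent and uniform. -/
abbrev Random := ℕ → (b : ℕ) → Fin (b + 1)

/-- `Exec ω c σ t τ`: started in memory `σ` with random source `ω`, the program `c` halts after `t`
time units in memory `τ`. The instruction `rand x p` puts a random number smaller than the value of
`p` (or 0, if that value is 0) into `x`. -/
inductive Exec (ω : Random) : Com → Store → ℕ → Store → Prop
  | setN (x : NVar) (p : NExp) (σ : Store) :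
      Exec ω (.setN x p) σ (p.cost + 1) (σ.setN x (p.eval σ))
  | setR (x : RVar) (p : RExp) (σ : Store) :
      Exec ω (.setR x p) σ (p.cost + 1) (σ.setR x (p.eval σ))
  | setNA (a : NArr) (p q val : NExp) (σ : Store) :
      Exec ω (.setNA a p q val) σ (p.cost + q.cost + val.cost + 1)
        (σ.setNA a (p.eval σ) (q.eval σ) (val.eval σ))
  | setRA (a : RArr) (p q : NExp) (val : RExp) (σ : Store) :
      Exec ω (.setRA a p q val) σ (p.cost + q.cost + val.cost + 1)
        (σ.setRA a (p.eval σ) (q.eval σ) (val.eval σ))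
  | rand (x : NVar) (p : NExp) (σ : Store) :
      Exec ω (.rand x p) σ (p.cost + 1)
        { σ.setN x (ω σ.drawn (p.eval σ - 1) : ℕ) with drawn := σ.drawn + 1 }
  | seq {c d : Com} {σ τ υ : Store} {t u : ℕ} :
      Exec ω c σ t τ → Exec ω d τ u υ → Exec ω (.seq c d) σ (t + u) υ
  | skip (σ : Store) : Exec ω .skip σ 1 σ
  | iteTrue {b : BExp} {c : Com} (d : Com) {σ τ : Store} {t : ℕ} :
      b.Holds σ → Exec ω c σ t τ → Exec ω (.ite b c d) σ (b.cost + 1 + t) τ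
  | iteFalse {b : BExp} (c : Com) {d : Com} {σ τ : Store} {t : ℕ} :
      ¬ b.Holds σ → Exec ω d σ t τ → Exec ω (.ite b c d) σ (b.cost + 1 + t) τ
  | loopTrue {b : BExp} {c : Com} {σ τ υ : Store} {t u : ℕ} :
      b.Holds σ → Exec ω c σ t τ → Exec ω (.loop b c) τ u υ →
        Exec ω (.loop b c) σ (b.cost + 1 + t + u) υ
  | loopFalse {b : BExp} (c : Com) {σ : Store} :
      ¬ b.Holds σ → Exec ω (.loop b c) σ (b.cost + 1) σ

/-- A program has at most one halting run, so its running time and its result are well defined. -/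
theorem Exec.deterministic {ω : Random} {c : Com} {σ τ τ' : Store} {t t' : ℕ}
    (h : Exec ω c σ t τ) (h' : Exec ω c σ t' τ') : t = t' ∧ τ = τ' := by
  induction h generalizing t' τ' with
  | setN => cases h'; exact ⟨rfl, rfl⟩
  | setR => cases h'; exact ⟨rfl, rfl⟩
  | setNA => cases h'; exact ⟨rfl, rfl⟩
  | setRA => cases h'; exact ⟨rfl, rfl⟩
  | rand => cases h'; exact ⟨rfl, rfl⟩
  | skip => cases h'; exact ⟨rfl, rfl⟩
  | seq _ _ ih₁ ih₂ =>
    cases h' with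
    | seq h₁ h₂ =>
      obtain ⟨rfl, rfl⟩ := ih₁ h₁
      obtain ⟨rfl, rfl⟩ := ih₂ h₂
      exact ⟨rfl, rfl⟩
  | iteTrue _ hb _ ih =>
    cases h' with
    | iteTrue _ _ h₁ =>
      obtain ⟨rfl, rfl⟩ := ih h₁
      exact ⟨rfl, rfl⟩
    | iteFalse _ hb' _ => exact absurd hb hb'
  | iteFalse _ hb _ ih =>
    cases h' with
    | iteTrue _ hb' _ => exact absurd hb' hb
    | iteFalse _ _ h₁ =>
      obtain ⟨rfl, rfl⟩ := ih h₁
      exact ⟨rfl, rfl⟩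
  | loopTrue hb _ _ ih₁ ih₂ =>
    cases h' with
    | loopTrue _ h₁ h₂ =>
      obtain ⟨rfl, rfl⟩ := ih₁ h₁
      obtain ⟨rfl, rfl⟩ := ih₂ h₂
      exact ⟨rfl, rfl⟩
    | loopFalse _ hb' => exact absurd hb hb'
  | loopFalse _ hb =>
    cases h' with
    | loopTrue hb' _ _ => exact absurd hb' hb
    | loopFalse _ _ => exact ⟨rfl, rfl⟩

end RealRAM

/-! ## The program `MSCut_Bend_RAND` -/

namespace MSCut

open RealRAM

infixr:40 " ;; " => Com.seq
infix:50 " ≔ " => Com.setN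
infix:50 " ≔ᵣ " => Com.setR

/-- One-dimensional array access. -/
def at1 (a : NArr) (p : NExp) : NExp := .arr a p (.lit 0)
def rat1 (a : RArr) (p : NExp) : RExp := .arr a p (.lit 0)
def put1 (a : NArr) (p val : NExp) : Com := .setNA a p (.lit 0) val
def rput1 (a : RArr) (p : NExp) (val : RExp) : Com := .setRA a p (.lit 0) val
def incr (x : NVar) : Com := x ≔ .add (.var x) (.lit 1)
def when (b : BExp) (c : Com) : Com := .ite b c .skip

/-- `for x = 0, …, bound - 1 do c`. -/
def forUp (x bound : NVar) (c : Com) : Com :=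
  x ≔ .lit 0 ;; .loop (.nlt (.var x) (.var bound)) (c ;; incr x)

/-- The test whether the edge number `p` is a cut edge, from the left to the right part. -/
def isCut (p : NExp) : BExp :=
  .and (.neq (at1 .inL (at1 .src p)) (.lit 1)) (.neq (at1 .inL (at1 .dst p)) (.lit 0))

/-- Block weights for the balance type, and their sum. -/
def prepWeights : Com :=
  .wTot ≔ᵣ .cast (.lit 0) ;;
  forUp .v .nBlk
    (.ite (.neq (.var .byNumber) (.lit 0))
      (rput1 .wt (.var .v) (rat1 .area (.var .v)))
      (rput1 .wt (.var .v) (.cast (.lit 1))) ;;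
    .wTot ≔ᵣ .add (.var .wTot) (rat1 .wt (.var .v)))

/-- The number of blocks of each net. -/
def prepNets : Com :=
  forUp .j .nNet
    (put1 .netDeg (.var .j) (.lit 0) ;;
    forUp .v .nBlk
      (put1 .netDeg (.var .j)
        (.add (at1 .netDeg (.var .j)) (.arr .pin (.var .j) (.var .v)))))

/-- The test whether an end of the segment of edge `e` is an end of the segment of edge `f`; the
array names say which ends. -/
def sameEnd (ax ay bx bY : RArr) : BExp :=
  .and (.req (rat1 ax (.var .e)) (rat1 bx (.var .f))) (.req (rat1 ay (.var .e)) (rat1 bY (.var .f)))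

/-- The list of all pairs of a vertical and a horizontal edge whose segments have a common end. -/
def prepCorners : Com :=
  .nCorner ≔ .lit 0 ;;
  forUp .e .nEdge (forUp .f .nEdge
    (when
      (.and (.neq (at1 .ori (.var .e)) (.lit 0))
        (.and (.neq (at1 .ori (.var .f)) (.lit 1))
          (.or (sameEnd .loX .loY .loX .loY) (.or (sameEnd .loX .loY .hiX .hiY)
            (.or (sameEnd .hiX .hiY .loX .loY) (sameEnd .hiX .hiY .hiX .hiY))))))
      (put1 .cornV (.var .nCorner) (.var .e) ;;
      put1 .cornH (.var .nCorner) (.var .f) ;;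
      incr .nCorner)))

def enqueue (p : NExp) : Com := put1 .queue (.var .tail) p ;; incr .tail

/-- Enqueue the block `newV` and include it in the left part. -/
def moveLeft : Com :=
  enqueue (.var .newV) ;;
  put1 .inL (.var .newV) (.lit 1) ;;
  incr .nLeft ;;
  .wLeft ≔ᵣ .add (.var .wLeft) (rat1 .wt (.var .newV))

/-- Net partitioning after `newV` has moved to the left part: update how many blocks of each net
are in the left part, and count the cut nets. -/
def netPartition : Com :=
  .kc ≔ .lit 0 ;;
  forUp .j .nNet
    (put1 .netLeft (.var .j)
      (.add (at1 .netLeft (.var .j)) (.arr .pin (.var .j) (.var .newV))) ;;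
    when
      (.and (.nlt (.lit 0) (at1 .netLeft (.var .j)))
        (.nlt (at1 .netLeft (.var .j)) (at1 .netDeg (.var .j))))
      (incr .kc))

/-- Count the segments and the bends of the current staircase. -/
def countBends : Com :=
  .nCut ≔ .lit 0 ;;
  forUp .f .nEdge (when (isCut (.var .f)) (incr .nCut)) ;;
  .z ≔ .lit 0 ;;
  forUp .i .nCorner
    (when (.and (isCut (at1 .cornV (.var .i))) (isCut (at1 .cornH (.var .i)))) (incr .z))

/-- The gain of the current staircase. -/
def computeGain : Com :=
  .wRight ≔ᵣ .sub (.var .wTot) (.var .wLeft) ;;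
  .ite (.rle (.var .wLeft) (.var .wRight))
    (.balr ≔ᵣ .div (.var .wLeft) (.var .wRight))
    (.balr ≔ᵣ .div (.var .wRight) (.var .wLeft)) ;;
  .gain ≔ᵣ .add (.add
    (.mul (.var .gamma) (.var .balr))
    (.mul (.sub (.sub (.cast (.lit 1)) (.var .gamma)) (.var .beta))
      (.sub (.cast (.lit 1)) (.div (.cast (.var .kc)) (.cast (.var .nNet))))))
    (.mul (.var .beta)
      (.sub (.cast (.lit 1))
        (.div (.cast (.var .z)) (.sub (.cast (.var .nCut)) (.cast (.lit 1))))))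

/-- Append the current staircase and its gain to the list `λ`. -/
def store : Com :=
  rput1 .lamGain (.var .lamLen) (.var .gain) ;;
  forUp .v .nBlk (.setNA .lamCut (.var .lamLen) (.var .v) (at1 .inL (.var .v))) ;;
  incr .lamLen

/-- Compute the parameters of the current partition and store them, unless its right part is
empty. -/
def record : Com :=
  when (.nlt (.var .nLeft) (.var .nBlk)) (netPartition ;; countBends ;; computeGain ;; store)

/-- List the cut edges from the wavefront to the right part that have not been tried. -/
def findCands : Com :=
  .nCand ≔ .lit 0 ;;
  forUp .f .nEdge
    (when
      (.and (.neq (at1 .inFront (at1 .src (.var .f))) (.lit 1))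
        (.and (.neq (at1 .inL (at1 .dst (.var .f))) (.lit 0))
          (.neq (at1 .tried (.var .f)) (.lit 0))))
      (put1 .cand (.var .nCand) (.var .f) ;; incr .nCand))

/-- `valid = 1` if no arc from the right part ends in the end vertex of the edge `e`, so that this
vertex can move to the left part without creating a back edge; otherwise `valid = 0`. -/
def checkValid : Com :=
  .valid ≔ .lit 1 ;;
  forUp .f .nEdge
    (when
      (.and (.neq (at1 .dst (.var .f)) (at1 .dst (.var .e)))
        (.neq (at1 .inL (at1 .src (.var .f))) (.lit 0)))
      (.valid ≔ .lit 0))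

/-- Propagate the wavefront: try its cut edges to the right part in random order. -/
def propagate : Com :=
  findCands ;;
  .loop (.nlt (.lit 0) (.var .nCand))
    (.rand .pick (.var .nCand) ;;
    .e ≔ at1 .cand (.var .pick) ;;
    put1 .tried (.var .e) (.lit 1) ;;
    checkValid ;;
    when (.neq (.var .valid) (.lit 1))
      (.newV ≔ at1 .dst (.var .e) ;; moveLeft ;; record) ;;
    findCands)

/-- Start a trial: everything is in the right part. -/
def resetTrial : Com :=
  forUp .v .nBlk (put1 .inL (.var .v) (.lit 0) ;; put1 .inFront (.var .v) (.lit 0)) ;;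
  forUp .f .nEdge (put1 .tried (.var .f) (.lit 0)) ;;
  forUp .j .nNet (put1 .netLeft (.var .j) (.lit 0)) ;;
  .wLeft ≔ᵣ .cast (.lit 0) ;;
  .nLeft ≔ .lit 0 ;;
  .head ≔ .lit 0 ;;
  .tail ≔ .lit 0 ;;
  .level ≔ .lit 0

/-- One trial. The number of blocks serves as the level indicator in the queue. -/
def trial : Com :=
  resetTrial ;;
  .newV ≔ .var .source ;;
  moveLeft ;;
  record ;;
  enqueue (.var .nBlk) ;;
  .loop (.nlt (.var .head) (.var .tail))
    (.cur ≔ at1 .queue (.var .head) ;;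
    incr .head ;;
    .ite (.nlt (.var .cur) (.var .nBlk))
      (put1 .inFront (.var .cur) (.lit 1))
      (propagate ;;
      forUp .v .nBlk (put1 .inFront (.var .v) (.lit 0)) ;;
      incr .level ;;
      when (.nlt (.var .head) (.var .tail)) (enqueue (.var .nBlk))))

/-- Copy a staircase of maximum gain in `λ` to the output. -/
def selectBest : Com :=
  .best ≔ .lit 0 ;;
  forUp .i .lamLen
    (when (.rlt (rat1 .lamGain (.var .best)) (rat1 .lamGain (.var .i))) (.best ≔ .var .i)) ;;
  forUp .v .nBlk (put1 .out (.var .v) (.arr .lamCut (.var .best) (.var .v)))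

/-- The randomized bipartitioner, with three trials. -/
def msCutBendRand : Com :=
  prepWeights ;;
  prepNets ;;
  prepCorners ;;
  .lamLen ≔ .lit 0 ;;
  .r ≔ .lit 0 ;;
  .loop (.nlt (.var .r) (.lit 3)) (trial ;; incr .r) ;;
  selectBest

/-! ### Input and output -/

variable {n k : ℕ}

/-- `E` lists the edges of the block adjacency graph, each once, in any order. -/
def IsEdgeList (F : Floorplan n) (st : StairType) (E : List (Fin n × Fin n)) : Prop :=
  E.Nodup ∧ ∀ p, p ∈ E ↔ F.Arc st p.1 p.2

/-- The initial contents of the registers. -/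
def inputNat (s : Fin n) (E : List (Fin n × Fin n)) (k : ℕ) (bt : BalType) : NVar → ℕ
  | .nBlk => n
  | .nEdge => E.length
  | .nNet => k
  | .source => s
  | .byNumber => match bt with
    | .area => 0
    | .number => 1
  | _ => 0

open Classical in
/-- The initial contents of the arrays of natural numbers: ends and orientation (0 for a vertical
and 1 for a horizontal boundary segment) of the edges, and the incidence matrix of the nets. -/
noncomputable def inputNatArr (F : Floorplan n) (E : List (Fin n × Fin n))
    (N : Fin k → Finset (Fin n)) : NArr → ℕ → ℕ → ℕ
  | .src, e, _ => (E.map fun p => (p.1 : ℕ)).getD e 0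
  | .dst, e, _ => (E.map fun p => (p.2 : ℕ)).getD e 0
  | .ori, e, _ => (E.map fun p => if F.LeftAdj p.1 p.2 then 0 else 1).getD e 0
  | .pin, j, v => if ∃ (hj : j < k) (hv : v < n), (⟨v, hv⟩ : Fin n) ∈ N ⟨j, hj⟩ then 1 else 0
  | _, _, _ => 0

/-- The initial contents of the arrays of reals: the areas of the blocks, and the ends of the
boundary segments of the edges. -/
noncomputable def inputRealArr (F : Floorplan n) (E : List (Fin n × Fin n)) : RArr → ℕ → ℕ → ℝ
  | .area, v, _ => if hv : v < n then F.weight .area ⟨v, hv⟩ else 0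
  | .loX, e, _ => (E.map fun p => (F.segLo p).1).getD e 0
  | .loY, e, _ => (E.map fun p => (F.segLo p).2).getD e 0
  | .hiX, e, _ => (E.map fun p => (F.segHi p).1).getD e 0
  | .hiY, e, _ => (E.map fun p => (F.segHi p).2).getD e 0
  | _, _, _ => 0

/-- The memory holding the block adjacency graph (with the geometry of its edges and vertices), the
nets, the trade-off parameters and the balance type; everything else is zero. -/
noncomputable def input (F : Floorplan n) (s : Fin n) (E : List (Fin n × Fin n))
    (N : Fin k → Finset (Fin n)) (γ β : ℝ) (bt : BalType) : Store where
  nat := inputNat s E k bt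
  real := fun
    | .gamma => γ
    | .beta => β
    | _ => 0
  natArr := inputNatArr F E N
  realArr := inputRealArr F E
  drawn := 0

/-- Row `c` of the array `a` is the indicator of the set `L` of blocks. -/
def HoldsRow (τ : Store) (a : NArr) (c : ℕ) (L : Finset (Fin n)) : Prop :=
  ∀ v : Fin n, τ.natArr a c v = if v ∈ L then 1 else 0

/-- The output array is the indicator of the set `L` of blocks. -/
def Outputs (τ : Store) (L : Finset (Fin n)) : Prop :=
  ∀ v : Fin n, τ.natArr .out v 0 = if v ∈ L then 1 else 0

end MSCut

/-! ### Geometry of floorplans and of their block adjacency graphs. -/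

namespace Floorplan

variable {n k : ℕ}

/-! ### Symmetries of floorplans -/

/-! The counts are charging arguments. The upper end of a vertical shared segment is a top corner of
one of its two blocks, and this corner of this block determines the edge; so there are at most `2n`
vertical edges and, after a quarter turn (`rot`), at most `4n` edges. A horizontal edge is
determined by either end of its segment (`horizontal_edge_eq`), so a vertical edge together with one
of the four pairings of ends fixes a corner: at most `8n` corners. In a dissected rectangle a block
off the left side has a left neighbour and a block off the top has a neighbour above, which leaves
only the corner block without incoming arcs. Decreasing staircases reduce to increasing ones by a
reflection (`flip`).

That no trial gets stuck rests on acyclicity (`exists_no_arc_into`): while the right part is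
nonempty, some block of it has all its predecessors on the left (`exists_valid`) and may move. The
algorithm must also find such a block although it only looks at arcs out of the wavefront. The
invariant (field `valid` of `Wave`) is that every movable block has an untried arc from the
wavefront or an arc from a block that moved during the current level. A failed try does no harm: its
target becomes movable only when its last missing predecessor moves, and that predecessor is then
new. Hence a level that moves nothing leaves no movable block, so the right part is empty. Whatever
the random choices, every trial moves all `n` blocks, and its proper left parts, being closed under
predecessors, form a chain of `n - 1` cuts.

For the time, each of the at most `4n` arcs is tried at most once per trial. A try costs `O(n + k)`:
scans of the edges for validity and for candidates, and possibly the evaluation of one cut. There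
are at most `n` levels, each with `O(n)` overhead. Net partitioning is `O(k)` because it only adds
one incidence column to counters; bend counting scans the edges and a list of corners, which is
prepared once in `O(n²)` time. The loop rule `Runs.loop` carries these bounds as a remaining budget,
which also proves termination; `levelTime` is the budget of a trial. -/

theorem separated (F : Floorplan n) {i j : Fin n} (h : i ≠ j) :
    F.x₁ i ≤ F.x₀ j ∨ F.x₁ j ≤ F.x₀ i ∨ F.y₁ i ≤ F.y₀ j ∨ F.y₁ j ≤ F.y₀ i := by
  have hd := F.interiors_disjoint i j h
  rw [Set.disjoint_prod, Set.Ioo_disjoint_Ioo, Set.Ioo_disjoint_Ioo] at hd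
  have := F.hx i
  have := F.hx j
  have := F.hy i
  have := F.hy j
  rcases hd with hd | hd <;> rw [min_le_iff, le_max_iff, le_max_iff] at hd
  · rcases hd with (h | h) | (h | h)
    · linarith
    · exact .inl h
    · exact .inr (.inl h)
    · linarith
  · rcases hd with (h | h) | (h | h)
    · linarith
    · exact .inr (.inr (.inl h))
    · exact .inr (.inr (.inr h))
    · linarith

/-- A floorplan from block coordinates in which distinct blocks are separated by a line. -/
def ofSeparated (x₀ x₁ y₀ y₁ : Fin n → ℝ) (hx : ∀ i, x₀ i < x₁ i) (hy : ∀ i, y₀ i < y₁ i)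
    (h : ∀ i j, i ≠ j → x₁ i ≤ x₀ j ∨ x₁ j ≤ x₀ i ∨ y₁ i ≤ y₀ j ∨ y₁ j ≤ y₀ i) : Floorplan n where
  x₀ := x₀
  x₁ := x₁
  y₀ := y₀
  y₁ := y₁
  hx := hx
  hy := hy
  interiors_disjoint i j hij := by
    rw [Set.disjoint_prod, Set.Ioo_disjoint_Ioo, Set.Ioo_disjoint_Ioo, min_le_iff, le_max_iff,
      le_max_iff, min_le_iff, le_max_iff, le_max_iff]
    rcases h i j hij with h | h | h | h <;> simp [h]

/-- The floorplan turned by a quarter, so that the top becomes the left. -/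
def rot (F : Floorplan n) : Floorplan n :=
  ofSeparated (fun i => -F.y₁ i) (fun i => -F.y₀ i) F.x₀ F.x₁ (fun i => neg_lt_neg (F.hy i)) F.hx
    fun i j h => by
      rcases F.separated h with h | h | h | h <;> simp [h]

/-- The floorplan turned upside down by a reflection. -/
def flip (F : Floorplan n) : Floorplan n :=
  ofSeparated F.x₀ F.x₁ (fun i => -F.y₁ i) (fun i => -F.y₀ i) F.hx (fun i => neg_lt_neg (F.hy i))
    fun i j h => by
      rcases F.separated h with h | h | h | h <;> simp [h]

theorem leftAdj_rot (F : Floorplan n) (i j : Fin n) : F.rot.LeftAdj i j ↔ F.AboveAdj i j := by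
  simp [LeftAdj, AboveAdj, rot, ofSeparated]

theorem leftAdj_flip (F : Floorplan n) (i j : Fin n) : F.flip.LeftAdj i j ↔ F.LeftAdj i j := by
  simp [LeftAdj, flip, ofSeparated]
  tauto

theorem aboveAdj_flip (F : Floorplan n) (i j : Fin n) : F.flip.AboveAdj i j ↔ F.AboveAdj j i := by
  simp [AboveAdj, flip, ofSeparated]
  rw [eq_comm]
  tauto

theorem arc_mds (F : Floorplan n) (i j : Fin n) : F.Arc .mds i j ↔ F.flip.Arc .mis i j := by
  simp [Arc, leftAdj_flip, aboveAdj_flip]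

/-! ### Counting edges and corners -/

open Classical in
/-- The edges with a vertical boundary segment. -/
noncomputable def vertEdges (F : Floorplan n) : Finset (Fin n × Fin n) :=
  univ.filter fun p => F.LeftAdj p.1 p.2

/-- An edge is charged to the block whose top is the upper end of the shared segment, tagged by the
side on which that block lies. The partners in two edges with the same charge would overlap just
below that top, so they coincide. -/
theorem card_vertEdges_le (F : Floorplan n) : F.vertEdges.card ≤ 2 * n := by
  classical
  have : (univ : Finset (Fin n ⊕ Fin n)).card = 2 * n := by simp; ring
  rw [← this]
  refine card_le_card_of_injOn
    (fun p => if F.y₁ p.1 ≤ F.y₁ p.2 then Sum.inl p.1 else Sum.inr p.2) (fun _ _ => mem_univ _) ?_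
  rintro ⟨i, j⟩ hp ⟨i', j'⟩ hq h
  simp only [vertEdges, coe_filter, mem_univ, true_and, Set.mem_ofPred_eq, LeftAdj, max_lt_iff,
    lt_min_iff] at hp hq
  obtain ⟨hx, ⟨_, _⟩, _, _⟩ := hp
  obtain ⟨hx', ⟨_, _⟩, _, _⟩ := hq
  have := F.hx i
  have := F.hx i'
  have := F.hx j
  have := F.hx j'
  dsimp only at h
  split_ifs at h with h₁ h₂ h₂
  · obtain rfl : i = i' := Sum.inl.inj h
    by_contra hne
    have hne : j ≠ j' := fun h => hne (by rw [h])
    rcases F.separated hne with h | h | h | h <;> linarith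
  · obtain rfl : j = j' := Sum.inr.inj h
    by_contra hne
    have hne : i ≠ i' := fun h => hne (by rw [h])
    rcases F.separated hne with h | h | h | h <;> linarith

theorem card_edges_le (F : Floorplan n) (st : StairType) : (F.edges st).card ≤ 4 * n := by
  classical
  have key : ∀ st, ∃ S : Finset (Fin n × Fin n), S.card ≤ 2 * n ∧ F.edges st ⊆ F.vertEdges ∪ S := by
    rintro (_ | _)
    · refine ⟨F.rot.vertEdges, F.rot.card_vertEdges_le, ?_⟩
      rintro ⟨i, j⟩ hp
      simp only [mem_union, vertEdges, mem_filter, mem_univ, true_and, leftAdj_rot]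
      exact (mem_filter.1 hp).2
    -- For decreasing staircases the horizontal arcs run upwards, so the pairs are reversed.
    · refine ⟨F.rot.vertEdges.image Prod.swap, card_image_le.trans F.rot.card_vertEdges_le, ?_⟩
      rintro ⟨i, j⟩ hp
      simp only [mem_union, vertEdges, mem_filter, mem_univ, true_and, leftAdj_rot, mem_image]
      exact (mem_filter.1 hp).2.imp_right fun h => ⟨(j, i), h, rfl⟩
  obtain ⟨S, hS, hsub⟩ := key st
  calc _ ≤ _ := card_le_card hsub
    _ ≤ _ := card_union_le _ _
    _ ≤ 4 * n := by linarith [F.card_vertEdges_le]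

theorem segLo_swap (F : Floorplan n) (p : Fin n × Fin n) : F.segLo p.swap = F.segLo p := by
  simp [segLo, max_comm]

theorem segHi_swap (F : Floorplan n) (p : Fin n × Fin n) : F.segHi p.swap = F.segHi p := by
  simp [segHi, min_comm]

/-- Both segments run to the right from the same point, so the two upper blocks overlap just above
the common line, and the two lower blocks just below it. -/
theorem eq_of_segLo_eq {F : Floorplan n} {p q : Fin n × Fin n} (hp : F.AboveAdj p.1 p.2)
    (hq : F.AboveAdj q.1 q.2) (h : F.segLo p = F.segLo q) : p = q := by
  obtain ⟨i, j⟩ := p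
  obtain ⟨i', j'⟩ := q
  simp only [AboveAdj, segLo, Prod.mk.injEq] at hp hq h
  obtain ⟨hy, ho⟩ := hp
  obtain ⟨hy', ho'⟩ := hq
  have h₁ := F.hy i
  have h₂ := F.hy j
  have h₃ := F.hy i'
  have h₄ := F.hy j'
  rw [max_eq_left (a := F.y₀ i) (by linarith), max_eq_left (a := F.y₀ i') (by linarith)] at h
  obtain ⟨hm, h⟩ := h
  rw [lt_min_iff] at ho ho'
  have a₁ := le_max_left (F.x₀ i) (F.x₀ j)
  have a₂ := le_max_right (F.x₀ i) (F.x₀ j)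
  have a₃ := le_max_left (F.x₀ i') (F.x₀ j')
  have a₄ := le_max_right (F.x₀ i') (F.x₀ j')
  rw [← hm] at a₃ a₄ ho'
  congr 1
  · by_contra hne
    rcases F.separated hne with h | h | h | h <;> linarith
  · by_contra hne
    rcases F.separated hne with h | h | h | h <;> linarith

theorem eq_of_segHi_eq {F : Floorplan n} {p q : Fin n × Fin n} (hp : F.AboveAdj p.1 p.2)
    (hq : F.AboveAdj q.1 q.2) (h : F.segHi p = F.segHi q) : p = q := by
  obtain ⟨i, j⟩ := p
  obtain ⟨i', j'⟩ := q
  simp only [AboveAdj, segHi, Prod.mk.injEq] at hp hq h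
  obtain ⟨hy, ho⟩ := hp
  obtain ⟨hy', ho'⟩ := hq
  have h₁ := F.hy i
  have h₂ := F.hy j
  have h₃ := F.hy i'
  have h₄ := F.hy j'
  rw [min_eq_right (b := F.y₁ j) (by linarith), min_eq_right (b := F.y₁ j') (by linarith)] at h
  obtain ⟨hm, h⟩ := h
  rw [max_lt_iff] at ho ho'
  have a₁ := min_le_left (F.x₁ i) (F.x₁ j)
  have a₂ := min_le_right (F.x₁ i) (F.x₁ j)
  have a₃ := min_le_left (F.x₁ i') (F.x₁ j')
  have a₄ := min_le_right (F.x₁ i') (F.x₁ j')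
  rw [← hm] at a₃ a₄ ho'
  congr 1
  · by_contra hne
    rcases F.separated hne with h | h | h | h <;> linarith
  · by_contra hne
    rcases F.separated hne with h | h | h | h <;> linarith

theorem horizontal_edge_eq {F : Floorplan n} {st : StairType} {p q : Fin n × Fin n}
    (hp : F.Arc st p.1 p.2) (hp' : ¬ F.LeftAdj p.1 p.2)
    (hq : F.Arc st q.1 q.2) (hq' : ¬ F.LeftAdj q.1 q.2)
    (h : F.segLo p = F.segLo q ∨ F.segHi p = F.segHi q) : p = q := by
  cases st
  · have hp := hp.resolve_left hp'
    have hq := hq.resolve_left hq'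
    exact h.elim (eq_of_segLo_eq hp hq) (eq_of_segHi_eq hp hq)
  · have hp : F.AboveAdj p.swap.1 p.swap.2 := hp.resolve_left hp'
    have hq : F.AboveAdj q.swap.1 q.swap.2 := hq.resolve_left hq'
    rw [← F.segLo_swap p, ← F.segLo_swap q, ← F.segHi_swap p, ← F.segHi_swap q] at h
    exact Prod.swap_injective (h.elim (eq_of_segLo_eq hp hq) (eq_of_segHi_eq hp hq))

theorem card_corners_le (F : Floorplan n) (st : StairType) : (F.corners st).card ≤ 8 * n := by
  classical
  -- `P` selects an end of the vertical segment and `Q` one of the horizontal segment. For a fixed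
  -- selection the vertical edge determines the horizontal one, so the first projection is
  -- injective; the four selections give `4 * 2n`.
  have key : ∀ (P Q : Fin n × Fin n → ℝ × ℝ),
      (Q = F.segLo ∨ Q = F.segHi) →
      ((F.corners st).filter fun c => P c.1 = Q c.2).card ≤ 2 * n := by
    intro P Q hQ
    refine (card_le_card_of_injOn Prod.fst ?_ ?_).trans F.card_vertEdges_le
    · rintro ⟨p, q⟩ h
      simp only [corners, coe_filter, mem_filter, Set.mem_ofPred_eq] at h
      simp [vertEdges, h.1.2.1]
    · rintro ⟨p, q⟩ h ⟨p', q'⟩ h' (rfl : p = p')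
      simp only [corners, edges, coe_filter, mem_filter, mem_product, Set.mem_ofPred_eq, mem_univ,
        true_and] at h h'
      have : q = q' := by
        refine horizontal_edge_eq h.1.1.2 h.1.2.2.1 h'.1.1.2 h'.1.2.2.1 ?_
        rcases hQ with rfl | rfl
        · exact .inl (h.2.symm.trans h'.2)
        · exact .inr (h.2.symm.trans h'.2)
      rw [this]
  have hsub : F.corners st ⊆
      (((F.corners st).filter fun c => F.segLo c.1 = F.segLo c.2) ∪
        ((F.corners st).filter fun c => F.segLo c.1 = F.segHi c.2)) ∪
      (((F.corners st).filter fun c => F.segHi c.1 = F.segLo c.2) ∪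
        ((F.corners st).filter fun c => F.segHi c.1 = F.segHi c.2)) := by
    intro c hc
    have : F.Meet c.1 c.2 := (mem_filter.1 hc).2.2.2
    simp only [mem_union, mem_filter, hc, true_and]
    unfold Meet at this
    tauto
  refine (card_le_card hsub).trans ((card_union_le _ _).trans ?_)
  have h₁ := card_union_le ((F.corners st).filter fun c => F.segLo c.1 = F.segLo c.2)
    ((F.corners st).filter fun c => F.segLo c.1 = F.segHi c.2)
  have h₂ := card_union_le ((F.corners st).filter fun c => F.segHi c.1 = F.segLo c.2)
    ((F.corners st).filter fun c => F.segHi c.1 = F.segHi c.2)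
  linarith [key F.segLo F.segLo (.inl rfl), key F.segLo F.segHi (.inr rfl),
    key F.segHi F.segLo (.inl rfl), key F.segHi F.segHi (.inr rfl)]

/-! ### Acyclicity -/

/-- Block `i` comes before block `j` on some line in the direction `(1, -1)` that meets the
interiors of both. -/
def Before (F : Floorplan n) (i j : Fin n) : Prop :=
  F.x₀ i + F.y₀ i < F.x₁ j + F.y₁ j ∧ F.x₀ j + F.y₀ j < F.x₁ i + F.y₁ i ∧
    (F.x₁ i ≤ F.x₀ j ∨ F.y₁ j ≤ F.y₀ i)

theorem Before.asymm {F : Floorplan n} {i j : Fin n} (h : F.Before i j) : ¬ F.Before j i := by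
  obtain ⟨h₁, h₂, h₃⟩ := h
  rintro ⟨h₄, h₅, h₆⟩
  have := F.hx i
  have := F.hx j
  have := F.hy i
  have := F.hy j
  rcases h₃ with h₃ | h₃ <;> rcases h₆ with h₆ | h₆ <;> linarith

theorem Before.of_arc {F : Floorplan n} {i j : Fin n} (h : F.Arc .mis i j) : F.Before i j := by
  have := F.hx i
  have := F.hx j
  have := F.hy i
  have := F.hy j
  rcases h with ⟨h, ho⟩ | ⟨h, ho⟩ <;> simp only [max_lt_iff, lt_min_iff] at ho <;>
    obtain ⟨⟨_, _⟩, _, _⟩ := ho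
  · exact ⟨by linarith, by linarith, .inl h.le⟩
  · exact ⟨by linarith, by linarith, .inr h.ge⟩

/-- The relation is not transitive in general, since the two comparisons may use different lines. If
the upper right corner of the middle block has the smallest `x + y`, then a line just below that
corner meets all three interiors, and the order on this one line is transitive. -/
theorem Before.trans_of_le {F : Floorplan n} {i j l : Fin n} (hij : F.Before i j)
    (hjl : F.Before j l) (hi : F.x₁ j + F.y₁ j ≤ F.x₁ i + F.y₁ i)
    (hl : F.x₁ j + F.y₁ j ≤ F.x₁ l + F.y₁ l) : F.Before i l := by
  have hne : i ≠ l := by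
    rintro rfl
    exact hij.asymm hjl
  obtain ⟨h₁, h₂, h₃⟩ := hij
  obtain ⟨h₄, h₅, h₆⟩ := hjl
  refine ⟨by linarith, by linarith, ?_⟩
  have := F.hx i
  have := F.hx j
  have := F.hx l
  have := F.hy i
  have := F.hy j
  have := F.hy l
  rcases F.separated hne with h | h | h | h
  · exact .inl h
  · rcases h₃ with h₃ | h₃ <;> rcases h₆ with h₆ | h₆
    · linarith
    · linarith
    · linarith
    · right; linarith
  · rcases h₃ with h₃ | h₃ <;> rcases h₆ with h₆ | h₆
    · left; linarith
    · linarith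
    · linarith
    · linarith
  · exact .inr h

/-- Induction that removes the block `b` with the smallest `x + y` at its upper right corner. If `b`
precedes a minimal block `a` of the rest, then `b` is itself minimal: anything before `b` would be
before `a` by `Before.trans_of_le`. Otherwise `a` stays minimal. -/
theorem exists_forall_not_before (F : Floorplan n) (R : Finset (Fin n)) (hR : R.Nonempty) :
    ∃ v ∈ R, ∀ u ∈ R, ¬ F.Before u v := by
  induction h : R.card generalizing R with
  | zero => simp_all
  | succ m ih =>
    obtain ⟨b, hb, hmin⟩ := R.exists_min_image (fun i => F.x₁ i + F.y₁ i) hR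
    have irrefl : ∀ i, ¬ F.Before i i := fun i hi => hi.asymm hi
    by_cases hR' : (R.erase b).Nonempty
    · obtain ⟨a, ha, hamin⟩ := ih (R.erase b) hR' (by rw [card_erase_of_mem hb, h]; rfl)
      by_cases hba : F.Before b a
      · refine ⟨b, hb, fun u hu hub => ?_⟩
        have hne : u ≠ b := by
          rintro rfl
          exact irrefl _ hub
        exact hamin u (mem_erase.2 ⟨hne, hu⟩)
          (hub.trans_of_le hba (hmin u hu) (hmin a (mem_of_mem_erase ha)))
      · refine ⟨a, mem_of_mem_erase ha, fun u hu => ?_⟩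
        by_cases hub : u = b
        · rwa [hub]
        · exact hamin u (mem_erase.2 ⟨hub, hu⟩)
    · refine ⟨b, hb, fun u hu => ?_⟩
      have : u = b := by
        by_contra hne
        exact hR' ⟨u, mem_erase.2 ⟨hne, hu⟩⟩
      rw [this]
      exact irrefl b

/-- Every nonempty set of blocks contains a block that no arc from the set enters. -/
theorem exists_no_arc_into (F : Floorplan n) (st : StairType) (R : Finset (Fin n))
    (hR : R.Nonempty) : ∃ v ∈ R, ∀ u, F.Arc st u v → u ∉ R := by
  cases st with
  | mis =>
    obtain ⟨v, hv, h⟩ := F.exists_forall_not_before R hR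
    exact ⟨v, hv, fun u hu hR => h u hR (.of_arc hu)⟩
  | mds =>
    obtain ⟨v, hv, h⟩ := F.flip.exists_forall_not_before R hR
    exact ⟨v, hv, fun u hu hR => h u hR (.of_arc ((F.arc_mds u v).1 hu))⟩

/-! ### The source of a dissected rectangle -/

/-- A point slightly to the left of block `j`, at a generic height within `j`, is covered by some
block, and this block must be a left neighbour. -/
theorem Dissects.exists_leftAdj {F : Floorplan n} {X₀ X₁ Y₀ Y₁ : ℝ} (h : F.Dissects X₀ X₁ Y₀ Y₁)
    {j : Fin n} (hj : X₀ < F.x₀ j) : ∃ i, F.LeftAdj i j := by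
  obtain ⟨_, _, hU⟩ := h
  have hsub : F.block j ⊆ Set.Icc X₀ X₁ ×ˢ Set.Icc Y₀ Y₁ := hU ▸ Set.subset_iUnion F.block j
  have hfin : (Set.range F.y₀ ∪ Set.range F.y₁).Finite :=
    (Set.finite_range _).union (Set.finite_range _)
  -- Avoiding the finitely many block boundaries puts `y` strictly inside the height of the covering
  -- block, so the shared segment has positive length.
  obtain ⟨y, ⟨hy₀, hy₁⟩, hy⟩ := ((Set.Ioo_infinite (F.hy j)).sdiff hfin).nonempty
  simp only [Set.mem_union, Set.mem_range, not_or, not_exists] at hy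
  -- The point lies so close to `j` that any block whose right side is not left of it reaches at
  -- least to the left side of `j`.
  have hev : ∀ᶠ x in nhdsWithin (F.x₀ j) (Set.Iio (F.x₀ j)),
      (∀ i, F.x₁ i < x ∨ F.x₀ j ≤ F.x₁ i) ∧ X₀ < x ∧ x < F.x₀ j := by
    refine Filter.Eventually.and (Filter.eventually_all.2 fun i => ?_) (Filter.Eventually.and ?_ ?_)
    · rcases lt_or_ge (F.x₁ i) (F.x₀ j) with hi | hi
      · exact (eventually_nhdsWithin_of_eventually_nhds (eventually_gt_nhds hi)).mono
          fun _ => .inl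
      · exact Filter.Eventually.of_forall fun _ => .inr hi
    · exact eventually_nhdsWithin_of_eventually_nhds (eventually_gt_nhds hj)
    · exact self_mem_nhdsWithin
  obtain ⟨x, hx, hx₀, hx₁⟩ := hev.exists
  have hb₀ : (F.x₀ j, y) ∈ F.block j := ⟨⟨le_rfl, (F.hx j).le⟩, hy₀.le, hy₁.le⟩
  obtain ⟨⟨_, hX⟩, hY⟩ := hsub hb₀
  have hxy : (x, y) ∈ ⋃ i, F.block i := by
    rw [hU]
    exact ⟨⟨hx₀.le, hx₁.le.trans hX⟩, hY⟩
  obtain ⟨i, ⟨hi₁, hi₂⟩, hi₃, hi₄⟩ := Set.mem_iUnion.1 hxy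
  dsimp only at hi₁ hi₂ hi₃ hi₄
  have h₁ := (hx i).resolve_left (not_lt.2 hi₂)
  have h₂ := lt_of_le_of_ne hi₃ (hy.1 i)
  have h₃ := lt_of_le_of_ne hi₄ (Ne.symm (hy.2 i))
  have hne : i ≠ j := by
    rintro rfl
    linarith
  have := F.hx i
  have := F.hx j
  refine ⟨i, ?_, max_lt (lt_min (F.hy i) (by linarith)) (lt_min (by linarith) (F.hy j))⟩
  rcases F.separated hne with h | h | h | h <;> linarith

theorem Dissects.rot {F : Floorplan n} {X₀ X₁ Y₀ Y₁ : ℝ} (h : F.Dissects X₀ X₁ Y₀ Y₁) :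
    F.rot.Dissects (-Y₁) (-Y₀) X₀ X₁ := by
  obtain ⟨hX, hY, hU⟩ := h
  refine ⟨neg_lt_neg hY, hX, ?_⟩
  ext ⟨x, y⟩
  -- The quarter turn sends `(y, -x)` to `(x, y)`.
  have := Set.ext_iff.1 hU (y, -x)
  simp only [Set.mem_iUnion, block, Set.mem_prod, Set.mem_Icc, Floorplan.rot, ofSeparated] at this ⊢
  simp only [le_neg, neg_le] at this ⊢
  simp only [and_comm, and_assoc] at this ⊢
  exact this

theorem Dissects.flip {F : Floorplan n} {X₀ X₁ Y₀ Y₁ : ℝ} (h : F.Dissects X₀ X₁ Y₀ Y₁) :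
    F.flip.Dissects X₀ X₁ (-Y₁) (-Y₀) := by
  obtain ⟨hX, hY, hU⟩ := h
  refine ⟨hX, neg_lt_neg hY, ?_⟩
  ext ⟨x, y⟩
  have := Set.ext_iff.1 hU (x, -y)
  simp only [Set.mem_iUnion, block, Set.mem_prod, Set.mem_Icc, Floorplan.flip, ofSeparated] at this ⊢
  simp only [le_neg, neg_le] at this ⊢
  simp only [and_comm, and_assoc] at this ⊢
  exact this

theorem Dissects.exists_isSource_mis {F : Floorplan n} {X₀ X₁ Y₀ Y₁ : ℝ}
    (h : F.Dissects X₀ X₁ Y₀ Y₁) : ∃ s, (X₀, Y₁) ∈ F.block s ∧ F.IsSource .mis s := by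
  have hsub : ∀ j, X₀ ≤ F.x₀ j ∧ F.y₁ j ≤ Y₁ := by
    intro j
    have hj : F.block j ⊆ Set.Icc X₀ X₁ ×ˢ Set.Icc Y₀ Y₁ := h.2.2 ▸ Set.subset_iUnion F.block j
    have : (F.x₀ j, F.y₁ j) ∈ F.block j := ⟨⟨le_rfl, (F.hx j).le⟩, (F.hy j).le, le_rfl⟩
    exact ⟨(hj this).1.1, (hj this).2.2⟩
  have hcor : (X₀, Y₁) ∈ ⋃ i, F.block i := by
    rw [h.2.2]
    exact ⟨⟨le_rfl, h.1.le⟩, h.2.1.le, le_rfl⟩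
  obtain ⟨s, hs⟩ := Set.mem_iUnion.1 hcor
  have hsx : F.x₀ s = X₀ := le_antisymm hs.1.1 (hsub s).1
  have hsy : F.y₁ s = Y₁ := le_antisymm (hsub s).2 hs.2.2
  refine ⟨s, hs, ?_, ?_⟩
  · rintro i (⟨hi, _⟩ | ⟨hi, _⟩)
    · linarith [F.hx i, (hsub i).1]
    · linarith [F.hy i, (hsub i).2]
  · intro j hj
    rcases (hsub j).1.lt_or_eq with hx | hx
    · obtain ⟨i, hi⟩ := h.exists_leftAdj hx
      exact ⟨i, .inl hi⟩
    · rcases (hsub j).2.lt_or_eq with hy | hy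
      · obtain ⟨i, hi⟩ := h.rot.exists_leftAdj (j := j) (neg_lt_neg hy)
        exact ⟨i, .inr ((F.leftAdj_rot i j).1 hi)⟩
      -- A second block touching both the left side and the top would overlap `s` near the corner.
      · have := F.hx j
        have := F.hx s
        have := F.hy j
        have := F.hy s
        rcases F.separated hj with h | h | h | h <;> linarith

theorem Dissects.exists_isSource {F : Floorplan n} {X₀ X₁ Y₀ Y₁ : ℝ}
    (h : F.Dissects X₀ X₁ Y₀ Y₁) (st : StairType) :
    ∃ s, sourceCorner X₀ Y₀ Y₁ st ∈ F.block s ∧ F.IsSource st s := by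
  cases st with
  | mis => exact h.exists_isSource_mis
  | mds =>
    obtain ⟨s, hs, hsrc⟩ := h.flip.exists_isSource_mis
    refine ⟨s, ?_, ?_⟩
    · simp only [block, Set.mem_prod, Set.mem_Icc, sourceCorner, Floorplan.flip, ofSeparated,
        neg_le_neg_iff] at hs ⊢
      tauto
    · simpa only [IsSource, arc_mds] using hsrc

end Floorplan

/-! ### A calculus for total correctness and running time. -/

namespace RealRAM

/-! ### Reading updated memory -/

section Store
variable (σ : Store) (x y : NVar) (u w : RVar) (a b : NArr) (d e : RArr) (p q c i j : ℕ) (r : ℝ)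

@[simp] theorem Store.setN_nat : (σ.setN x c).nat y = if y = x then c else σ.nat y := by
  simp [Store.setN, Function.update_apply]
@[simp] theorem Store.setN_real : (σ.setN x c).real = σ.real := rfl
@[simp] theorem Store.setN_natArr : (σ.setN x c).natArr = σ.natArr := rfl
@[simp] theorem Store.setN_realArr : (σ.setN x c).realArr = σ.realArr := rfl

@[simp] theorem Store.setR_real : (σ.setR u r).real w = if w = u then r else σ.real w := by
  simp [Store.setR, Function.update_apply]
@[simp] theorem Store.setR_nat : (σ.setR u r).nat = σ.nat := rfl
@[simp] theorem Store.setR_natArr : (σ.setR u r).natArr = σ.natArr := rfl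
@[simp] theorem Store.setR_realArr : (σ.setR u r).realArr = σ.realArr := rfl

@[simp] theorem Store.setNA_natArr : (σ.setNA a p q c).natArr b i j =
    if b = a ∧ i = p ∧ j = q then c else σ.natArr b i j := by
  by_cases hb : b = a
  · subst hb
    by_cases hi : i = p
    · subst hi
      simp [Store.setNA, Function.update_apply]
    · simp [Store.setNA, hi]
  · simp [Store.setNA, hb]
@[simp] theorem Store.setNA_nat : (σ.setNA a p q c).nat = σ.nat := rfl
@[simp] theorem Store.setNA_real : (σ.setNA a p q c).real = σ.real := rfl
@[simp] theorem Store.setNA_realArr : (σ.setNA a p q c).realArr = σ.realArr := rfl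

@[simp] theorem Store.setRA_realArr : (σ.setRA d p q r).realArr e i j =
    if e = d ∧ i = p ∧ j = q then r else σ.realArr e i j := by
  by_cases hb : e = d
  · subst hb
    by_cases hi : i = p
    · subst hi
      simp [Store.setRA, Function.update_apply]
    · simp [Store.setRA, hi]
  · simp [Store.setRA, hb]
@[simp] theorem Store.setRA_nat : (σ.setRA d p q r).nat = σ.nat := rfl
@[simp] theorem Store.setRA_real : (σ.setRA d p q r).real = σ.real := rfl
@[simp] theorem Store.setRA_natArr : (σ.setRA d p q r).natArr = σ.natArr := rfl

end Store

attribute [simp] NExp.eval RExp.eval BExp.Holds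

/-! ### What a program can write -/

/-- The natural number registers that a program can write. -/
def Com.natW : Com → List NVar
  | setN x _ => [x]
  | rand x _ => [x]
  | seq c d => c.natW ++ d.natW
  | ite _ c d => c.natW ++ d.natW
  | loop _ c => c.natW
  | _ => []

/-- The real registers that a program can write. -/
def Com.realW : Com → List RVar
  | setR x _ => [x]
  | seq c d => c.realW ++ d.realW
  | ite _ c d => c.realW ++ d.realW
  | loop _ c => c.realW
  | _ => []

/-- The arrays of natural numbers that a program can write. -/
def Com.natArrW : Com → List NArr
  | setNA a _ _ _ => [a]
  | seq c d => c.natArrW ++ d.natArrW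
  | ite _ c d => c.natArrW ++ d.natArrW
  | loop _ c => c.natArrW
  | _ => []

/-- The arrays of reals that a program can write. -/
def Com.realArrW : Com → List RArr
  | setRA a _ _ _ => [a]
  | seq c d => c.realArrW ++ d.realArrW
  | ite _ c d => c.realArrW ++ d.realArrW
  | loop _ c => c.realArrW
  | _ => []

/-- The memories agree except where the program can write. -/
structure Frame (c : Com) (σ τ : Store) : Prop where
  nat : ∀ x, x ∉ c.natW → τ.nat x = σ.nat x
  real : ∀ x, x ∉ c.realW → τ.real x = σ.real x
  natArr : ∀ a, a ∉ c.natArrW → τ.natArr a = σ.natArr a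
  realArr : ∀ a, a ∉ c.realArrW → τ.realArr a = σ.realArr a

theorem Frame.refl (c : Com) (σ : Store) : Frame c σ σ :=
  ⟨fun _ _ => rfl, fun _ _ => rfl, fun _ _ => rfl, fun _ _ => rfl⟩

theorem Frame.trans {c : Com} {σ τ υ : Store} (h : Frame c σ τ) (h' : Frame c τ υ) :
    Frame c σ υ :=
  ⟨fun x hx => (h'.nat x hx).trans (h.nat x hx), fun x hx => (h'.real x hx).trans (h.real x hx),
    fun x hx => (h'.natArr x hx).trans (h.natArr x hx),
    fun x hx => (h'.realArr x hx).trans (h.realArr x hx)⟩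

theorem Frame.mono {c d : Com} {σ τ : Store} (h : Frame c σ τ) (h₁ : c.natW ⊆ d.natW)
    (h₂ : c.realW ⊆ d.realW) (h₃ : c.natArrW ⊆ d.natArrW) (h₄ : c.realArrW ⊆ d.realArrW) :
    Frame d σ τ :=
  ⟨fun x hx => h.nat x fun hc => hx (h₁ hc), fun x hx => h.real x fun hc => hx (h₂ hc),
    fun x hx => h.natArr x fun hc => hx (h₃ hc), fun x hx => h.realArr x fun hc => hx (h₄ hc)⟩

/-- The write sets are syntactic, so membership is settled by `decide`. Every later transfer of an
invariant across a subroutine uses this. -/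
theorem Exec.frame {ω : Random} {c : Com} {σ τ : Store} {t : ℕ} (h : Exec ω c σ t τ) :
    Frame c σ τ := by
  induction h with
  | setN x p σ =>
    exact ⟨fun y hy => by simp_all [Com.natW], fun _ _ => rfl, fun _ _ => rfl, fun _ _ => rfl⟩
  | setR x p σ =>
    exact ⟨fun _ _ => rfl, fun y hy => by simp_all [Com.realW], fun _ _ => rfl, fun _ _ => rfl⟩
  | setNA a p q v σ =>
    exact ⟨fun _ _ => rfl, fun _ _ => rfl, fun y hy => by
      ext i j
      simp_all [Com.natArrW], fun _ _ => rfl⟩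
  | setRA a p q v σ =>
    exact ⟨fun _ _ => rfl, fun _ _ => rfl, fun _ _ => rfl, fun y hy => by
      ext i j
      simp_all [Com.realArrW]⟩
  | rand x p σ =>
    refine ⟨fun y hy => ?_, fun _ _ => rfl, fun _ _ => rfl, fun _ _ => rfl⟩
    have : y ≠ x := by simpa [Com.natW] using hy
    simp [this]
  | seq _ _ ih₁ ih₂ =>
    refine (ih₁.mono ?_ ?_ ?_ ?_).trans (ih₂.mono ?_ ?_ ?_ ?_) <;>
      simp [Com.natW, Com.realW, Com.natArrW, Com.realArrW]
  | skip σ => exact .refl _ _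
  | iteTrue _ _ _ ih | iteFalse _ _ _ ih =>
    refine ih.mono ?_ ?_ ?_ ?_ <;> simp [Com.natW, Com.realW, Com.natArrW, Com.realArrW]
  | loopTrue _ _ _ ih₁ ih₂ =>
    exact Frame.trans ⟨ih₁.nat, ih₁.real, ih₁.natArr, ih₁.realArr⟩ ih₂
  | loopFalse => exact .refl _ _

/-! ### Programs without loops -/

/-- The program has no loops. -/
def Com.straight : Com → Bool
  | seq c d => c.straight && d.straight
  | ite _ c d => c.straight && d.straight
  | loop _ _ => false
  | _ => true

/-- A bound for the running time of a program without loops. -/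
def Com.bound : Com → ℕ
  | setN _ p => p.cost + 1
  | setR _ p => p.cost + 1
  | setNA _ p q v => p.cost + q.cost + v.cost + 1
  | setRA _ p q v => p.cost + q.cost + v.cost + 1
  | rand _ p => p.cost + 1
  | seq c d => c.bound + d.bound
  | skip => 1
  | ite b c d => b.cost + 1 + max c.bound d.bound
  | loop _ _ => 0

/-- Separates time from correctness: for loop-free code the cost is bounded by a computed constant,
and the postcondition can be proved without tracking the branch taken. -/
theorem Exec.le_bound {ω : Random} {c : Com} {σ τ : Store} {t : ℕ} (h : Exec ω c σ t τ)
    (hc : c.straight) : t ≤ c.bound := by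
  induction h with
  | seq _ _ ih₁ ih₂ =>
    simp only [Com.straight, Bool.and_eq_true] at hc
    exact add_le_add (ih₁ hc.1) (ih₂ hc.2)
  | iteTrue _ _ _ ih =>
    simp only [Com.straight, Bool.and_eq_true] at hc
    exact Nat.add_le_add_left ((ih hc.1).trans (le_max_left _ _)) _
  | iteFalse _ _ _ ih =>
    simp only [Com.straight, Bool.and_eq_true] at hc
    exact Nat.add_le_add_left ((ih hc.2).trans (le_max_right _ _)) _
  | loopTrue | loopFalse => simp [Com.straight] at hc
  | _ => exact le_rfl

/-! ### Total correctness -/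

/-- Started in `σ`, the program halts with a running time and a memory that satisfy `Q`. -/
def Runs (ω : Random) (c : Com) (σ : Store) (Q : ℕ → Store → Prop) : Prop :=
  ∃ t τ, Exec ω c σ t τ ∧ Q t τ

section Runs
variable {ω : Random} {b : BExp} {c d : Com} {σ : Store} {P Q : ℕ → Store → Prop}

theorem Runs.mono (h : Runs ω c σ P) (hPQ : ∀ t τ, Frame c σ τ → P t τ → Q t τ) :
    Runs ω c σ Q := by
  obtain ⟨t, τ, h, hP⟩ := h
  exact ⟨t, τ, h, hPQ t τ h.frame hP⟩

theorem Runs.of_straight {P : Store → Prop} (h : Runs ω c σ fun _ τ => P τ) (hc : c.straight)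
    {T : ℕ} (hT : c.bound ≤ T) : Runs ω c σ fun t τ => t ≤ T ∧ P τ := by
  obtain ⟨t, τ, h, hP⟩ := h
  exact ⟨t, τ, h, (h.le_bound hc).trans hT, hP⟩

@[simp] theorem runs_setN {x : NVar} {p : NExp} :
    Runs ω (.setN x p) σ Q ↔ Q (p.cost + 1) (σ.setN x (p.eval σ)) := by
  constructor
  · rintro ⟨_, _, ⟨⟩, h⟩
    exact h
  · exact fun h => ⟨_, _, .setN x p σ, h⟩

@[simp] theorem runs_setR {x : RVar} {p : RExp} :
    Runs ω (.setR x p) σ Q ↔ Q (p.cost + 1) (σ.setR x (p.eval σ)) := by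
  constructor
  · rintro ⟨_, _, ⟨⟩, h⟩
    exact h
  · exact fun h => ⟨_, _, .setR x p σ, h⟩

@[simp] theorem runs_setNA {a : NArr} {p q v : NExp} : Runs ω (.setNA a p q v) σ Q ↔
    Q (p.cost + q.cost + v.cost + 1) (σ.setNA a (p.eval σ) (q.eval σ) (v.eval σ)) := by
  constructor
  · rintro ⟨_, _, ⟨⟩, h⟩
    exact h
  · exact fun h => ⟨_, _, .setNA a p q v σ, h⟩

@[simp] theorem runs_setRA {a : RArr} {p q : NExp} {v : RExp} : Runs ω (.setRA a p q v) σ Q ↔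
    Q (p.cost + q.cost + v.cost + 1) (σ.setRA a (p.eval σ) (q.eval σ) (v.eval σ)) := by
  constructor
  · rintro ⟨_, _, ⟨⟩, h⟩
    exact h
  · exact fun h => ⟨_, _, .setRA a p q v σ, h⟩

@[simp] theorem runs_skip : Runs ω .skip σ Q ↔ Q 1 σ := by
  constructor
  · rintro ⟨_, _, ⟨⟩, h⟩
    exact h
  · exact fun h => ⟨_, _, .skip σ, h⟩

@[simp] theorem runs_seq : Runs ω (.seq c d) σ Q ↔
    Runs ω c σ fun t τ => Runs ω d τ fun u υ => Q (t + u) υ := by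
  constructor
  · rintro ⟨_, _, h, hQ⟩
    cases h with
    | seq h₁ h₂ => exact ⟨_, _, h₁, _, _, h₂, hQ⟩
  · rintro ⟨_, _, h₁, _, _, h₂, h⟩
    exact ⟨_, _, .seq h₁ h₂, h⟩

@[simp] theorem runs_ite : Runs ω (.ite b c d) σ Q ↔
    (b.Holds σ → Runs ω c σ fun t τ => Q (b.cost + 1 + t) τ) ∧
    (¬ b.Holds σ → Runs ω d σ fun t τ => Q (b.cost + 1 + t) τ) := by
  constructor
  · rintro ⟨_, _, h, hQ⟩
    cases h with
    | iteTrue _ hb h => exact ⟨fun _ => ⟨_, _, h, hQ⟩, fun hb' => absurd hb hb'⟩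
    | iteFalse _ hb h => exact ⟨fun hb' => absurd hb' hb, fun _ => ⟨_, _, h, hQ⟩⟩
  · rintro ⟨h₁, h₂⟩
    by_cases hb : b.Holds σ
    · obtain ⟨t, τ, h, hQ⟩ := h₁ hb
      exact ⟨_, _, .iteTrue _ hb h, hQ⟩
    · obtain ⟨t, τ, h, hQ⟩ := h₂ hb
      exact ⟨_, _, .iteFalse _ hb h, hQ⟩

/-- Only the range of the drawn number is kept, so whatever is derived holds for every random
source. The `max` with 1 covers a request with bound 0, which is answered by 0. -/
theorem Runs.rand {x : NVar} {p : NExp}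
    (h : ∀ r < max (p.eval σ) 1, ∀ τ : Store, τ.nat = (σ.setN x r).nat → τ.real = σ.real →
      τ.natArr = σ.natArr → τ.realArr = σ.realArr → Q (p.cost + 1) τ) :
    Runs ω (.rand x p) σ Q := by
  refine ⟨_, _, .rand x p σ, h (ω σ.drawn (p.eval σ - 1)) ?_ _ rfl rfl rfl rfl⟩
  have := (ω σ.drawn (p.eval σ - 1)).2
  omega

theorem Runs.seq (hc : Runs ω c σ P)
    (hd : ∀ t τ, Frame c σ τ → P t τ → Runs ω d τ fun u υ => Q (t + u) υ) :
    Runs ω (.seq c d) σ Q :=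
  runs_seq.2 (hc.mono hd)

/-- The rule for loops, with an invariant that depends on the time that is left. -/
theorem Runs.loop {I : ℕ → Store → Prop} {φ : ℕ} (hI : I φ σ)
    (step : ∀ φ τ, Frame (.loop b c) σ τ → I φ τ → b.Holds τ →
      Runs ω c τ fun t υ => ∃ φ', I φ' υ ∧ t + (b.cost + 1) + φ' ≤ φ) :
    Runs ω (.loop b c) σ fun t τ =>
      ¬ b.Holds τ ∧ ∃ φ', I φ' τ ∧ t + φ' ≤ φ + (b.cost + 1) := by
  induction φ using Nat.strong_induction_on generalizing σ with
  | _ φ ih =>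
    by_cases hb : b.Holds σ
    · obtain ⟨t, υ, h, φ', hφ', hle⟩ := step φ σ (.refl _ _) hI hb
      have hf : Frame (.loop b c) σ υ := ⟨h.frame.nat, h.frame.real, h.frame.natArr, h.frame.realArr⟩
      -- Each iteration pays at least for its test, so the budget strictly decreases; this is the
      -- termination argument.
      obtain ⟨u, τ, h', hb', φ'', hφ'', hle'⟩ := ih φ' (by omega) hφ'
        fun φ τ hτ => step φ τ (hf.trans hτ)
      exact ⟨_, _, .loopTrue hb h h', hb', φ'', hφ'', by omega⟩
    · exact ⟨_, _, .loopFalse c hb, hb, φ, hI, by omega⟩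

/-- Per iteration the test and the increment cost 4 each, hence `T + 8`; the initialization (2) and
the last, failing test (4) give the 6. -/
theorem Runs.forUp {x bound : NVar} {m T : ℕ} {I : ℕ → Store → Prop}
    (hw : x ∉ c.natW ∧ bound ∉ c.natW ∧ x ≠ bound) (hm : σ.nat bound = m)
    (h0 : I 0 (σ.setN x 0))
    (step : ∀ i < m, ∀ τ, Frame (MSCut.forUp x bound c) σ τ → τ.nat x = i → I i τ →
      Runs ω c τ fun t υ => t ≤ T ∧ I (i + 1) (υ.setN x (i + 1))) :
    Runs ω (MSCut.forUp x bound c) σ fun t τ =>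
      t ≤ (T + 8) * m + 6 ∧ τ.nat x = m ∧ I m τ := by
  have hsub : Frame (.setN x (.lit 0)) σ (σ.setN x 0) := (Exec.setN (ω := ω) x (.lit 0) σ).frame
  have hfr : ∀ τ, Frame (.loop (.nlt (.var x) (.var bound)) (.seq c (MSCut.incr x)))
      (σ.setN x 0) τ → Frame (MSCut.forUp x bound c) σ τ := fun τ hτ => by
    refine (hsub.mono ?_ ?_ ?_ ?_).trans (hτ.mono ?_ ?_ ?_ ?_) <;>
      simp [Com.natW, Com.realW, Com.natArrW, Com.realArrW, MSCut.forUp]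
  refine runs_seq.2 (runs_setN.2 ?_)
  refine (Runs.loop (φ := (T + 8) * m) (I := fun φ τ => ∃ i ≤ m, τ.nat x = i ∧
    τ.nat bound = m ∧ I i τ ∧ φ = (T + 8) * (m - i)) ⟨0, by simp [h0, hm, hw.2.2.symm]⟩ ?_).mono ?_
  · rintro φ τ hτ ⟨i, hi, hx, hb, hI, rfl⟩ hlt
    simp only [BExp.Holds, NExp.eval, hx, hb] at hlt
    refine Runs.seq (step i hlt τ (hfr τ hτ) hx hI) ?_
    rintro t υ hυ ⟨ht, hI'⟩
    refine runs_setN.2 ⟨(T + 8) * (m - (i + 1)), ⟨i + 1, hlt, ?_, ?_, ?_, rfl⟩, ?_⟩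
    · simp [hυ.nat x hw.1, hx]
    · simp [hυ.nat bound hw.2.1, hb, hw.2.2.symm]
    · simpa [hυ.nat x hw.1, hx] using hI'
    · obtain ⟨q, rfl⟩ := Nat.exists_eq_add_of_lt hlt
      simp only [show i + q + 1 - i = q + 1 by omega, show i + q + 1 - (i + 1) = q by omega,
        NExp.cost, BExp.cost]
      linarith
  · rintro t τ - ⟨hnb, φ, ⟨i, hi, hx, hb, hI, rfl⟩, hle⟩
    simp only [BExp.Holds, NExp.eval, hx, hb, not_lt] at hnb
    obtain rfl : i = m := le_antisymm hi hnb
    refine ⟨?_, hx, hI⟩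
    simp only [BExp.cost, NExp.cost] at hle ⊢
    omega

theorem Runs.forUp_straight {x bound : NVar} {m T : ℕ} {I : ℕ → Store → Prop}
    (hc : c.straight) (hT : c.bound ≤ T)
    (hw : x ∉ c.natW ∧ bound ∉ c.natW ∧ x ≠ bound) (hm : σ.nat bound = m)
    (h0 : I 0 (σ.setN x 0))
    (step : ∀ i < m, ∀ τ, Frame (MSCut.forUp x bound c) σ τ → τ.nat x = i → I i τ →
      Runs ω c τ fun _ υ => I (i + 1) (υ.setN x (i + 1))) :
    Runs ω (MSCut.forUp x bound c) σ fun t τ =>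
      t ≤ (T + 8) * m + 6 ∧ τ.nat x = m ∧ I m τ :=
  Runs.forUp hw hm h0 fun i hi τ hτ hx hI => (step i hi τ hτ hx hI).of_straight hc hT

end Runs

end RealRAM

/-! ### Specifications of the subroutines. -/

namespace MSCut

open RealRAM

attribute [simp] at1 rat1 put1 rput1 incr MSCut.when

variable {ω : Random} {σ : Store}

/-! ### Counting loops -/

theorem runs_count {x bound cnt : NVar} {b : BExp} {m T : ℕ} {P : ℕ → Prop} [DecidablePred P]
    (hx : x ≠ cnt) (hbd : bound ≠ cnt) (hxb : x ≠ bound) (hm : σ.nat bound = m)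
    (h0 : σ.nat cnt = 0) (hT : (MSCut.when b (incr cnt)).bound ≤ T)
    (hb : ∀ i < m, ∀ τ, Frame (forUp x bound (MSCut.when b (incr cnt))) σ τ → τ.nat x = i →
      (b.Holds τ ↔ P i)) :
    Runs ω (forUp x bound (MSCut.when b (incr cnt))) σ fun t τ =>
      t ≤ (T + 8) * m + 6 ∧ τ.nat cnt = Nat.count P m := by
  refine (Runs.forUp_straight (I := fun i τ => τ.nat cnt = Nat.count P i) rfl hT
    (by simp [Com.natW, hx, hbd, hxb]) hm (by simp [hx.symm, h0]) ?_).mono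
    fun t τ _ h => ⟨h.1, h.2.2⟩
  intro i hi τ hτ hxi hI
  have := hb i hi τ hτ hxi
  simp only [MSCut.when, incr, runs_ite, runs_setN, runs_skip, this, Nat.count_succ]
  constructor <;> intro h <;> simp [h, hx.symm, hI]

theorem runs_countBends (σ : Store) : Runs ω countBends σ fun t τ =>
    t ≤ 40 * σ.nat .nEdge + 60 * σ.nat .nCorner + 20 ∧
    τ.nat .nCut = Nat.count (fun f => σ.natArr .inL (σ.natArr .src f 0) 0 = 1 ∧
      σ.natArr .inL (σ.natArr .dst f 0) 0 = 0) (σ.nat .nEdge) ∧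
    τ.nat .z = Nat.count (fun c =>
      (σ.natArr .inL (σ.natArr .src (σ.natArr .cornV c 0) 0) 0 = 1 ∧
        σ.natArr .inL (σ.natArr .dst (σ.natArr .cornV c 0) 0) 0 = 0) ∧
      (σ.natArr .inL (σ.natArr .src (σ.natArr .cornH c 0) 0) 0 = 1 ∧
        σ.natArr .inL (σ.natArr .dst (σ.natArr .cornH c 0) 0) 0 = 0)) (σ.nat .nCorner) := by
  rw [countBends, runs_seq, runs_setN]
  refine Runs.seq (runs_count (T := 32) (P := fun f => σ.natArr .inL (σ.natArr .src f 0) 0 = 1 ∧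
      σ.natArr .inL (σ.natArr .dst f 0) 0 = 0) (by decide) (by decide) (by decide) rfl (by simp)
      (by decide) ?_) ?_
  · intro i hi τ hτ hx
    simp [isCut, hx, hτ.natArr .inL (by decide), hτ.natArr .src (by decide),
      hτ.natArr .dst (by decide)]
  · rintro t τ hτ ⟨ht, hcut⟩
    rw [runs_seq, runs_setN]
    refine (runs_count (T := 52) (P := fun c =>
      (σ.natArr .inL (σ.natArr .src (σ.natArr .cornV c 0) 0) 0 = 1 ∧
        σ.natArr .inL (σ.natArr .dst (σ.natArr .cornV c 0) 0) 0 = 0) ∧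
      (σ.natArr .inL (σ.natArr .src (σ.natArr .cornH c 0) 0) 0 = 1 ∧
        σ.natArr .inL (σ.natArr .dst (σ.natArr .cornH c 0) 0) 0 = 0)) (by decide) (by decide)
      (by decide) rfl (by simp) (by decide) ?_).mono ?_
    · intro i hi υ hυ hx
      simp [isCut, hx, hυ.natArr .inL (by decide), hυ.natArr .src (by decide),
        hυ.natArr .dst (by decide), hτ.natArr .inL (by decide), hτ.natArr .src (by decide),
        hτ.natArr .dst (by decide), hυ.natArr .cornV (by decide), hυ.natArr .cornH (by decide),
        hτ.natArr .cornV (by decide), hτ.natArr .cornH (by decide)]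
    · rintro u υ hυ ⟨hu, hz⟩
      simp only [Store.setN_nat, hτ.nat .nCorner (by decide), reduceCtorEq, if_false] at hu hz ht
      refine ⟨by simp only [NExp.cost]; omega, ?_, hz⟩
      simpa [hυ.nat .nCut (by decide)] using hcut

theorem runs_netPartition (σ : Store) : Runs ω netPartition σ fun t τ =>
    t ≤ 60 * σ.nat .nNet + 10 ∧
    τ.nat .kc = Nat.count (fun j =>
      0 < σ.natArr .netLeft j 0 + σ.natArr .pin j (σ.nat .newV) ∧
      σ.natArr .netLeft j 0 + σ.natArr .pin j (σ.nat .newV) < σ.natArr .netDeg j 0)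
      (σ.nat .nNet) ∧
    ∀ j < σ.nat .nNet,
      τ.natArr .netLeft j 0 = σ.natArr .netLeft j 0 + σ.natArr .pin j (σ.nat .newV) := by
  rw [netPartition, runs_seq, runs_setN]
  refine (Runs.forUp_straight (T := 52) (I := fun i τ => τ.nat .kc = Nat.count (fun j =>
      0 < σ.natArr .netLeft j 0 + σ.natArr .pin j (σ.nat .newV) ∧
      σ.natArr .netLeft j 0 + σ.natArr .pin j (σ.nat .newV) < σ.natArr .netDeg j 0) i ∧
    -- Nets from position `i` on still have their old counters, which is what the body reads when it
    -- reaches them.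
    ∀ j, τ.natArr .netLeft j 0 = σ.natArr .netLeft j 0 +
      if j < i then σ.natArr .pin j (σ.nat .newV) else 0) rfl (by decide) (by decide) rfl
      (by simp) ?_).mono ?_
  · rintro i hi τ hτ hx ⟨hkc, hnl⟩
    have hpin := hτ.natArr .pin (by decide)
    have hdeg := hτ.natArr .netDeg (by decide)
    have hnew := hτ.nat .newV (by decide)
    simp only [Store.setN_natArr, Store.setN_nat, reduceCtorEq, if_false] at hpin hdeg hnew
    have hnl' : ∀ j, (if j = i then σ.natArr .netLeft i 0 + σ.natArr .pin i (σ.nat .newV)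
        else τ.natArr .netLeft j 0) = σ.natArr .netLeft j 0 +
          if j < i + 1 then σ.natArr .pin j (σ.nat .newV) else 0 := by
      intro j
      rcases lt_trichotomy j i with h | rfl | h
      · simp [hnl, h, h.ne, h.trans (Nat.lt_succ_self i)]
      · simp
      · simp [hnl, h.ne', h.not_gt, show ¬ j < i + 1 by omega]
    have hii : τ.natArr .netLeft i 0 = σ.natArr .netLeft i 0 := by simp [hnl]
    simp only [put1, at1, MSCut.when, incr, runs_seq, runs_setNA, runs_ite, runs_setN, runs_skip,
      BExp.Holds, NExp.eval, hx, hpin, hdeg, hnew, hii, Store.setNA_natArr, Store.setNA_nat,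
      Store.setN_nat, Store.setN_natArr, Nat.count_succ, reduceCtorEq, true_and,
      and_true, if_true, if_false, hkc, and_self]
    constructor <;> intro h
    · refine ⟨by rw [if_pos h], hnl'⟩
    · refine ⟨by rw [if_neg h]; rfl, hnl'⟩
  · rintro t τ - ⟨ht, -, hkc, hnl⟩
    simp only [Store.setN_nat, reduceCtorEq, if_false] at ht hkc hnl
    refine ⟨by simp only [NExp.cost]; omega, hkc, fun j hj => by simp [hnl, hj]⟩

theorem runs_computeGain (σ : Store) : Runs ω computeGain σ fun t τ => t ≤ 60 ∧
    τ.real .gain = σ.real .gamma * (if σ.real .wLeft ≤ σ.real .wTot - σ.real .wLeft then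
        σ.real .wLeft / (σ.real .wTot - σ.real .wLeft)
      else (σ.real .wTot - σ.real .wLeft) / σ.real .wLeft) +
      (1 - σ.real .gamma - σ.real .beta) * (1 - (σ.nat .kc : ℝ) / (σ.nat .nNet : ℝ)) +
      σ.real .beta * (1 - (σ.nat .z : ℝ) / ((σ.nat .nCut : ℝ) - 1)) := by
  refine Runs.of_straight ?_ rfl (by decide)
  simp only [computeGain, runs_seq, runs_setR, runs_ite, RExp.eval, NExp.eval, BExp.Holds,
    Store.setR_real, Store.setR_nat, reduceCtorEq, if_true, if_false, Nat.cast_one]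
  constructor <;> intro h <;> simp [h]

theorem runs_store (σ : Store) : Runs ω store σ fun t τ =>
    t ≤ 25 * σ.nat .nBlk + 20 ∧ τ.nat .lamLen = σ.nat .lamLen + 1 ∧
    τ.realArr .lamGain (σ.nat .lamLen) 0 = σ.real .gain ∧
    (∀ c, c ≠ σ.nat .lamLen → τ.realArr .lamGain c 0 = σ.realArr .lamGain c 0) ∧
    (∀ c v, c ≠ σ.nat .lamLen → τ.natArr .lamCut c v = σ.natArr .lamCut c v) ∧
    ∀ v < σ.nat .nBlk, τ.natArr .lamCut (σ.nat .lamLen) v = σ.natArr .inL v 0 := by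
  rw [store, rput1, runs_seq, runs_setRA]
  refine Runs.seq (Runs.forUp_straight (T := 17) (m := σ.nat .nBlk) (I := fun i τ =>
    (∀ c v, c ≠ σ.nat .lamLen → τ.natArr .lamCut c v = σ.natArr .lamCut c v) ∧
    ∀ v < i, τ.natArr .lamCut (σ.nat .lamLen) v = σ.natArr .inL v 0) rfl (by decide) (by decide)
    rfl (by simp) ?_) ?_
  · rintro i hi τ hτ hx ⟨h₁, h₂⟩
    have hlen := hτ.nat .lamLen (by decide)
    have hinL := hτ.natArr .inL (by decide)
    simp only [Store.setRA_nat, Store.setRA_natArr] at hlen hinL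
    simp only [runs_setNA, at1, NExp.eval, hlen, hinL, hx, Store.setNA_natArr, Store.setN_natArr,
      true_and]
    refine ⟨fun c v hc => by simp [hc, h₁ c v hc], fun v hv => ?_⟩
    by_cases hvi : v = i
    · simp [hvi]
    · simp [hvi, h₂ v (by omega)]
  · rintro t τ hτ ⟨ht, -, h₁, h₂⟩
    have hlen := hτ.nat .lamLen (by decide)
    have hg := hτ.realArr .lamGain (by decide)
    simp only [Store.setRA_nat] at hlen
    simp only [incr, runs_setN, NExp.eval, Store.setN_nat, Store.setN_natArr, Store.setN_realArr,
      if_true, hlen, hg, Store.setRA_realArr, and_self, true_and, and_true, RExp.eval]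
    exact ⟨by simp only [NExp.cost, RExp.cost]; omega, fun c hc => by simp [hc], h₁, h₂⟩

/-! ### Candidate edges -/

/-- The edge `f` leads from the wavefront to the right part and has not been tried. -/
def IsCand (σ : Store) (f : ℕ) : Prop :=
  σ.natArr .inFront (σ.natArr .src f 0) 0 = 1 ∧ σ.natArr .inL (σ.natArr .dst f 0) 0 = 0 ∧
    σ.natArr .tried f 0 = 0

/-- The array `cand` lists candidate edges, at least one if there is any. -/
structure CandList (σ : Store) : Prop where
  cand : ∀ c < σ.nat .nCand, σ.natArr .cand c 0 < σ.nat .nEdge ∧ IsCand σ (σ.natArr .cand c 0)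
  pos : ∀ f < σ.nat .nEdge, IsCand σ f → 0 < σ.nat .nCand

/-- Neither the order nor the completeness of the list is recorded: a trial must cope with any
candidate, and may stop only if there is none. -/
theorem runs_findCands (σ : Store) : Runs ω findCands σ fun t τ =>
    t ≤ 60 * σ.nat .nEdge + 10 ∧ CandList τ := by
  rw [findCands, runs_seq, runs_setN]
  refine (Runs.forUp_straight (T := 52) (I := fun i τ =>
    (∀ c < τ.nat .nCand, τ.natArr .cand c 0 < i ∧ IsCand σ (τ.natArr .cand c 0)) ∧
    ∀ f < i, IsCand σ f → 0 < τ.nat .nCand) rfl (by decide) (by decide) rfl (by simp) ?_).mono ?_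
  · rintro i hi τ hτ hx ⟨h₁, h₂⟩
    simp only [put1, at1, MSCut.when, incr, runs_seq, runs_setNA, runs_ite, runs_setN, runs_skip,
      BExp.Holds, NExp.eval, hx, hτ.natArr .inFront (by decide), hτ.natArr .src (by decide),
      hτ.natArr .dst (by decide), hτ.natArr .inL (by decide), hτ.natArr .tried (by decide),
      Store.setNA_natArr, Store.setNA_nat, Store.setN_nat, Store.setN_natArr, reduceCtorEq,
      true_and, and_true, if_true, if_false]
    constructor <;> intro h
    · refine ⟨fun c hc => ?_, fun _ _ _ => Nat.succ_pos _⟩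
      by_cases hcn : c = τ.nat .nCand
      · simp only [hcn, if_true]
        exact ⟨Nat.lt_succ_self i, h⟩
      · simp only [hcn, if_false]
        have := h₁ c (by omega)
        exact ⟨this.1.trans (Nat.lt_succ_self i), this.2⟩
    · refine ⟨fun c hc => ⟨(h₁ c hc).1.trans (Nat.lt_succ_self i), (h₁ c hc).2⟩, fun f hf hfc => ?_⟩
      rcases Nat.lt_succ_iff_lt_or_eq.1 hf with hf | rfl
      · exact h₂ f hf hfc
      · exact absurd hfc h
  · rintro t τ hτ ⟨ht, -, h₁, h₂⟩
    simp only [Store.setN_nat, reduceCtorEq, if_false] at ht h₁ h₂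
    have he := hτ.nat .nEdge (by decide)
    simp only [Store.setN_nat, reduceCtorEq, if_false] at he
    have hc : ∀ f, IsCand τ f ↔ IsCand σ f := fun f => by
      simp only [IsCand, hτ.natArr .inFront (by decide), hτ.natArr .src (by decide),
      hτ.natArr .dst (by decide), hτ.natArr .inL (by decide), hτ.natArr .tried (by decide),
      Store.setN_natArr]
    refine ⟨by simp only [NExp.cost]; omega, fun c hc' => ?_, fun f hf hfc => ?_⟩
    · rw [hc, he]
      exact h₁ c hc'
    · exact h₂ f (he ▸ hf) ((hc f).1 hfc)

theorem runs_checkValid (σ : Store) : Runs ω checkValid σ fun t τ =>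
    t ≤ 50 * σ.nat .nEdge + 10 ∧
    (τ.nat .valid = 1 ↔ ∀ f < σ.nat .nEdge, σ.natArr .dst f 0 = σ.natArr .dst (σ.nat .e) 0 →
      σ.natArr .inL (σ.natArr .src f 0) 0 ≠ 0) := by
  rw [checkValid, runs_seq, runs_setN]
  refine (Runs.forUp_straight (T := 42) (I := fun i τ => τ.nat .valid = 1 ↔
    ∀ f < i, σ.natArr .dst f 0 = σ.natArr .dst (σ.nat .e) 0 →
      σ.natArr .inL (σ.natArr .src f 0) 0 ≠ 0) rfl (by decide) (by decide) rfl (by simp) ?_).mono ?_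
  · rintro i hi τ hτ hx h
    have he := hτ.nat .e (by decide)
    simp only [Store.setN_nat, reduceCtorEq, if_false] at he
    simp only [at1, MSCut.when, runs_ite, runs_setN, runs_skip, BExp.Holds, NExp.eval, hx, he,
      hτ.natArr .src (by decide), hτ.natArr .dst (by decide), hτ.natArr .inL (by decide),
      Store.setN_nat, Store.setN_natArr, reduceCtorEq, if_true, if_false]
    constructor <;> intro hc
    · simp only [false_iff]
      exact fun hf => hf i (Nat.lt_succ_self i) hc.1 hc.2
    · rw [h]
      refine ⟨fun hf f hfi => ?_, fun hf f hfi => hf f (hfi.trans (Nat.lt_succ_self i))⟩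
      rcases Nat.lt_succ_iff_lt_or_eq.1 hfi with hfi | rfl
      · exact hf f hfi
      · exact fun h₁ h₂ => hc ⟨h₁, h₂⟩
  · rintro t τ - ⟨ht, -, h⟩
    simp only [Store.setN_nat, reduceCtorEq, if_false] at ht h
    exact ⟨by simp only [NExp.cost]; omega, h⟩

/-! ### Initialization and selection -/

theorem runs_clear {x bound : NVar} {a : NArr} (σ : Store) (h : x ≠ bound) :
    Runs ω (forUp x bound (put1 a (.var x) (.lit 0))) σ fun t τ =>
      t ≤ 12 * σ.nat bound + 6 ∧ ∀ v < σ.nat bound, τ.natArr a v 0 = 0 := by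
  refine (Runs.forUp_straight (T := 4) (m := σ.nat bound) (I := fun i τ =>
    ∀ v < i, τ.natArr a v 0 = 0) rfl (le_refl 4) (by simp [Com.natW, h]) rfl (by simp)
    ?_).mono fun t τ _ h => ⟨h.1, h.2.2⟩
  intro i hi τ hτ hx hI
  simp only [put1, runs_setNA, NExp.eval, Store.setN_natArr, Store.setNA_natArr, hx]
  intro v hv
  by_cases hvi : v = i
  · simp [hvi]
  · simp [hvi, hI v (by omega)]

theorem runs_resetTrial (σ : Store) : Runs ω resetTrial σ fun t τ =>
    t ≤ 20 * σ.nat .nBlk + 20 * σ.nat .nEdge + 20 * σ.nat .nNet + 40 ∧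
    (∀ v < σ.nat .nBlk, τ.natArr .inL v 0 = 0 ∧ τ.natArr .inFront v 0 = 0) ∧
    (∀ f < σ.nat .nEdge, τ.natArr .tried f 0 = 0) ∧
    (∀ j < σ.nat .nNet, τ.natArr .netLeft j 0 = 0) ∧
    τ.real .wLeft = 0 ∧ τ.nat .nLeft = 0 ∧ τ.nat .head = 0 ∧ τ.nat .tail = 0 := by
  rw [resetTrial]
  refine Runs.seq (Runs.forUp_straight (T := 8) (m := σ.nat .nBlk) (I := fun i τ =>
    ∀ v < i, τ.natArr .inL v 0 = 0 ∧ τ.natArr .inFront v 0 = 0) rfl (by decide) (by decide) rfl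
    (by simp) ?_) ?_
  · intro i hi τ hτ hx hI
    simp only [put1, runs_seq, runs_setNA, NExp.eval, Store.setN_natArr, Store.setNA_natArr,
      Store.setNA_nat, hx]
    intro v hv
    by_cases hvi : v = i
    · simp [hvi]
    · simp [hvi, hI v (by omega)]
  · rintro t₁ τ₁ h₁ ⟨ht₁, -, hI₁⟩
    refine Runs.seq (runs_clear τ₁ (by decide)) ?_
    rintro t₂ τ₂ h₂ ⟨ht₂, hI₂⟩
    refine Runs.seq (runs_clear τ₂ (by decide)) ?_
    rintro t₃ τ₃ h₃ ⟨ht₃, hI₃⟩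
    have hE := h₁.nat .nEdge (by decide)
    have hN := (h₂.nat .nNet (by decide)).trans (h₁.nat .nNet (by decide))
    rw [hE] at hI₂ ht₂
    rw [hN] at hI₃ ht₃
    simp only [runs_seq, runs_setR, runs_setN, Store.setN_nat, Store.setN_natArr, Store.setN_real,
      Store.setR_real, Store.setR_natArr, reduceCtorEq, if_true, if_false,
      RExp.eval, NExp.eval, Nat.cast_zero, h₃.natArr .inL (by decide), h₂.natArr .inL (by decide),
      h₃.natArr .inFront (by decide), h₂.natArr .inFront (by decide),
      h₃.natArr .tried (by decide), and_true]
    exact ⟨by simp only [NExp.cost, RExp.cost]; omega, hI₁, hI₂, hI₃⟩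

theorem runs_selectBest (σ : Store) : Runs ω selectBest σ fun t τ =>
    t ≤ 30 * σ.nat .lamLen + 30 * σ.nat .nBlk + 20 ∧
    ∃ b, (0 < σ.nat .lamLen → b < σ.nat .lamLen) ∧
      (∀ c < σ.nat .lamLen, σ.realArr .lamGain c 0 ≤ σ.realArr .lamGain b 0) ∧
      ∀ v < σ.nat .nBlk, τ.natArr .out v 0 = σ.natArr .lamCut b v := by
  rw [selectBest, runs_seq, runs_setN]
  refine Runs.seq (Runs.forUp_straight (T := 14) (m := σ.nat .lamLen) (I := fun i τ =>
    -- The second alternative covers the start and an empty list, where `best` keeps its initial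
    -- value.
    (τ.nat .best < i ∨ τ.nat .best = 0) ∧
      ∀ c < i, σ.realArr .lamGain c 0 ≤ σ.realArr .lamGain (τ.nat .best) 0) rfl (by decide)
    (by decide) rfl (by simp) ?_) ?_
  · rintro i hi τ hτ hx ⟨hI, hI'⟩
    simp only [rat1, MSCut.when, runs_ite, runs_setN, runs_skip, BExp.Holds, NExp.eval, RExp.eval,
      hx, hτ.realArr .lamGain (by decide), Store.setN_nat, Store.setN_realArr, reduceCtorEq,
      if_true, if_false]
    constructor <;> intro h
    · refine ⟨.inl (Nat.lt_succ_self i), fun c hc => ?_⟩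
      rcases Nat.lt_succ_iff_lt_or_eq.1 hc with hc | rfl
      · exact (hI' c hc).trans h.le
      · exact le_rfl
    · refine ⟨by omega, fun c hc => ?_⟩
      rcases Nat.lt_succ_iff_lt_or_eq.1 hc with hc | rfl
      · exact hI' c hc
      · exact not_lt.1 h
  · rintro t τ hτ ⟨ht, -, hb, hmax⟩
    have hB := hτ.nat .nBlk (by decide)
    simp only [Store.setN_nat, reduceCtorEq, if_false] at hB
    refine (Runs.forUp_straight (T := 12) (m := σ.nat .nBlk) (I := fun i υ =>
      ∀ v < i, υ.natArr .out v 0 = σ.natArr .lamCut (τ.nat .best) v) rfl (by decide)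
      (by decide) hB (by simp) ?_).mono ?_
    · intro i hi υ hυ hx hI
      simp only [put1, runs_setNA, NExp.eval, Store.setN_natArr, Store.setNA_natArr, hx,
        hυ.natArr .lamCut (by decide), hτ.natArr .lamCut (by decide), hυ.nat .best (by decide)]
      intro v hv
      by_cases hvi : v = i
      · simp [hvi]
      · simp [hvi, hI v (by omega)]
    · rintro u υ - ⟨hu, -, hout⟩
      exact ⟨by simp only [NExp.cost]; omega, τ.nat .best, by omega, hmax, hout⟩

end MSCut

namespace MSCut

open RealRAM

variable {ω : Random} {σ : Store}

theorem runs_seq_assoc {b c d : Com} {Q : ℕ → Store → Prop} :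
    Runs ω (.seq b (.seq c d)) σ Q ↔ Runs ω (.seq (.seq b c) d) σ Q := by
  simp only [runs_seq, add_assoc]

/-! ### Counting by enumerations -/

theorem bijOn_append {α : Type*} {f g : ℕ → α} {k : ℕ} {S : Set α} {a : α}
    (h : Set.BijOn f (Set.Iio k) S) (ha : a ∉ S) (hg : ∀ c < k, g c = f c) (hk : g k = a) :
    Set.BijOn g (Set.Iio (k + 1)) (insert a S) := by
  have h' : Set.BijOn g (Set.Iio k) S := h.congr fun c hc => (hg c hc).symm
  have : Set.Iio (k + 1) = insert k (Set.Iio k) := by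
    ext c
    simp only [Set.mem_Iio, Set.mem_insert_iff]
    omega
  rw [this, ← hk]
  exact h'.insert (hk ▸ ha)

/-- Links the counters of the program, which run over positions in a list, to the cardinalities in
the mathematical definitions. -/
theorem card_filter_eq_count {α : Type*} {f : ℕ → α} {k : ℕ} {S : Finset α}
    (h : Set.BijOn f (Set.Iio k) S) (P : α → Prop) [DecidablePred P]
    (Q : ℕ → Prop) [DecidablePred Q] (hPQ : ∀ c < k, P (f c) ↔ Q c) :
    (S.filter P).card = Nat.count Q k := by
  rw [Nat.count_eq_card_filter_range]
  symm
  refine card_bij (fun c _ => f c) ?_ ?_ ?_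
  · intro c hc
    rw [mem_filter, mem_range] at hc
    exact mem_filter.2 ⟨h.mapsTo hc.1, (hPQ c hc.1).2 hc.2⟩
  · intro c hc d hd hcd
    exact h.injOn (mem_range.1 (mem_filter.1 hc).1) (mem_range.1 (mem_filter.1 hd).1) hcd
  · intro a ha
    obtain ⟨c, hc, rfl⟩ := h.surjOn (mem_filter.1 ha).1
    exact ⟨c, mem_filter.2 ⟨mem_range.2 hc, (hPQ c hc).1 (mem_filter.1 ha).2⟩, rfl⟩

theorem card_eq_of_bijOn {α : Type*} {f : ℕ → α} {k : ℕ} {S : Finset α}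
    (h : Set.BijOn f (Set.Iio k) S) : S.card = k := by
  simpa [Nat.count_true] using card_filter_eq_count h (fun _ => True) (fun _ => True) (by simp)

/-! ### Preparation -/

theorem runs_prepWeights (σ : Store) : Runs ω prepWeights σ fun t τ =>
    t ≤ 40 * σ.nat .nBlk + 20 ∧
    (∀ v < σ.nat .nBlk, τ.realArr .wt v 0 =
      if σ.nat .byNumber = 0 then σ.realArr .area v 0 else 1) ∧
    τ.real .wTot = ∑ v ∈ range (σ.nat .nBlk),
      if σ.nat .byNumber = 0 then σ.realArr .area v 0 else 1 := by
  rw [prepWeights, runs_seq, runs_setR]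
  refine (Runs.forUp_straight (T := 32) (m := σ.nat .nBlk) (I := fun i τ =>
    (∀ v < i, τ.realArr .wt v 0 = if σ.nat .byNumber = 0 then σ.realArr .area v 0 else 1) ∧
    τ.real .wTot = ∑ v ∈ range i, if σ.nat .byNumber = 0 then σ.realArr .area v 0 else 1)
    rfl (by decide) (by decide) (by simp) (by simp) ?_).mono ?_
  · rintro i hi τ hτ hx ⟨h₁, h₂⟩
    have hb := hτ.nat .byNumber (by decide)
    have ha := hτ.realArr .area (by decide)
    simp only [Store.setR_nat, Store.setR_realArr] at hb ha
    simp only [rput1, rat1, runs_seq, runs_ite, runs_setRA, runs_setR, BExp.Holds, NExp.eval,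
      RExp.eval, hb, ha, hx, Store.setRA_nat, Store.setRA_real, Store.setRA_realArr,
      Store.setR_real, Store.setR_realArr, Store.setN_real, Store.setN_realArr, sum_range_succ, h₂,
      true_and, if_true, Nat.cast_one, and_self]
    constructor <;> intro h
    · refine ⟨fun v hv => ?_, by simp [h]⟩
      by_cases hvi : v = i
      · simp [hvi, h]
      · simp [hvi, h₁ v (by omega)]
    · refine ⟨fun v hv => ?_, by simp [h]⟩
      by_cases hvi : v = i
      · simp [hvi, h]
      · simp [hvi, h₁ v (by omega)]
  · rintro t τ - ⟨ht, -, h₁, h₂⟩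
    exact ⟨by simp only [RExp.cost, NExp.cost]; omega, h₁, h₂⟩

theorem runs_prepNets (σ : Store) : Runs ω prepNets σ fun t τ =>
    t ≤ (40 * σ.nat .nBlk + 40) * σ.nat .nNet + 6 ∧
    ∀ j < σ.nat .nNet, τ.natArr .netDeg j 0 =
      ∑ v ∈ range (σ.nat .nBlk), σ.natArr .pin j v := by
  rw [prepNets]
  refine (Runs.forUp (T := 40 * σ.nat .nBlk + 32) (m := σ.nat .nNet) (I := fun i τ =>
    ∀ j < i, τ.natArr .netDeg j 0 = ∑ v ∈ range (σ.nat .nBlk), σ.natArr .pin j v)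
    (by decide) rfl (by simp) ?_).mono fun t τ _ h => ⟨h.1, h.2.2⟩
  intro i hi τ hτ hx hI
  rw [put1, runs_seq, runs_setNA]
  refine (Runs.forUp_straight (T := 20) (m := σ.nat .nBlk) (I := fun w υ =>
    (∀ j < i, υ.natArr .netDeg j 0 = ∑ v ∈ range (σ.nat .nBlk), σ.natArr .pin j v) ∧
    υ.natArr .netDeg i 0 = ∑ v ∈ range w, σ.natArr .pin i v)
    rfl (by decide) (by decide) (by simp [hτ.nat .nBlk (by decide)]) ?_ ?_).mono ?_
  · simp only [NExp.eval, hx, Store.setN_natArr, Store.setNA_natArr, true_and, and_self, if_true,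
      range_zero, sum_empty, and_true]
    intro j hj
    simp [hj.ne, hI j hj]
  · rintro w hw υ hυ hv ⟨h₁, h₂⟩
    have hj := hυ.nat .j (by decide)
    have hp := hυ.natArr .pin (by decide)
    rw [Store.setNA_nat, hx] at hj
    simp only [put1, at1, runs_setNA, NExp.eval, hj, hv, Store.setN_natArr, Store.setNA_natArr, hp,
      true_and, and_true, if_true, h₂, sum_range_succ, hτ.natArr .pin (by decide), reduceCtorEq,
      false_and, if_false]
    intro j hj
    simp [hj.ne, h₁ j hj]
  · rintro t υ hυ ⟨ht, -, h₁, h₂⟩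
    refine ⟨by simp only [NExp.cost]; omega, fun j hj => ?_⟩
    rw [Store.setN_natArr]
    rcases Nat.lt_succ_iff_lt_or_eq.1 hj with hj | rfl
    · exact h₁ j hj
    · exact h₂

/-- The edges `e` and `f` form a corner, according to the input arrays. -/
def IsCorner (σ : Store) (e f : ℕ) : Prop :=
  σ.natArr .ori e 0 = 0 ∧ σ.natArr .ori f 0 = 1 ∧
    ((σ.realArr .loX e 0 = σ.realArr .loX f 0 ∧ σ.realArr .loY e 0 = σ.realArr .loY f 0) ∨
      (σ.realArr .loX e 0 = σ.realArr .hiX f 0 ∧ σ.realArr .loY e 0 = σ.realArr .hiY f 0) ∨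
      (σ.realArr .hiX e 0 = σ.realArr .loX f 0 ∧ σ.realArr .hiY e 0 = σ.realArr .loY f 0) ∨
      (σ.realArr .hiX e 0 = σ.realArr .hiX f 0 ∧ σ.realArr .hiY e 0 = σ.realArr .hiY f 0))

/-- The list must contain each corner exactly once for the later count to equal the number of bends.
The double loop over the edges is affordable since it runs once and there are `O(n)` edges. -/
theorem runs_prepCorners (σ : Store) : Runs ω prepCorners σ fun t τ =>
    t ≤ (150 * σ.nat .nEdge + 20) * σ.nat .nEdge + 10 ∧
    Set.BijOn (fun c => (τ.natArr .cornV c 0, τ.natArr .cornH c 0)) (Set.Iio (τ.nat .nCorner))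
      {p | p.1 < σ.nat .nEdge ∧ p.2 < σ.nat .nEdge ∧ IsCorner σ p.1 p.2} := by
  rw [prepCorners, runs_seq, runs_setN]
  refine (Runs.forUp (T := 150 * σ.nat .nEdge + 6) (m := σ.nat .nEdge) (I := fun i τ =>
    Set.BijOn (fun c => (τ.natArr .cornV c 0, τ.natArr .cornH c 0)) (Set.Iio (τ.nat .nCorner))
      {p | p.1 < i ∧ p.2 < σ.nat .nEdge ∧ IsCorner σ p.1 p.2}) (by decide) (by simp)
    (by simp) ?_).mono ?_
  · intro i hi τ hτ hx hI
    -- The invariant of the inner loop describes the pairs that lexicographically precede `(i, w)`.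
    refine (Runs.forUp_straight (T := 142) (m := σ.nat .nEdge) (I := fun w υ =>
      Set.BijOn (fun c => (υ.natArr .cornV c 0, υ.natArr .cornH c 0)) (Set.Iio (υ.nat .nCorner))
        {p | (p.1 < i ∨ p.1 = i ∧ p.2 < w) ∧ p.2 < σ.nat .nEdge ∧ IsCorner σ p.1 p.2})
      rfl (by decide) (by decide) ?_ (by simpa using hI) ?_).mono ?_
    · exact hτ.nat .nEdge (by decide)
    · intro w hw υ hυ hy hJ
      have he := hυ.nat .e (by decide)
      rw [hx] at he
      simp only [sameEnd, put1, at1, rat1, MSCut.when, incr, runs_seq, runs_setNA, runs_ite,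
        runs_setN, runs_skip,
        BExp.Holds, NExp.eval, RExp.eval, hy, he, hυ.natArr .ori (by decide),
        hτ.natArr .ori (by decide), hυ.realArr .loX (by decide), hτ.realArr .loX (by decide),
        hυ.realArr .loY (by decide), hτ.realArr .loY (by decide), hυ.realArr .hiX (by decide),
        hτ.realArr .hiX (by decide), hυ.realArr .hiY (by decide), hτ.realArr .hiY (by decide),
        Store.setN_natArr, Store.setN_realArr, Store.setNA_natArr, Store.setNA_nat,
        Store.setN_nat, reduceCtorEq, true_and, and_true, false_and, if_true, if_false]
      constructor <;> intro h
      · have hS : {p : ℕ × ℕ | (p.1 < i ∨ p.1 = i ∧ p.2 < w + 1) ∧ p.2 < σ.nat .nEdge ∧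
            IsCorner σ p.1 p.2} = insert (i, w) {p : ℕ × ℕ | (p.1 < i ∨ p.1 = i ∧ p.2 < w) ∧
              p.2 < σ.nat .nEdge ∧ IsCorner σ p.1 p.2} := by
          ext ⟨a, b⟩
          simp only [Set.mem_ofPred_eq, Set.mem_insert_iff, Prod.mk.injEq]
          constructor
          · rintro ⟨h₁ | ⟨rfl, h₁⟩, h₂⟩
            · exact .inr ⟨.inl h₁, h₂⟩
            · rcases Nat.lt_succ_iff_lt_or_eq.1 h₁ with h₁ | rfl
              · exact .inr ⟨.inr ⟨rfl, h₁⟩, h₂⟩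
              · exact .inl ⟨rfl, rfl⟩
          · rintro (⟨rfl, rfl⟩ | ⟨h₁, h₂⟩)
            · exact ⟨.inr ⟨rfl, Nat.lt_succ_self _⟩, hw, h⟩
            · exact ⟨h₁.imp_right fun h => ⟨h.1, by omega⟩, h₂⟩
        rw [hS]
        refine bijOn_append hJ (by simp) (fun c hc => ?_) (by simp)
        simp [hc.ne]
      · have hS : {p : ℕ × ℕ | (p.1 < i ∨ p.1 = i ∧ p.2 < w + 1) ∧ p.2 < σ.nat .nEdge ∧
            IsCorner σ p.1 p.2} = {p : ℕ × ℕ | (p.1 < i ∨ p.1 = i ∧ p.2 < w) ∧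
              p.2 < σ.nat .nEdge ∧ IsCorner σ p.1 p.2} := by
          ext ⟨a, b⟩
          simp only [Set.mem_ofPred_eq]
          constructor
          · rintro ⟨h₁ | ⟨rfl, h₁⟩, h₂⟩
            · exact ⟨.inl h₁, h₂⟩
            · rcases Nat.lt_succ_iff_lt_or_eq.1 h₁ with h₁ | rfl
              · exact ⟨.inr ⟨rfl, h₁⟩, h₂⟩
              · exact absurd h₂.2 h
          · rintro ⟨h₁, h₂⟩
            exact ⟨h₁.imp_right fun h => ⟨h.1, by omega⟩, h₂⟩
        rw [hS]
        exact hJ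
    · rintro t υ - ⟨ht, -, h⟩
      refine ⟨by omega, ?_⟩
      have hS : {p : ℕ × ℕ | p.1 < i + 1 ∧ p.2 < σ.nat .nEdge ∧ IsCorner σ p.1 p.2} =
          {p : ℕ × ℕ | (p.1 < i ∨ p.1 = i ∧ p.2 < σ.nat .nEdge) ∧ p.2 < σ.nat .nEdge ∧
            IsCorner σ p.1 p.2} := by
        ext ⟨a, b⟩
        simp only [Set.mem_ofPred_eq, Nat.lt_succ_iff_lt_or_eq]
        tauto
      rw [hS]
      exact h
  · rintro t τ - ⟨ht, -, h⟩
    exact ⟨by simp only [NExp.cost]; linarith, h⟩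

end MSCut

/-! ### The memory invariants, and the effect of moving one block. -/

namespace MSCut

open RealRAM

variable {ω : Random} {σ τ : Store} {n k : ℕ}

/-- A floorplan whose block adjacency graph has the source `s`, with nets, trade-off parameters, and
an enumeration `ed 0, …, ed (m - 1)` of the edges. -/
structure Problem (n k : ℕ) where
  F : Floorplan n
  st : StairType
  bt : BalType
  N : Fin k → Finset (Fin n)
  γ : ℝ
  β : ℝ
  s : Fin n
  ed : ℕ → Fin n × Fin n
  m : ℕ
  isSource : F.IsSource st s
  bijOn : Set.BijOn ed (Set.Iio m) (F.edges st)

namespace Problem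

variable (D : Problem n k)

theorem m_le : D.m ≤ 4 * n := by
  rw [← card_eq_of_bijOn D.bijOn]
  exact D.F.card_edges_le D.st

theorem n_pos (D : Problem n k) : 0 < n := D.s.pos

theorem arc_ed {e : ℕ} (he : e < D.m) : D.F.Arc D.st (D.ed e).1 (D.ed e).2 := by
  have := D.bijOn.mapsTo he
  simpa [Floorplan.edges] using this

theorem exists_ed {i j : Fin n} (h : D.F.Arc D.st i j) : ∃ e < D.m, D.ed e = (i, j) := by
  have : (i, j) ∈ (D.F.edges D.st : Set (Fin n × Fin n)) := by simpa [Floorplan.edges] using h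
  exact D.bijOn.surjOn this

/-- The memory holds the problem and the results of the preparation. -/
structure Ready (σ : Store) : Prop where
  nBlk : σ.nat .nBlk = n
  nEdge : σ.nat .nEdge = D.m
  nNet : σ.nat .nNet = k
  source : σ.nat .source = D.s
  gamma : σ.real .gamma = D.γ
  beta : σ.real .beta = D.β
  src : ∀ e < D.m, σ.natArr .src e 0 = (D.ed e).1
  dst : ∀ e < D.m, σ.natArr .dst e 0 = (D.ed e).2
  pin : ∀ (j : Fin k) (v : Fin n), σ.natArr .pin j v = if v ∈ D.N j then 1 else 0
  wt : ∀ v : Fin n, σ.realArr .wt v 0 = D.F.weight D.bt v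
  wTot : σ.real .wTot = ∑ v, D.F.weight D.bt v
  netDeg : ∀ j : Fin k, σ.natArr .netDeg j 0 = (D.N j).card
  corners : Set.BijOn (fun c => (D.ed (σ.natArr .cornV c 0), D.ed (σ.natArr .cornH c 0)))
    (Set.Iio (σ.nat .nCorner)) (D.F.corners D.st)
  corner_lt : ∀ c < σ.nat .nCorner, σ.natArr .cornV c 0 < D.m ∧ σ.natArr .cornH c 0 < D.m

/-- The program does not write to the registers and arrays that hold the problem. -/
@[reducible] def Keeps (c : Com) : Prop :=
  (∀ x ∈ [NVar.nBlk, .nEdge, .nNet, .source, .nCorner], x ∉ c.natW) ∧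
  (∀ x ∈ [RVar.gamma, .beta, .wTot], x ∉ c.realW) ∧
  (∀ x ∈ [NArr.src, .dst, .pin, .netDeg, .cornV, .cornH], x ∉ c.natArrW) ∧
  (∀ x ∈ [RArr.wt], x ∉ c.realArrW)

variable {D}

theorem Ready.frame {c : Com} (h : D.Ready σ) (hf : Frame c σ τ) (hc : Keeps c) : D.Ready τ := by
  obtain ⟨h₁, h₂, h₃, h₄⟩ := hc
  have e₁ := fun x hx => hf.nat x (h₁ x hx)
  have e₂ := fun x hx => hf.real x (h₂ x hx)
  have e₃ := fun x hx => hf.natArr x (h₃ x hx)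
  have e₄ := fun x hx => hf.realArr x (h₄ x hx)
  simp only [List.mem_cons, List.not_mem_nil, or_false, forall_eq_or_imp, forall_eq] at e₁ e₂ e₃ e₄
  obtain ⟨a₁, a₂, a₃, a₄, a₅⟩ := e₁
  obtain ⟨b₁, b₂, b₃⟩ := e₂
  obtain ⟨c₁, c₂, c₃, c₄, c₅, c₆⟩ := e₃
  constructor
  · rw [a₁, h.nBlk]
  · rw [a₂, h.nEdge]
  · rw [a₃, h.nNet]
  · rw [a₄, h.source]
  · rw [b₁, h.gamma]
  · rw [b₂, h.beta]
  · rw [c₁]; exact h.src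
  · rw [c₂]; exact h.dst
  · rw [c₃]; exact h.pin
  · rw [e₄]; exact h.wt
  · rw [b₃, h.wTot]
  · rw [c₄]; exact h.netDeg
  · rw [a₅, c₅, c₆]; exact h.corners
  · rw [a₅, c₅, c₆]; exact h.corner_lt

theorem Ready.nCorner_le (h : D.Ready σ) : σ.nat .nCorner ≤ 8 * n := by
  rw [← card_eq_of_bijOn h.corners]
  exact D.F.card_corners_le D.st

variable (D)

/-- The left part is `L`. -/
structure Left (L : Finset (Fin n)) (σ : Store) : Prop where
  inL : ∀ v : Fin n, σ.natArr .inL v 0 = if v ∈ L then 1 else 0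
  nLeft : σ.nat .nLeft = L.card
  wLeft : σ.real .wLeft = ∑ v ∈ L, D.F.weight D.bt v
  netLeft : L.card < n → ∀ j : Fin k, σ.natArr .netLeft j 0 = (D.N j ∩ L).card

/-- The list `λ` consists of `G 0, …, G (len - 1)`, with their gains. -/
structure Stored (G : ℕ → Finset (Fin n)) (len : ℕ) (σ : Store) : Prop where
  lamLen : σ.nat .lamLen = len
  lamCut : ∀ c < len, HoldsRow σ .lamCut c (G c)
  lamGain : ∀ c < len, σ.realArr .lamGain c 0 = D.F.gain D.st D.bt D.N D.γ D.β (G c)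

variable {D}

theorem Stored.congr {G : ℕ → Finset (Fin n)} {len : ℕ} (h : D.Stored G len σ)
    (h₁ : τ.nat .lamLen = σ.nat .lamLen) (h₂ : τ.natArr .lamCut = σ.natArr .lamCut)
    (h₃ : τ.realArr .lamGain = σ.realArr .lamGain) : D.Stored G len τ :=
  ⟨h₁.trans h.lamLen, fun c hc v => by rw [h₂]; exact h.lamCut c hc v,
    fun c hc => by rw [h₃]; exact h.lamGain c hc⟩

theorem Left.inL_eq_one {L : Finset (Fin n)} (h : D.Left L σ) (v : Fin n) :
    σ.natArr .inL v 0 = 1 ↔ v ∈ L := by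
  simp [h.inL]

theorem Left.inL_eq_zero {L : Finset (Fin n)} (h : D.Left L σ) (v : Fin n) :
    σ.natArr .inL v 0 = 0 ↔ v ∉ L := by
  simp [h.inL]

theorem Left.congr {L : Finset (Fin n)} (h : D.Left L σ)
    (h₁ : τ.natArr .inL = σ.natArr .inL) (h₂ : τ.nat .nLeft = σ.nat .nLeft)
    (h₃ : τ.real .wLeft = σ.real .wLeft) (h₄ : τ.natArr .netLeft = σ.natArr .netLeft) :
    D.Left L τ :=
  ⟨h₁ ▸ h.inL, h₂ ▸ h.nLeft, h₃ ▸ h.wLeft, h₄ ▸ h.netLeft⟩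

theorem count_cutEdges (hR : D.Ready σ) {L : Finset (Fin n)} (hL : D.Left L σ) :
    Nat.count (fun f => σ.natArr .inL (σ.natArr .src f 0) 0 = 1 ∧
      σ.natArr .inL (σ.natArr .dst f 0) 0 = 0) D.m = (D.F.cutEdges D.st L).card := by
  classical
  symm
  unfold Floorplan.cutEdges
  refine card_filter_eq_count D.bijOn _ _ fun c hc => ?_
  rw [hR.src c hc, hR.dst c hc, hL.inL_eq_one, hL.inL_eq_zero]
  rfl

theorem count_bends (hR : D.Ready σ) {L : Finset (Fin n)} (hL : D.Left L σ) :
    Nat.count (fun c =>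
      (σ.natArr .inL (σ.natArr .src (σ.natArr .cornV c 0) 0) 0 = 1 ∧
        σ.natArr .inL (σ.natArr .dst (σ.natArr .cornV c 0) 0) 0 = 0) ∧
      (σ.natArr .inL (σ.natArr .src (σ.natArr .cornH c 0) 0) 0 = 1 ∧
        σ.natArr .inL (σ.natArr .dst (σ.natArr .cornH c 0) 0) 0 = 0)) (σ.nat .nCorner) =
    D.F.bends D.st L := by
  classical
  symm
  unfold Floorplan.bends
  refine card_filter_eq_count hR.corners _ _ fun c hc => ?_
  obtain ⟨h₁, h₂⟩ := hR.corner_lt c hc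
  rw [hR.src _ h₁, hR.dst _ h₁, hR.src _ h₂, hR.dst _ h₂, hL.inL_eq_one, hL.inL_eq_zero,
    hL.inL_eq_one, hL.inL_eq_zero]
  rfl

/-- A net is cut exactly when its number of blocks on the left is neither zero nor its full size, so
two counters per net suffice. -/
theorem count_cutNets (L : Finset (Fin n)) (N : Fin k → Finset (Fin n)) (P : ℕ → Prop)
    [DecidablePred P]
    (hP : ∀ j : Fin k, P j ↔ 0 < (N j ∩ L).card ∧ (N j ∩ L).card < (N j).card) :
    Nat.count P k = Floorplan.cutNets N L := by
  rw [Nat.count_eq_card_filter_range, Floorplan.cutNets]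
  have key : ∀ j : Fin k, P j ↔ (N j ∩ L).Nonempty ∧ (N j ∩ Lᶜ).Nonempty := fun j => by
    have := card_inter_add_card_sdiff (N j) L
    rw [hP, card_pos, ← sdiff_eq_inter_compl, ← card_pos (s := N j \ L)]
    exact and_congr_right fun _ => by omega
  symm
  refine card_bij (fun j _ => (j : ℕ)) ?_ (fun a _ b _ h => Fin.ext h) ?_
  · intro j hj
    exact mem_filter.2 ⟨mem_range.2 j.2, (key j).2 (mem_filter.1 hj).2⟩
  · intro j hj
    obtain ⟨h, hj⟩ := mem_filter.1 hj
    exact ⟨⟨j, mem_range.1 h⟩, mem_filter.2 ⟨mem_univ _, (key _).1 hj⟩, rfl⟩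

/-- The program never sums over the right part; it subtracts the left weight from the total. -/
theorem balr_eq (F : Floorplan n) (bt : BalType) (L : Finset (Fin n)) {w T : ℝ}
    (hw : w = ∑ i ∈ L, F.weight bt i) (hT : T = ∑ i, F.weight bt i) :
    (if w ≤ T - w then w / (T - w) else (T - w) / w) = F.balr bt L := by
  have : T - w = ∑ i ∈ Lᶜ, F.weight bt i := by
    rw [hT, hw, ← sum_add_sum_compl L]
    ring
  rw [this, hw, Floorplan.balr]
  split_ifs with h
  · rw [min_eq_left h, max_eq_right h]
  · rw [min_eq_right (not_le.1 h).le, max_eq_left (not_le.1 h).le]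

theorem runs_moveLeft {L : Finset (Fin n)} {v : Fin n} (hR : D.Ready σ) (hL : D.Left L σ)
    (hv : v ∉ L) (hnew : σ.nat .newV = v) :
    Runs ω moveLeft σ fun t τ => t ≤ 40 ∧
      (∀ w : Fin n, τ.natArr .inL w 0 = if w ∈ insert v L then 1 else 0) ∧
      τ.nat .nLeft = (insert v L).card ∧
      τ.real .wLeft = ∑ w ∈ insert v L, D.F.weight D.bt w ∧
      τ.nat .tail = σ.nat .tail + 1 ∧
      ∀ i, τ.natArr .queue i 0 = if i = σ.nat .tail then (v : ℕ) else σ.natArr .queue i 0 := by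
  refine Runs.of_straight ?_ rfl (by decide)
  simp [moveLeft, enqueue, hnew, hL.inL, hL.nLeft, hL.wLeft, hR.wt, hv, Fin.val_inj, ← ite_or,
    add_comm]

/-- The move that empties the right part skips the evaluation: no staircase is appended and the net
counters go stale. This is why `Left` guards its condition on the counters by `L.card < n`. -/
theorem runs_moveLeft_record {L : Finset (Fin n)} {v : Fin n} (hR : D.Ready σ) (hL : D.Left L σ)
    (hv : v ∉ L) (hnew : σ.nat .newV = v) :
    Runs ω (.seq moveLeft record) σ fun t τ => t ≤ 1000 * (n + k) ∧
      D.Left (insert v L) τ ∧ τ.nat .tail = σ.nat .tail + 1 ∧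
      (∀ i, τ.natArr .queue i 0 = if i = σ.nat .tail then (v : ℕ) else σ.natArr .queue i 0) ∧
      ∀ G len, D.Stored G len σ →
        ((insert v L).card < n → D.Stored (Function.update G len (insert v L)) (len + 1) τ) ∧
        (¬ (insert v L).card < n → D.Stored G len τ) := by
  have hn := D.n_pos
  refine Runs.seq (runs_moveLeft hR hL hv hnew) ?_
  rintro t₁ τ₁ h₁ ⟨ht₁, hin₁, hnl₁, hw₁, htail₁, hq₁⟩
  have hR₁ := hR.frame h₁ (by decide)
  simp only [record, MSCut.when, runs_ite, BExp.Holds, NExp.eval, hnl₁, hR₁.nBlk]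
  constructor
  · intro hlt
    refine Runs.seq (runs_netPartition τ₁) ?_
    rintro t₂ τ₂ h₂ ⟨ht₂, hkc₂, hnl₂⟩
    have hR₂ := hR₁.frame h₂ (by decide)
    have hL₂ : D.Left (insert v L) τ₂ := by
      refine ⟨by rwa [h₂.natArr .inL (by decide)], by rwa [h₂.nat .nLeft (by decide)],
        by rwa [h₂.real .wLeft (by decide)], fun _ j => ?_⟩
      -- The old left part is a proper subset too, so its net counters were still correct.
      have hc : L.card < n := lt_of_le_of_lt (card_le_card (subset_insert v L)) hlt
      rw [hnl₂ j (by rw [hR₁.nNet]; exact j.2), h₁.natArr .netLeft (by decide), hL.netLeft hc,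
        h₁.nat .newV (by decide), hnew, hR₁.pin]
      by_cases hvj : v ∈ D.N j
      · rw [inter_insert_of_mem hvj, card_insert_of_notMem (by simp [hv]), if_pos hvj]
      · rw [inter_insert_of_notMem hvj, if_neg hvj, add_zero]
    refine Runs.seq (runs_countBends τ₂) ?_
    rintro t₃ τ₃ h₃ ⟨ht₃, hcut₃, hz₃⟩
    rw [hR₂.nEdge, count_cutEdges hR₂ hL₂] at hcut₃
    rw [count_bends hR₂ hL₂] at hz₃
    have hR₃ := hR₂.frame h₃ (by decide)
    refine Runs.seq (runs_computeGain τ₃) ?_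
    rintro t₄ τ₄ h₄ ⟨ht₄, hg₄⟩
    have hR₄ := hR₃.frame h₄ (by decide)
    refine (runs_store τ₄).mono ?_
    rintro t₅ τ₅ h₅ ⟨ht₅, hlen₅, hlg₅, hlg₅', hlc₅', hlc₅⟩
    have hkc : τ₃.nat .kc = Floorplan.cutNets D.N (insert v L) := by
      rw [h₃.nat .kc (by decide), hkc₂, hR₁.nNet]
      refine count_cutNets _ _ _ fun j => ?_
      rw [← hnl₂ j (by rw [hR₁.nNet]; exact j.2), hL₂.netLeft hlt, hR₁.netDeg]
    have hgain : τ₄.real .gain = D.F.gain D.st D.bt D.N D.γ D.β (insert v L) := by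
      rw [hg₄, hR₃.gamma, hR₃.beta, hkc, hcut₃, hz₃, hR₃.nNet,
        balr_eq D.F D.bt (insert v L) ?_ hR₃.wTot]
      · rfl
      · rw [h₃.real .wLeft (by decide), hL₂.wLeft]
    have hlen₄ : τ₄.nat .lamLen = σ.nat .lamLen := by
      rw [h₄.nat .lamLen (by decide), h₃.nat .lamLen (by decide), h₂.nat .lamLen (by decide),
        h₁.nat .lamLen (by decide)]
    refine ⟨?_, hL₂.congr ?_ ?_ ?_ ?_, ?_, ?_, fun G len hG => ⟨fun _ => ?_, fun h => absurd hlt h⟩⟩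
    · have := D.m_le
      have := hR₂.nCorner_le
      rw [hR₁.nNet] at ht₂
      rw [hR₂.nEdge] at ht₃
      rw [hR₄.nBlk] at ht₅
      simp only [BExp.cost, NExp.cost]
      omega
    · rw [h₅.natArr .inL (by decide), h₄.natArr .inL (by decide), h₃.natArr .inL (by decide)]
    · rw [h₅.nat .nLeft (by decide), h₄.nat .nLeft (by decide), h₃.nat .nLeft (by decide)]
    · rw [h₅.real .wLeft (by decide), h₄.real .wLeft (by decide), h₃.real .wLeft (by decide)]
    · rw [h₅.natArr .netLeft (by decide), h₄.natArr .netLeft (by decide),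
        h₃.natArr .netLeft (by decide)]
    · rw [h₅.nat .tail (by decide), h₄.nat .tail (by decide), h₃.nat .tail (by decide),
        h₂.nat .tail (by decide), htail₁]
    · rw [h₅.natArr .queue (by decide), h₄.natArr .queue (by decide),
        h₃.natArr .queue (by decide), h₂.natArr .queue (by decide)]
      exact hq₁
    · have hG₄ : D.Stored G len τ₄ := hG.congr hlen₄
        (by rw [h₄.natArr .lamCut (by decide), h₃.natArr .lamCut (by decide),
          h₂.natArr .lamCut (by decide), h₁.natArr .lamCut (by decide)])
        (by rw [h₄.realArr .lamGain (by decide), h₃.realArr .lamGain (by decide),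
          h₂.realArr .lamGain (by decide), h₁.realArr .lamGain (by decide)])
      rw [hG₄.lamLen] at hlen₅ hlg₅ hlg₅' hlc₅' hlc₅
      refine ⟨hlen₅, fun c hc w => ?_, fun c hc => ?_⟩
      · by_cases hcl : c = len
        · rw [hcl, Function.update_self, hlc₅ w (by rw [hR₄.nBlk]; exact w.2),
            h₄.natArr .inL (by decide), h₃.natArr .inL (by decide), hL₂.inL]
        · rw [Function.update_of_ne hcl, hlc₅' c w hcl]
          exact hG₄.lamCut c (by omega) w
      · by_cases hcl : c = len
        · rw [hcl, Function.update_self, hlg₅, hgain]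
        · rw [Function.update_of_ne hcl, hlg₅' c hcl]
          exact hG₄.lamGain c (by omega)
  · intro hlt
    rw [runs_skip]
    refine ⟨?_, ⟨hin₁, hnl₁, hw₁, fun h => absurd h hlt⟩, htail₁, hq₁,
      fun G len hG => ⟨fun h => absurd h hlt, fun _ => hG.congr (h₁.nat .lamLen (by decide))
        (h₁.natArr .lamCut (by decide)) (h₁.realArr .lamGain (by decide))⟩⟩
    simp only [BExp.cost, NExp.cost]
    omega

end Problem

end MSCut

/-! ### The queue, the staircases of a trial, and the propagation of a wavefront. -/

namespace MSCut

open RealRAM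

variable {ω : Random} {σ τ : Store} {n k : ℕ}

/-! ### The queue -/

/-- The entries of the array from position `h` up to, but excluding, position `t` are `l`. -/
def IsQueue (a : ℕ → ℕ → ℕ) (t : ℕ) : ℕ → List ℕ → Prop
  | h, [] => t = h
  | h, x :: l => a h 0 = x ∧ IsQueue a t (h + 1) l

theorem IsQueue.eq_add {a : ℕ → ℕ → ℕ} {t h : ℕ} {l : List ℕ} (hq : IsQueue a t h l) :
    t = h + l.length := by
  induction l generalizing h with
  | nil => exact hq
  | cons x l ih =>
    have := ih hq.2
    rw [List.length_cons]
    omega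

theorem IsQueue.append {a a' : ℕ → ℕ → ℕ} {t h x : ℕ} {l : List ℕ} (hq : IsQueue a t h l)
    (ha : ∀ i, a' i 0 = if i = t then x else a i 0) : IsQueue a' (t + 1) h (l ++ [x]) := by
  induction l generalizing h with
  | nil =>
    obtain rfl : t = h := hq
    exact ⟨by simp [ha], rfl⟩
  | cons y l ih =>
    have := hq.2.eq_add
    exact ⟨by rw [ha, if_neg (by omega), hq.1], ih hq.2⟩

/-- The queue consists of the numbers in the list. -/
def Queue (σ : Store) (l : List ℕ) : Prop :=
  IsQueue (σ.natArr .queue) (σ.nat .tail) (σ.nat .head) l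

theorem Queue.frame {c : Com} {l : List ℕ} (h : Queue σ l) (hf : Frame c σ τ)
    (hc : .queue ∉ c.natArrW ∧ .tail ∉ c.natW ∧ .head ∉ c.natW) : Queue τ l := by
  rwa [Queue, hf.natArr _ hc.1, hf.nat _ hc.2.1, hf.nat _ hc.2.2]

theorem Queue.head_lt_tail {l : List ℕ} (h : Queue σ l) :
    σ.nat .head < σ.nat .tail ↔ l ≠ [] := by
  rw [h.eq_add, ← List.length_pos_iff]
  omega

theorem runs_enqueue {l : List ℕ} {p : NExp} (h : Queue σ l) : Runs ω (enqueue p) σ fun t τ =>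
    t ≤ p.cost + 8 ∧ Queue τ (l ++ [p.eval σ]) := by
  simp only [enqueue, put1, incr, runs_seq, runs_setNA, runs_setN]
  refine ⟨by simp only [NExp.cost]; omega, ?_⟩
  simp only [Queue, NExp.eval, Store.setN_nat, Store.setN_natArr, Store.setNA_nat, reduceCtorEq,
    if_true, if_false]
  exact h.append fun i => by simp

namespace Problem

variable (D : Problem n k)

/-! ### The staircases of a trial -/

/-- All arcs into the block `w` come from `L`. -/
def Valid (L : Finset (Fin n)) (w : Fin n) : Prop := ∀ u, D.F.Arc D.st u w → u ∈ L

/-- No arc leads from the complement of `L` to `L`. -/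
def Closed (L : Finset (Fin n)) : Prop := ∀ w ∈ L, D.Valid L w

variable {D} in
theorem Closed.insert {L : Finset (Fin n)} {v : Fin n} (h : D.Closed L) (hv : D.Valid L v) :
    D.Closed (insert v L) := by
  intro w hw u hu
  rcases mem_insert.1 hw with rfl | hw
  · exact mem_insert_of_mem (hv u hu)
  · exact mem_insert_of_mem (h w hw u hu)

/-- The point where acyclicity enters the analysis of the algorithm: some block can always move. -/
theorem exists_valid {L : Finset (Fin n)} (h : L ≠ univ) : ∃ w ∉ L, D.Valid L w := by
  have : Lᶜ.Nonempty := by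
    rwa [nonempty_iff_ne_empty, Ne, compl_eq_empty_iff]
  obtain ⟨w, hw, hu⟩ := D.F.exists_no_arc_into D.st Lᶜ this
  exact ⟨w, mem_compl.1 hw, fun u hu' => by simpa using hu u hu'⟩

/-- `G b, G (b + 1), …` are increasing monotone staircases with `1, 2, …` blocks, up to `L`. -/
def Chain (G : ℕ → Finset (Fin n)) (b : ℕ) (L : Finset (Fin n)) : Prop :=
  -- The cap `n - 1` leaves out the full left part, which is not a cut.
  ∀ i < min L.card (n - 1), D.F.IsMSCut D.st (G (b + i)) ∧ (G (b + i)).card = i + 1 ∧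
    G (b + i) ⊆ L ∧ ∀ i' ≤ i, G (b + i') ⊆ G (b + i)

/-- The left part is `L`, and `λ` consists of the first `b` sets of `G₀` and the staircases that
led to `L`. -/
structure Trial (G₀ : ℕ → Finset (Fin n)) (b : ℕ) (L : Finset (Fin n)) (σ : Store) : Prop where
  left : D.Left L σ
  closed : D.Closed L
  stored : ∃ G, (∀ c < b, G c = G₀ c) ∧ D.Stored G (b + min L.card (n - 1)) σ ∧ D.Chain G b L

variable {D} {G₀ : ℕ → Finset (Fin n)} {b : ℕ}

theorem Trial.frame {L : Finset (Fin n)} {c : Com} (h : D.Trial G₀ b L σ) (hf : Frame c σ τ)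
    (hc : (.inL ∉ c.natArrW ∧ .netLeft ∉ c.natArrW ∧ .lamCut ∉ c.natArrW) ∧
      (.nLeft ∉ c.natW ∧ .lamLen ∉ c.natW) ∧ .wLeft ∉ c.realW ∧ .lamGain ∉ c.realArrW) :
    D.Trial G₀ b L τ := by
  obtain ⟨⟨h₁, h₂, h₃⟩, ⟨h₄, h₅⟩, h₆, h₇⟩ := hc
  obtain ⟨hl, hc, G, hG₀, hG, hch⟩ := h
  exact ⟨hl.congr (hf.natArr _ h₁) (hf.nat _ h₄) (hf.real _ h₆) (hf.natArr _ h₂), hc, G, hG₀,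
    hG.congr (hf.nat _ h₅) (hf.natArr _ h₃) (hf.realArr _ h₇), hch⟩

theorem Chain.insert {G : ℕ → Finset (Fin n)} {L : Finset (Fin n)} {v : Fin n}
    (h : D.Chain G b L) (hv : v ∉ L) (hc : D.Closed (insert v L)) (hlt : (insert v L).card < n) :
    D.Chain (Function.update G (b + L.card) (insert v L)) b (insert v L) := by
  have hcard := card_insert_of_notMem hv
  have hold : ∀ i < L.card, Function.update G (b + L.card) (Insert.insert v L) (b + i) = G (b + i) :=
    fun i hi => Function.update_of_ne (by omega) _ _
  intro i hi
  by_cases hiL : i = L.card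
  · subst hiL
    rw [Function.update_self]
    refine ⟨⟨⟨v, mem_insert_self _ _⟩, ?_, fun i j hij hj => hc j hj i hij⟩, hcard, Subset.rfl,
      fun i' hi' => ?_⟩
    · intro hu
      rw [hu, card_univ, Fintype.card_fin] at hlt
      exact hlt.false
    · rcases hi'.lt_or_eq with hi' | rfl
      · rw [hold i' hi']
        exact (h i' (by omega)).2.2.1.trans (subset_insert _ _)
      · rw [Function.update_self]
  · have hi' : i < L.card := by omega
    obtain ⟨h₁, h₂, h₃, h₄⟩ := h i (by omega)
    rw [hold i hi']
    refine ⟨h₁, h₂, h₃.trans (subset_insert _ _), fun i' hi'' => ?_⟩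
    rw [hold i' (by omega)]
    exact h₄ i' hi''

theorem runs_move {L : Finset (Fin n)} {v : Fin n} {l : List ℕ} (hR : D.Ready σ)
    (hT : D.Trial G₀ b L σ) (hq : Queue σ l) (hv : v ∉ L) (hval : D.Valid L v)
    (hnew : σ.nat .newV = v) :
    Runs ω (.seq moveLeft record) σ fun t τ => t ≤ 1000 * (n + k) ∧
      D.Trial G₀ b (insert v L) τ ∧ Queue τ (l ++ [(v : ℕ)]) := by
  obtain ⟨hL, hc, G, hG₀, hG, hch⟩ := hT
  have hc' := hc.insert hval
  refine (runs_moveLeft_record hR hL hv hnew).mono ?_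
  rintro t τ hτ ⟨ht, hL', htail, hq', hst⟩
  refine ⟨ht, ⟨hL', hc', ?_⟩, ?_⟩
  · obtain ⟨h₁, h₂⟩ := hst G _ hG
    have hcard := card_insert_of_notMem hv
    by_cases hlt : (insert v L).card < n
    · have e₁ : min L.card (n - 1) = L.card := by omega
      have e₂ : min (insert v L).card (n - 1) = L.card + 1 := by omega
      rw [e₁] at h₁
      rw [e₂]
      exact ⟨_, fun c hcb => by rw [Function.update_of_ne (by omega), hG₀ c hcb], h₁ hlt,
        hch.insert hv hc' hlt⟩
    -- The left part is now full: nothing was appended, and the capped length stays the same.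
    · have hle : (insert v L).card ≤ n := by simpa using card_le_univ (insert v L)
      have e : min (insert v L).card (n - 1) = min L.card (n - 1) := by omega
      refine ⟨G, hG₀, ?_, ?_⟩
      · rw [e]
        exact h₂ hlt
      · intro i hi
        rw [e] at hi
        obtain ⟨h₁, h₂, h₃, h₄⟩ := hch i hi
        exact ⟨h₁, h₂, h₃.trans (subset_insert _ _), h₄⟩
  · rw [Queue, htail, hτ.nat .head (by decide)]
    exact hq.append hq'

/-! ### Propagation of the wavefront -/

variable (D G₀ b) in
/-- The wavefront is `W`, and the edges in `T` have been tried. The left part was `L₀` at the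
beginning of the level; now it is `L`, and the blocks in `Q` are new. -/
structure Wave (L₀ W L : Finset (Fin n)) (Q : List (Fin n)) (T : Finset ℕ) (σ : Store) : Prop where
  ready : D.Ready σ
  trial : D.Trial G₀ b L σ
  front : ∀ v : Fin n, σ.natArr .inFront v 0 = if v ∈ W then 1 else 0
  tried : ∀ e < D.m, σ.natArr .tried e 0 = if e ∈ T then 1 else 0
  queue : Queue σ (Q.map Fin.val)
  T_sub : T ⊆ range D.m
  T_src : ∀ e ∈ T, (D.ed e).1 ∈ L₀
  W_sub : W ⊆ L₀
  L₀_sub : L₀ ⊆ L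
  Q_sub : ∀ v ∈ Q, v ∈ L ∧ v ∉ L₀
  card : L.card = L₀.card + Q.length
  -- The progress invariant: a movable block can be reached in this level by an untried arc or in
  -- the next one from a new block.
  valid : ∀ w ∉ L, D.Valid L w →
    (∃ e < D.m, e ∉ T ∧ (D.ed e).2 = w ∧ (D.ed e).1 ∈ W) ∨ ∃ p ∈ Q, D.F.Arc D.st p w

theorem Wave.isCand {L₀ W L : Finset (Fin n)} {Q : List (Fin n)} {T : Finset ℕ}
    (h : D.Wave G₀ b L₀ W L Q T σ) {e : ℕ} (he : e < D.m) :
    IsCand σ e ↔ (D.ed e).1 ∈ W ∧ (D.ed e).2 ∉ L ∧ e ∉ T := by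
  rw [IsCand, h.ready.src e he, h.ready.dst e he, h.front, h.trial.left.inL_eq_zero, h.tried e he]
  simp

/-- One try always consumes one fresh arc, whether or not a block moves. The budget covers the
validity scan (about `200n`), the move with its evaluation (`1000(n + k)`) and the new candidate
scan (about `240n`). -/
theorem runs_try {L₀ W L : Finset (Fin n)} {Q : List (Fin n)} {T : Finset ℕ}
    (h : D.Wave G₀ b L₀ W L Q T σ) (hc : CandList σ) (hpos : 0 < σ.nat .nCand) :
    Runs ω (.rand .pick (.var .nCand) ;;
      .e ≔ at1 .cand (.var .pick) ;;
      put1 .tried (.var .e) (.lit 1) ;;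
      checkValid ;;
      MSCut.when (.neq (.var .valid) (.lit 1))
        (.newV ≔ at1 .dst (.var .e) ;; moveLeft ;; record) ;;
      findCands) σ fun t τ => t + 4 ≤ 1600 * (n + k) ∧ CandList τ ∧
        ∃ L' Q' T', D.Wave G₀ b L₀ W L' Q' T' τ ∧ T'.card = T.card + 1 := by
  have hn := D.n_pos
  have hm := D.m_le
  refine Runs.seq (P := fun t τ => t = 2 ∧ τ.nat .pick < σ.nat .nCand)
    (Runs.rand fun r hr τ hτ _ _ _ => ⟨rfl, ?_⟩) ?_
  · rw [hτ]
    simp only [NExp.eval] at hr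
    simp only [Store.setN_nat, if_true]
    omega
  rintro t₁ τ₁ h₁ ⟨rfl, hp₁⟩
  refine Runs.seq (P := fun t τ => t ≤ 10 ∧ τ.nat .e = τ₁.natArr .cand (τ₁.nat .pick) 0)
    (by simp [NExp.cost]) ?_
  rintro t₂ τ₂ h₂ ⟨ht₂, he₂⟩
  refine Runs.seq (P := fun t τ => t ≤ 10 ∧ ∀ f, τ.natArr .tried f 0 =
    if f = τ₂.nat .e then 1 else τ₂.natArr .tried f 0) (by simp [NExp.cost]) ?_
  rintro t₃ τ₃ h₃ ⟨ht₃, htr₃⟩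
  refine Runs.seq (runs_checkValid τ₃) ?_
  rintro t₄ τ₄ h₄ ⟨ht₄, hv₄⟩
  rw [h₁.natArr .cand (by decide)] at he₂
  obtain ⟨hem, hcand⟩ := hc.cand _ hp₁
  rw [← he₂] at hcand hem
  rw [h.ready.nEdge] at hem
  rw [h.isCand hem] at hcand
  obtain ⟨hsW, hdL, heT⟩ := hcand
  set e := τ₂.nat .e with he
  have hR₃ := ((h.ready.frame h₁ (by decide)).frame h₂ (by decide)).frame h₃ (by decide)
  have hT₃ := ((h.trial.frame h₁ (by decide)).frame h₂ (by decide)).frame h₃ (by decide)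
  have hQ₃ := ((h.queue.frame h₁ (by decide)).frame h₂ (by decide)).frame h₃ (by decide)
  have hR₄ := hR₃.frame h₄ (by decide)
  have hT₄ := hT₃.frame h₄ (by decide)
  have hQ₄ := hQ₃.frame h₄ (by decide)
  have he₃ : τ₃.nat .e = e := h₃.nat .e (by decide)
  have he₄ : τ₄.nat .e = e := (h₄.nat .e (by decide)).trans he₃
  have hF₄ : τ₄.natArr .inFront = σ.natArr .inFront := by
    rw [h₄.natArr .inFront (by decide), h₃.natArr .inFront (by decide),
      h₂.natArr .inFront (by decide), h₁.natArr .inFront (by decide)]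
  have htr₄ : ∀ f < D.m, τ₄.natArr .tried f 0 = if f ∈ insert e T then 1 else 0 := fun f hf => by
    rw [h₄.natArr .tried (by decide), htr₃, h₂.natArr .tried (by decide),
      h₁.natArr .tried (by decide), h.tried f hf]
    simp only [mem_insert]
    split_ifs <;> tauto
  have hvalid : τ₄.nat .valid = 1 ↔ D.Valid L (D.ed e).2 := by
    rw [hv₄, hR₃.nEdge, he₃]
    constructor
    · intro hf u hu
      obtain ⟨f, hf', hfe⟩ := D.exists_ed hu
      have := hf f hf'
      rw [hR₃.dst f hf', hR₃.dst e hem, hR₃.src f hf', hfe, Ne, hT₃.left.inL_eq_zero,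
        not_not] at this
      exact this rfl
    · intro hf f hf' hfe
      rw [hR₃.dst f hf', hR₃.dst e hem, Fin.val_inj] at hfe
      rw [hR₃.src f hf', Ne, hT₃.left.inL_eq_zero, not_not]
      exact hf _ (hfe ▸ D.arc_ed hf')
  have hT_sub : insert e T ⊆ range D.m := insert_subset (mem_range.2 hem) h.T_sub
  have hT_src : ∀ f ∈ insert e T, (D.ed f).1 ∈ L₀ := by
    intro f hf
    rcases mem_insert.1 hf with rfl | hf
    · exact h.W_sub hsW
    · exact h.T_src f hf
  have hstep : Runs ω (MSCut.when (.neq (.var .valid) (.lit 1))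
      (.newV ≔ at1 .dst (.var .e) ;; moveLeft ;; record)) τ₄ fun t τ =>
        t ≤ 1000 * (n + k) + 20 ∧ ∃ L' Q', D.Wave G₀ b L₀ W L' Q' (insert e T) τ := by
    rw [MSCut.when, runs_ite]
    constructor
    · intro hval
      have hval : D.Valid L (D.ed e).2 := hvalid.1 hval
      refine Runs.seq (P := fun t τ => t ≤ 10 ∧ τ.nat .newV = ((D.ed e).2 : ℕ)) ?_ ?_
      · simp only [runs_setN, at1, NExp.eval, he₄, hR₄.dst e hem, Store.setN_nat, if_true]
        exact ⟨by simp [NExp.cost], trivial⟩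
      rintro t₅ τ₅ h₅ ⟨ht₅, hnew⟩
      refine (runs_move (hR₄.frame h₅ (by decide)) (hT₄.frame h₅ (by decide))
        (hQ₄.frame h₅ (by decide)) hdL hval hnew).mono ?_
      rintro t₆ τ₆ h₆ ⟨ht₆, hT₆, hQ₆⟩
      refine ⟨by simp only [BExp.cost, NExp.cost]; omega, insert (D.ed e).2 L, Q ++ [(D.ed e).2], ?_⟩
      refine ⟨(hR₄.frame h₅ (by decide)).frame h₆ (by decide), hT₆, ?_, ?_, by simpa using hQ₆,
        hT_sub, hT_src, h.W_sub, h.L₀_sub.trans (subset_insert _ _), ?_, ?_, ?_⟩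
      · rw [h₆.natArr .inFront (by decide), h₅.natArr .inFront (by decide), hF₄]
        exact h.front
      · rw [h₆.natArr .tried (by decide), h₅.natArr .tried (by decide)]
        exact htr₄
      · intro v hv
        rcases List.mem_append.1 hv with hv | hv
        · exact ⟨mem_insert_of_mem (h.Q_sub v hv).1, (h.Q_sub v hv).2⟩
        · rw [List.mem_singleton.1 hv]
          exact ⟨mem_insert_self _ _, fun h' => hdL (h.L₀_sub h')⟩
      · rw [card_insert_of_notMem hdL, h.card, List.length_append, List.length_singleton, add_assoc]
      · intro w hw hwv
        have hwL : w ∉ L := fun h' => hw (mem_insert_of_mem h')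
        -- If the moved block precedes `w`, it serves as the new predecessor. Otherwise `w` was
        -- already movable, and its witness survives because the arc just tried ends in another
        -- block.
        by_cases hd : D.F.Arc D.st (D.ed e).2 w
        · exact .inr ⟨_, by simp, hd⟩
        · have : D.Valid L w := fun u hu => by
            rcases mem_insert.1 (hwv u hu) with rfl | h'
            · exact absurd hu hd
            · exact h'
          rcases h.valid w hwL this with ⟨f, hf, hfT, hfw, hfW⟩ | ⟨p, hp, hpw⟩
          · refine .inl ⟨f, hf, fun hfe => ?_, hfw, hfW⟩
            rcases mem_insert.1 hfe with rfl | hfe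
            · exact hw (hfw ▸ mem_insert_self _ _)
            · exact hfT hfe
          · exact .inr ⟨p, List.mem_append_left _ hp, hpw⟩
    · intro hval
      have hval : ¬ D.Valid L (D.ed e).2 := fun h' => hval (hvalid.2 h')
      rw [runs_skip]
      refine ⟨by simp only [BExp.cost, NExp.cost]; omega, L, Q, hR₄, hT₄, by rw [hF₄]; exact h.front,
        htr₄, hQ₄, hT_sub, hT_src, h.W_sub, h.L₀_sub, h.Q_sub, h.card, fun w hw hwv => ?_⟩
      -- The target of the arc just tried is not movable, so this arc was not the witness for any
      -- movable block.
      refine (h.valid w hw hwv).imp_left ?_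
      rintro ⟨f, hf, hfT, hfw, hfW⟩
      refine ⟨f, hf, fun hfe => ?_, hfw, hfW⟩
      rcases mem_insert.1 hfe with rfl | hfe
      · exact hval (hfw ▸ hwv)
      · exact hfT hfe
  refine Runs.seq hstep ?_
  rintro t₅ τ₅ - ⟨ht₅, L', Q', hw⟩
  refine (runs_findCands τ₅).mono ?_
  rintro t₆ τ₆ h₆ ⟨ht₆, hc₆⟩
  rw [hR₃.nEdge] at ht₄
  rw [hw.ready.nEdge] at ht₆
  refine ⟨by omega, hc₆, L', Q', insert e T, ?_, card_insert_of_notMem heT⟩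
  exact { hw with
    ready := hw.ready.frame h₆ (by decide)
    trial := hw.trial.frame h₆ (by decide)
    front := by rw [h₆.natArr .inFront (by decide)]; exact hw.front
    tried := by rw [h₆.natArr .tried (by decide)]; exact hw.tried
    queue := hw.queue.frame h₆ (by decide) }

theorem runs_propagate {L₀ W L : Finset (Fin n)} {Q : List (Fin n)} {T : Finset ℕ}
    (h : D.Wave G₀ b L₀ W L Q T σ) :
    Runs ω propagate σ fun t τ => ∃ L' Q' T', D.Wave G₀ b L₀ W L' Q' T' τ ∧
      t + 1600 * (n + k) * (D.m - T'.card) ≤ 1600 * (n + k) * (D.m - T.card) + 300 * n ∧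
      ∀ w ∉ L', D.Valid L' w → ∃ p ∈ Q', D.F.Arc D.st p w := by
  have hn := D.n_pos
  have hm := D.m_le
  rw [propagate]
  refine Runs.seq (runs_findCands σ) ?_
  rintro t₁ τ₁ h₁ ⟨ht₁, hc₁⟩
  have hw₁ : D.Wave G₀ b L₀ W L Q T τ₁ := { h with
    ready := h.ready.frame h₁ (by decide)
    trial := h.trial.frame h₁ (by decide)
    front := by rw [h₁.natArr .inFront (by decide)]; exact h.front
    tried := by rw [h₁.natArr .tried (by decide)]; exact h.tried
    queue := h.queue.frame h₁ (by decide) }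
  refine (Runs.loop (φ := 1600 * (n + k) * (D.m - T.card)) (I := fun φ τ => CandList τ ∧
    ∃ L' Q' T', D.Wave G₀ b L₀ W L' Q' T' τ ∧ φ = 1600 * (n + k) * (D.m - T'.card))
    ⟨hc₁, L, Q, T, hw₁, rfl⟩ ?_).mono ?_
  · rintro φ τ - ⟨hc, L', Q', T', hw, rfl⟩ hpos
    refine (runs_try hw hc hpos).mono ?_
    rintro t υ - ⟨ht, hc', L'', Q'', T'', hw', hcard⟩
    refine ⟨_, ⟨hc', L'', Q'', T'', hw', rfl⟩, ?_⟩
    have hle : T''.card ≤ D.m := by simpa using card_le_card hw'.T_sub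
    have : D.m - T'.card = D.m - T''.card + 1 := by omega
    rw [this, Nat.mul_succ]
    simp only [BExp.cost, NExp.cost]
    omega
  · rintro t τ - ⟨hnot, φ, ⟨hc, L', Q', T', hw, rfl⟩, ht⟩
    refine ⟨L', Q', T', hw, ?_, fun w hwL hwv => ?_⟩
    · rw [h.ready.nEdge] at ht₁
      simp only [BExp.cost, NExp.cost] at ht
      omega
    -- With no candidates left, the first alternative of the progress invariant is void.
    · refine (hw.valid w hwL hwv).resolve_left ?_
      rintro ⟨e, he, heT, rfl, heW⟩
      exact hnot (hc.pos e (by rw [hw.ready.nEdge]; exact he) ((hw.isCand he).2 ⟨heW, hwL, heT⟩))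

end Problem

end MSCut

/-! ### Levels and whole trials. -/

namespace MSCut

open RealRAM

variable {ω : Random} {σ τ : Store} {n k : ℕ}

namespace Problem

variable (D : Problem n k) (G₀ : ℕ → Finset (Fin n)) (b : ℕ)

/-! ### Trials -/

/-- While a level is read from the queue: the blocks in `W` have been read, those in `q` have not,
and the edges in `T` have been tried at previous levels. -/
structure Level (L W : Finset (Fin n)) (q : List (Fin n)) (T : Finset ℕ) (σ : Store) : Prop where
  ready : D.Ready σ
  trial : D.Trial G₀ b L σ
  front : ∀ v : Fin n, σ.natArr .inFront v 0 = if v ∈ W then 1 else 0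
  tried : ∀ e < D.m, σ.natArr .tried e 0 = if e ∈ T then 1 else 0
  queue : Queue σ (q.map Fin.val ++ [n])
  T_sub : T ⊆ range D.m
  -- All arcs out of the present wavefront are fresh, since tried arcs start at blocks of earlier
  -- wavefronts.
  T_src : ∀ e ∈ T, (D.ed e).1 ∈ L ∧ (D.ed e).1 ∉ W ∧ (D.ed e).1 ∉ q
  W_sub : W ⊆ L
  q_sub : ∀ v ∈ q, v ∈ L
  valid : ∀ w ∉ L, D.Valid L w → ∃ p, (p ∈ W ∨ p ∈ q) ∧ D.F.Arc D.st p w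

/-- A bound for the time that a trial still takes. -/
def levelTime (L : Finset (Fin n)) (q : List (Fin n)) (T : Finset ℕ) : ℕ :=
  -- The terms pay for the overhead of the remaining levels (each but the last moves a block), for
  -- the arcs still to be tried, and for reading the blocks that are queued or yet to be queued.
  1000 * n * (1 + (n - L.card)) + 1600 * (n + k) * (D.m - T.card) +
    60 * (q.length + (n - L.card))

/-- The body of the main loop of a trial. -/
def levelStep : Com :=
  .cur ≔ at1 .queue (.var .head) ;;
  incr .head ;;
  .ite (.nlt (.var .cur) (.var .nBlk))
    (put1 .inFront (.var .cur) (.lit 1))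
    (propagate ;;
    forUp .v .nBlk (put1 .inFront (.var .v) (.lit 0)) ;;
    incr .level ;;
    MSCut.when (.nlt (.var .head) (.var .tail)) (enqueue (.var .nBlk)))

variable {D G₀ b}

theorem Wave.runs_endLevel {L₀ W L : Finset (Fin n)} {Q : List (Fin n)} {T : Finset ℕ}
    (h : D.Wave G₀ b L₀ W L Q T σ)
    (hval : ∀ w ∉ L, D.Valid L w → ∃ p ∈ Q, D.F.Arc D.st p w) :
    Runs ω (forUp .v .nBlk (put1 .inFront (.var .v) (.lit 0)) ;;
      incr .level ;;
      MSCut.when (.nlt (.var .head) (.var .tail)) (enqueue (.var .nBlk))) σ fun t τ =>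
      t ≤ 12 * n + 50 ∧ ((Q ≠ [] ∧ D.Level G₀ b L ∅ Q T τ) ∨
        (Q = [] ∧ D.Ready τ ∧ D.Trial G₀ b L τ ∧ Queue τ [] ∧ L = univ)) := by
  refine Runs.seq (runs_clear σ (by decide)) ?_
  rintro t₁ τ₁ h₁ ⟨ht₁, hF₁⟩
  rw [h.ready.nBlk] at ht₁ hF₁
  refine Runs.seq (P := fun t τ => t ≤ 10) (by simp [NExp.cost]) ?_
  rintro t₂ τ₂ h₂ ht₂
  have hR₂ := (h.ready.frame h₁ (by decide)).frame h₂ (by decide)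
  have hT₂ := (h.trial.frame h₁ (by decide)).frame h₂ (by decide)
  have hQ₂ := (h.queue.frame h₁ (by decide)).frame h₂ (by decide)
  simp only [MSCut.when, runs_ite, BExp.Holds, NExp.eval, hQ₂.head_lt_tail]
  constructor
  · intro hne
    have hne : Q ≠ [] := by simpa using hne
    refine (runs_enqueue hQ₂).mono ?_
    rintro t₃ τ₃ h₃ ⟨ht₃, hQ₃⟩
    refine ⟨by simp only [BExp.cost, NExp.cost] at ht₃ ⊢; omega, .inl ⟨hne, ?_⟩⟩
    refine ⟨hR₂.frame h₃ (by decide), hT₂.frame h₃ (by decide), ?_, ?_, ?_, h.T_sub, ?_,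
      empty_subset _, fun v hv => (h.Q_sub v hv).1, fun w hw hwv => ?_⟩
    · intro v
      rw [h₃.natArr .inFront (by decide), h₂.natArr .inFront (by decide), hF₁ v v.2]
      simp
    · rw [h₃.natArr .tried (by decide), h₂.natArr .tried (by decide),
        h₁.natArr .tried (by decide)]
      exact h.tried
    · simpa [hR₂.nBlk] using hQ₃
    · exact fun e he => ⟨h.L₀_sub (h.T_src e he), notMem_empty _,
        fun hq => (h.Q_sub _ hq).2 (h.T_src e he)⟩
    · obtain ⟨p, hp, hpw⟩ := hval w hw hwv
      exact ⟨p, .inr hp, hpw⟩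
  · intro hnil
    have hnil : Q = [] := by simpa using hnil
    rw [runs_skip]
    refine ⟨by simp only [BExp.cost, NExp.cost]; omega, .inr ⟨hnil, hR₂, hT₂, by simpa [hnil] using hQ₂, ?_⟩⟩
    -- If the right part were nonempty, it would contain a movable block, whose required predecessor
    -- among the new blocks does not exist.
    by_contra hL
    obtain ⟨w, hw, hwv⟩ := D.exists_valid hL
    obtain ⟨p, hp, -⟩ := hval w hw hwv
    simp [hnil] at hp

theorem Level.runs_step {L W : Finset (Fin n)} {q : List (Fin n)} {T : Finset ℕ}
    (h : D.Level G₀ b L W q T σ) : Runs ω levelStep σ fun t τ =>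
      (∃ L' W' q' T', D.Level G₀ b L' W' q' T' τ ∧
        t + 4 + D.levelTime L' q' T' ≤ D.levelTime L q T) ∨
      (D.Ready τ ∧ D.Trial G₀ b univ τ ∧ Queue τ [] ∧ t + 4 ≤ D.levelTime L q T) := by
  have hn := D.n_pos
  rw [levelStep]
  refine Runs.seq (P := fun t τ => t ≤ 10 ∧ τ.nat .cur = σ.natArr .queue (σ.nat .head) 0)
    (by simp [NExp.cost]) ?_
  rintro t₁ τ₁ h₁ ⟨ht₁, hcur₁⟩
  refine Runs.seq (P := fun t τ => t ≤ 10 ∧ τ.nat .head = τ₁.nat .head + 1)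
    (by simp [NExp.cost]) ?_
  rintro t₂ τ₂ h₂ ⟨ht₂, hh₂⟩
  have hR₂ := (h.ready.frame h₁ (by decide)).frame h₂ (by decide)
  have hT₂ := (h.trial.frame h₁ (by decide)).frame h₂ (by decide)
  have hcur : τ₂.nat .cur = σ.natArr .queue (σ.nat .head) 0 := by
    rw [h₂.nat .cur (by decide), hcur₁]
  have hF₂ : ∀ v : Fin n, τ₂.natArr .inFront v 0 = if v ∈ W then 1 else 0 := by
    rw [h₂.natArr .inFront (by decide), h₁.natArr .inFront (by decide)]
    exact h.front
  have htr₂ : ∀ e < D.m, τ₂.natArr .tried e 0 = if e ∈ T then 1 else 0 := by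
    rw [h₂.natArr .tried (by decide), h₁.natArr .tried (by decide)]
    exact h.tried
  have hq₂ : ∀ x l, Queue σ (x :: l) → τ₂.nat .cur = x ∧ Queue τ₂ l := by
    intro x l hq
    refine ⟨by rw [hcur, hq.1], ?_⟩
    rw [Queue, h₂.natArr .queue (by decide), h₁.natArr .queue (by decide),
      h₂.nat .tail (by decide), h₁.nat .tail (by decide), hh₂, h₁.nat .head (by decide)]
    exact hq.2
  rw [runs_ite]
  simp only [BExp.Holds, NExp.eval, hR₂.nBlk]
  cases q with
  | nil =>
    obtain ⟨hcn, hQ⟩ := hq₂ _ _ h.queue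
    -- Only the marker `n` is left in front, so the test for a block fails and the wavefront is
    -- propagated.
    refine ⟨fun hlt => absurd hlt (by rw [hcn]; exact lt_irrefl n), fun _ => ?_⟩
    have hwave : D.Wave G₀ b L W L [] T τ₂ := by
      refine ⟨hR₂, hT₂, hF₂, htr₂, hQ, h.T_sub, fun e he => (h.T_src e he).1, h.W_sub,
        Subset.rfl, by simp, by simp, fun w hw hwv => ?_⟩
      obtain ⟨p, hp, hpw⟩ := h.valid w hw hwv
      have hp : p ∈ W := by simpa using hp
      obtain ⟨e, he, hed⟩ := D.exists_ed hpw
      refine .inl ⟨e, he, fun heT => (h.T_src e heT).2.1 (by rwa [hed]), by rw [hed], by rwa [hed]⟩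
    refine Runs.seq (runs_propagate hwave) ?_
    rintro t₃ τ₃ - ⟨L', Q', T', hw, ht₃, hval⟩
    refine (hw.runs_endLevel hval).mono ?_
    rintro t₄ τ₄ - ⟨ht₄, ⟨hne, hlev⟩ | ⟨rfl, hR, hT, hQ, rfl⟩⟩
    · refine .inl ⟨L', ∅, Q', T', hlev, ?_⟩
      have hle : L'.card ≤ n := by simpa using card_le_univ L'
      have hlen : 1 ≤ Q'.length := List.length_pos_iff.2 hne
      have hc := hw.card
      obtain ⟨u, hu⟩ : ∃ u, n - L'.card = u := ⟨_, rfl⟩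
      have hu' : n - L.card = u + Q'.length := by omega
      -- At least one block moved, which releases the `1000 * n` that this level may spend.
      have hmul : 1000 * n ≤ 1000 * n * Q'.length := Nat.le_mul_of_pos_right _ hlen
      have hsplit : 1000 * n * (1 + (u + Q'.length)) =
          1000 * n * (1 + u) + 1000 * n * Q'.length := by ring
      simp only [levelTime, hu, hu', BExp.cost, NExp.cost, List.length_nil, hsplit]
      omega
    · refine .inr ⟨hR, hT, hQ, ?_⟩
      have hmul : 1000 * n ≤ 1000 * n * (1 + (n - L.card)) :=
        Nat.le_mul_of_pos_right _ (by omega)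
      simp only [levelTime, BExp.cost, NExp.cost, List.length_nil]
      omega
  | cons v q =>
    obtain ⟨hcv, hQ⟩ := hq₂ _ _ h.queue
    refine ⟨fun _ => ?_, fun hlt => absurd v.2 (by rwa [hcv] at hlt)⟩
    refine (Runs.of_straight (T := 4) (P := fun τ => ∀ w : Fin n, τ.natArr .inFront w 0 =
      if w ∈ insert v W then 1 else 0) ?_ rfl (by decide)).mono ?_
    · simp only [put1, runs_setNA, NExp.eval, hcv, Store.setNA_natArr, true_and, and_true,
        Fin.val_inj, mem_insert, hF₂]
      intro w
      split_ifs <;> tauto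
    · rintro t₃ τ₃ h₃ ⟨ht₃, hF₃⟩
      refine .inl ⟨L, insert v W, q, T, ⟨hR₂.frame h₃ (by decide), hT₂.frame h₃ (by decide), hF₃,
        by rw [h₃.natArr .tried (by decide)]; exact htr₂, hQ.frame h₃ (by decide), h.T_sub, ?_, ?_,
        fun w hw => h.q_sub w (List.mem_cons_of_mem _ hw), ?_⟩, ?_⟩
      · intro e he
        obtain ⟨h₁, h₂, h₃⟩ := h.T_src e he
        rw [List.mem_cons, not_or] at h₃
        exact ⟨h₁, by rw [mem_insert, not_or]; exact ⟨h₃.1, h₂⟩, h₃.2⟩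
      · exact insert_subset (h.q_sub v List.mem_cons_self) h.W_sub
      · intro w hw hwv
        obtain ⟨p, hp, hpw⟩ := h.valid w hw hwv
        refine ⟨p, ?_, hpw⟩
        rw [List.mem_cons] at hp
        rw [mem_insert]
        tauto
      · simp only [levelTime, List.length_cons, BExp.cost, NExp.cost]
        omega

theorem runs_trial {G₀ : ℕ → Finset (Fin n)} {b : ℕ} (hR : D.Ready σ) (hS : D.Stored G₀ b σ) :
    Runs ω trial σ fun t τ => t ≤ 10000 * (n * (n + k)) ∧ D.Ready τ ∧
      ∃ G, (∀ c < b, G c = G₀ c) ∧ D.Stored G (b + (n - 1)) τ ∧ D.Chain G b univ := by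
  have hn := D.n_pos
  have hm := D.m_le
  rw [trial]
  refine Runs.seq (runs_resetTrial σ) ?_
  rintro t₁ τ₁ h₁ ⟨ht₁, hin₁, htr₁, hnet₁, hw₁, hnl₁, hh₁, htl₁⟩
  have hR₁ := hR.frame h₁ (by decide)
  rw [hR.nBlk] at hin₁ ht₁
  rw [hR.nEdge] at htr₁ ht₁
  rw [hR.nNet] at hnet₁ ht₁
  have hT₁ : D.Trial G₀ b ∅ τ₁ := by
    refine ⟨⟨fun v => by simp [(hin₁ v v.2).1], by simp [hnl₁], by simp [hw₁],
      fun _ j => by simp [hnet₁ j j.2]⟩, fun w hw => absurd hw (notMem_empty w), G₀,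
      fun _ _ => rfl, ?_, fun i hi => absurd hi (by simp)⟩
    simpa using hS.congr (h₁.nat .lamLen (by decide)) (h₁.natArr .lamCut (by decide))
      (h₁.realArr .lamGain (by decide))
  have hQ₁ : Queue τ₁ [] := by
    rw [Queue, hh₁, htl₁]
    exact rfl
  refine Runs.seq (P := fun t τ => t ≤ 10 ∧ τ.nat .newV = (D.s : ℕ))
    (by simp [NExp.cost, hR₁.source]) ?_
  rintro t₂ τ₂ h₂ ⟨ht₂, hnew₂⟩
  rw [runs_seq_assoc]
  refine Runs.seq (runs_move (hR₁.frame h₂ (by decide)) (hT₁.frame h₂ (by decide))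
    (hQ₁.frame h₂ (by decide)) (notMem_empty D.s) (fun u hu => absurd hu (D.isSource.1 u)) hnew₂) ?_
  rintro t₃ τ₃ h₃ ⟨ht₃, hT₃, hQ₃⟩
  have hR₃ := (hR₁.frame h₂ (by decide)).frame h₃ (by decide)
  refine Runs.seq (runs_enqueue hQ₃) ?_
  rintro t₄ τ₄ h₄ ⟨ht₄, hQ₄⟩
  have hlev : D.Level G₀ b {D.s} ∅ [D.s] ∅ τ₄ := by
    refine ⟨hR₃.frame h₄ (by decide), hT₃.frame h₄ (by decide), ?_, ?_, ?_, empty_subset _,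
      by simp, empty_subset _, by simp, ?_⟩
    · intro v
      rw [h₄.natArr .inFront (by decide), h₃.natArr .inFront (by decide),
        h₂.natArr .inFront (by decide), (hin₁ v v.2).2]
      simp
    · intro e he
      rw [h₄.natArr .tried (by decide), h₃.natArr .tried (by decide),
        h₂.natArr .tried (by decide), htr₁ e he]
      simp
    · simpa [hR₃.nBlk] using hQ₄
    -- Uniqueness of the source is used here: any other block has a predecessor, and if the block is
    -- movable, this predecessor is the source.
    · intro w hw hwv
      have hne : w ≠ D.s := by simpa using hw
      obtain ⟨p, hp⟩ := D.isSource.2 w hne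
      exact ⟨p, .inr (by simpa using hwv p hp), hp⟩
  refine (Runs.loop (φ := D.levelTime {D.s} [D.s] ∅) (I := fun φ τ =>
    (∃ L W q T, D.Level G₀ b L W q T τ ∧ φ = D.levelTime L q T) ∨
      (D.Ready τ ∧ D.Trial G₀ b univ τ ∧ Queue τ []))
    (.inl ⟨_, _, _, _, hlev, rfl⟩) ?_).mono ?_
  · rintro φ τ - (⟨L, W, q, T, h, rfl⟩ | ⟨-, -, hQ⟩) hlt
    · refine h.runs_step.mono ?_
      rintro t υ - (⟨L', W', q', T', h', ht⟩ | ⟨hR', hT', hQ', ht⟩)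
      · exact ⟨_, .inl ⟨_, _, _, _, h', rfl⟩, ht⟩
      · exact ⟨0, .inr ⟨hR', hT', hQ'⟩, ht⟩
    · exact absurd rfl (hQ.head_lt_tail.1 hlt)
  · rintro t τ - ⟨hnot, φ, ⟨L, W, q, T, h, rfl⟩ | ⟨hR', ⟨-, -, G, hG₀, hG, hch⟩, -⟩, ht⟩
    -- The loop cannot stop inside a level, because the marker is still in the queue.
    · exact absurd (h.queue.head_lt_tail.2 (by simp)) hnot
    · refine ⟨?_, hR', G, hG₀, ?_, hch⟩
      · simp only [levelTime, card_singleton, card_empty, List.length_singleton, BExp.cost,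
          NExp.cost] at ht ht₄
        have e₁ : n ≤ n * (n + k) := Nat.le_mul_of_pos_right _ (by omega)
        have e₂ : n + k ≤ n * (n + k) := Nat.le_mul_of_pos_left _ hn
        have e₃ : 1000 * n * (1 + (n - 1)) ≤ 1000 * (n * (n + k)) := by
          rw [Nat.add_sub_cancel' hn, mul_assoc]
          gcongr
          omega
        have e₄ : 1600 * (n + k) * (D.m - 0) ≤ 6400 * (n * (n + k)) :=
          calc _ ≤ 1600 * (n + k) * (4 * n) := Nat.mul_le_mul_left _ (by omega)
            _ = _ := by ring
        omega
      · simpa using hG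

end Problem

end MSCut

namespace MSCut

open RealRAM

variable {ω : Random} {n k : ℕ}

/-! ### The whole program -/

theorem IsEdgeList.bijOn {F : Floorplan n} {st : StairType} {E : List (Fin n × Fin n)}
    (hE : IsEdgeList F st E) (d : Fin n × Fin n) :
    Set.BijOn (fun e => E[e]?.getD d) (Set.Iio E.length) (F.edges st) := by
  obtain ⟨hnd, hmem⟩ := hE
  refine ⟨fun e he => ?_, fun e he f hf h => ?_, fun p hp => ?_⟩
  · rw [Set.mem_Iio] at he
    simpa [Floorplan.edges, he] using (hmem E[e]).1 (List.getElem_mem he)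
  · rw [Set.mem_Iio] at he hf
    simp only [List.getElem?_eq_getElem he, List.getElem?_eq_getElem hf, Option.getD_some] at h
    exact hnd.getElem_inj_iff.1 h
  · have hp : F.Arc st p.1 p.2 := by simpa [Floorplan.edges] using hp
    obtain ⟨e, he, rfl⟩ := List.mem_iff_getElem.1 ((hmem p).2 hp)
    exact ⟨e, he, by simp [he]⟩

/-- The problem that the input describes. -/
def problem (F : Floorplan n) (st : StairType) (bt : BalType) (N : Fin k → Finset (Fin n))
    (γ β : ℝ) {s : Fin n} (hs : F.IsSource st s) {E : List (Fin n × Fin n)}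
    (hE : IsEdgeList F st E) : Problem n k where
  F := F
  st := st
  bt := bt
  N := N
  γ := γ
  β := β
  s := s
  -- The default pair only fills positions beyond the list; the enumeration matters for indices
  -- below `m`.
  ed e := E[e]?.getD (s, s)
  m := E.length
  isSource := hs
  bijOn := hE.bijOn _

theorem getD_map {α β : Type*} (E : List α) (f : α → β) (d : α) (d' : β) {e : ℕ}
    (he : e < E.length) : (E.map f).getD e d' = f (E[e]?.getD d) := by
  simp [List.getD, he]

section Preparation

variable (F : Floorplan n) (st : StairType) (bt : BalType) (N : Fin k → Finset (Fin n)) (γ β : ℝ)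
  {s : Fin n} (hs : F.IsSource st s) {E : List (Fin n × Fin n)} (hE : IsEdgeList F st E)

theorem isCorner_input {e f : ℕ} (he : e < E.length) (hf : f < E.length) :
    IsCorner (input F s E N γ β bt) e f ↔
      F.LeftAdj (E[e]?.getD (s, s)).1 (E[e]?.getD (s, s)).2 ∧
      ¬ F.LeftAdj (E[f]?.getD (s, s)).1 (E[f]?.getD (s, s)).2 ∧
      F.Meet (E[e]?.getD (s, s)) (E[f]?.getD (s, s)) := by
  simp only [IsCorner, input, inputNatArr, inputRealArr, getD_map E _ (s, s) _ he,
    getD_map E _ (s, s) _ hf, Floorplan.Meet, Prod.ext_iff]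
  refine and_congr (by simp) (and_congr (by simp) Iff.rfl)

theorem weight_input (v : Fin n) :
    (if (input F s E N γ β bt).nat .byNumber = 0 then (input F s E N γ β bt).realArr .area v 0
      else 1) = F.weight bt v := by
  cases bt <;> simp [input, inputNat, inputRealArr, Floorplan.weight]

theorem runs_prep : Runs ω (prepWeights ;; prepNets ;; prepCorners) (input F s E N γ β bt)
    fun t τ => t ≤ 3000 * (n * (n + k)) ∧ (problem F st bt N γ β hs hE).Ready τ := by
  set D := problem F st bt N γ β hs hE with hD
  have hn := D.n_pos
  have hm := D.m_le
  refine Runs.seq (runs_prepWeights _) ?_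
  rintro t₁ τ₁ h₁ ⟨ht₁, hwt₁, hwT₁⟩
  refine Runs.seq (runs_prepNets τ₁) ?_
  rintro t₂ τ₂ h₂ ⟨ht₂, hdeg₂⟩
  refine (runs_prepCorners τ₂).mono ?_
  rintro t₃ τ₃ h₃ ⟨ht₃, hc₃⟩
  have hB : (input F s E N γ β bt).nat .nBlk = n := rfl
  have hB₁ : τ₁.nat .nBlk = n := h₁.nat .nBlk (by decide)
  have hN₁ : τ₁.nat .nNet = k := h₁.nat .nNet (by decide)
  have hE₂ : τ₂.nat .nEdge = E.length := (h₂.nat .nEdge (by decide)).trans (h₁.nat .nEdge (by decide))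
  rw [hB] at ht₁ hwt₁ hwT₁
  rw [hB₁, hN₁] at ht₂
  rw [hN₁, hB₁] at hdeg₂
  rw [hE₂] at ht₃ hc₃
  have hcorner : ∀ e f, IsCorner τ₂ e f ↔ IsCorner (input F s E N γ β bt) e f := fun e f => by
    simp only [IsCorner, h₂.natArr .ori (by decide), h₁.natArr .ori (by decide),
      h₂.realArr .loX (by decide), h₁.realArr .loX (by decide), h₂.realArr .loY (by decide),
      h₁.realArr .loY (by decide), h₂.realArr .hiX (by decide), h₁.realArr .hiX (by decide),
      h₂.realArr .hiY (by decide), h₁.realArr .hiY (by decide)]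
  refine ⟨?_, ?_⟩
  · have hm : E.length ≤ 4 * n := hm
    have e₁ : n ≤ n * (n + k) := Nat.le_mul_of_pos_right _ (by omega)
    have e₂ : n + k ≤ n * (n + k) := Nat.le_mul_of_pos_left _ hn
    have e₃ : (40 * n + 40) * k ≤ 80 * (n * (n + k)) :=
      calc _ ≤ 80 * n * (n + k) := Nat.mul_le_mul (by omega) (by omega)
        _ = _ := by ring
    have e₄ : (150 * E.length + 20) * E.length ≤ 2480 * (n * (n + k)) :=
      calc _ ≤ 620 * n * (4 * (n + k)) := Nat.mul_le_mul (by omega) (by omega)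
        _ = _ := by ring
    omega
  · have hpin : ∀ (j : Fin k) (v : Fin n), (input F s E N γ β bt).natArr .pin j v =
        if v ∈ N j then 1 else 0 := fun j v => by simp [input, inputNatArr]
    refine ⟨?_, ?_, ?_, ?_, ?_, ?_, ?_, ?_, ?_, ?_, ?_, ?_, ?_, ?_⟩
    · rw [h₃.nat .nBlk (by decide), h₂.nat .nBlk (by decide), hB₁]
    · rw [h₃.nat .nEdge (by decide), hE₂]
      rfl
    · rw [h₃.nat .nNet (by decide), h₂.nat .nNet (by decide), hN₁]
    · rw [h₃.nat .source (by decide), h₂.nat .source (by decide), h₁.nat .source (by decide)]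
      rfl
    · rw [h₃.real .gamma (by decide), h₂.real .gamma (by decide), h₁.real .gamma (by decide)]
      rfl
    · rw [h₃.real .beta (by decide), h₂.real .beta (by decide), h₁.real .beta (by decide)]
      rfl
    · intro e he
      rw [h₃.natArr .src (by decide), h₂.natArr .src (by decide), h₁.natArr .src (by decide)]
      exact getD_map E (fun p => (p.1 : ℕ)) (s, s) 0 he
    · intro e he
      rw [h₃.natArr .dst (by decide), h₂.natArr .dst (by decide), h₁.natArr .dst (by decide)]
      exact getD_map E (fun p => (p.2 : ℕ)) (s, s) 0 he
    · rw [h₃.natArr .pin (by decide), h₂.natArr .pin (by decide), h₁.natArr .pin (by decide)]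
      exact hpin
    · intro v
      rw [h₃.realArr .wt (by decide), h₂.realArr .wt (by decide), hwt₁ v v.2]
      exact weight_input F bt N γ β v
    · rw [h₃.real .wTot (by decide), h₂.real .wTot (by decide), hwT₁, sum_range]
      exact sum_congr rfl fun v _ => weight_input F bt N γ β v
    · intro j
      rw [h₃.natArr .netDeg (by decide), hdeg₂ j j.2, sum_range, h₁.natArr .pin (by decide)]
      simp [hpin, hD, problem]
    -- Index pairs that pass the corner test correspond to the geometric corners; composing with the
    -- bijection from list positions to index pairs gives the claim.
    · have hprod : Set.BijOn (fun p : ℕ × ℕ => (D.ed p.1, D.ed p.2))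
          {p | p.1 < E.length ∧ p.2 < E.length ∧ IsCorner τ₂ p.1 p.2} (F.corners st) := by
        have hbij := D.bijOn
        refine ⟨?_, ?_, ?_⟩
        · rintro ⟨e, f⟩ ⟨he, hf, hc⟩
          simp only [Floorplan.corners, coe_filter, mem_product]
          exact ⟨⟨hbij.mapsTo he, hbij.mapsTo hf⟩,
            (isCorner_input F bt N γ β he hf).1 ((hcorner e f).1 hc)⟩
        · rintro ⟨e, f⟩ ⟨he, hf, -⟩ ⟨e', f'⟩ ⟨he', hf', -⟩ h
          rw [Prod.mk.injEq] at h ⊢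
          exact ⟨hbij.injOn he he' h.1, hbij.injOn hf hf' h.2⟩
        · rintro ⟨p, q⟩ hpq
          simp only [Floorplan.corners, coe_filter, mem_product] at hpq
          obtain ⟨⟨hp, hq⟩, hc⟩ := hpq
          obtain ⟨e, he, rfl⟩ := hbij.surjOn hp
          obtain ⟨f, hf, rfl⟩ := hbij.surjOn hq
          exact ⟨(e, f), ⟨he, hf, (hcorner e f).2 ((isCorner_input F bt N γ β he hf).2 hc)⟩, rfl⟩
      exact hprod.comp hc₃
    · intro c hc
      have := hc₃.mapsTo hc
      exact ⟨this.1, this.2.1⟩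

end Preparation

namespace Problem

variable {D : Problem n k} {σ : Store}

theorem runs_trials (hR : D.Ready σ) :
    Runs ω (.lamLen ≔ .lit 0 ;; .r ≔ .lit 0 ;;
      .loop (.nlt (.var .r) (.lit 3)) (trial ;; incr .r)) σ fun t τ =>
      t ≤ 30100 * (n * (n + k)) ∧ D.Ready τ ∧ ∃ G, D.Stored G (3 * (n - 1)) τ ∧
        ∀ r < 3, D.Chain G (r * (n - 1)) univ := by
  have hn := D.n_pos
  refine Runs.seq (P := fun t τ => t ≤ 10 ∧ τ.nat .lamLen = 0) (by simp [NExp.cost]) ?_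
  rintro t₁ τ₁ h₁ ⟨ht₁, hlen₁⟩
  refine Runs.seq (P := fun t τ => t ≤ 10 ∧ τ.nat .r = 0) (by simp [NExp.cost]) ?_
  rintro t₂ τ₂ h₂ ⟨ht₂, hr₂⟩
  have hR₂ := (hR.frame h₁ (by decide)).frame h₂ (by decide)
  refine (Runs.loop (φ := (10000 * (n * (n + k)) + 20) * 3) (I := fun φ τ => ∃ r ≤ 3,
    τ.nat .r = r ∧ D.Ready τ ∧ (∃ G, D.Stored G (r * (n - 1)) τ ∧
      ∀ r' < r, D.Chain G (r' * (n - 1)) univ) ∧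
    φ = (10000 * (n * (n + k)) + 20) * (3 - r)) ⟨0, by omega, hr₂, hR₂, ⟨fun _ => ∅, ?_, by simp⟩,
      by simp⟩ ?_).mono ?_
  · refine ⟨?_, by simp, by simp⟩
    rw [h₂.nat .lamLen (by decide), hlen₁, zero_mul]
  · rintro φ τ - ⟨r, hr, hrr, hR, ⟨G, hG, hch⟩, rfl⟩ hlt
    simp only [BExp.Holds, NExp.eval, hrr] at hlt
    refine Runs.seq (runs_trial hR hG) ?_
    rintro t₃ τ₃ h₃ ⟨ht₃, hR₃, G', hGG', hG', hch'⟩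
    have hr₃ : τ₃.nat .r = r := (h₃.nat .r (by decide)).trans hrr
    refine Runs.mono (P := fun t τ => t ≤ 10 ∧ τ.nat .r = τ₃.nat .r + 1) (by simp [NExp.cost]) ?_
    rintro t₄ τ₄ h₄ ⟨ht₄, hr₄⟩
    refine ⟨_, ⟨r + 1, hlt, by rw [hr₄, hr₃], hR₃.frame h₄ (by decide), ⟨G', ?_, ?_⟩, rfl⟩, ?_⟩
    · rw [add_mul, one_mul]
      exact hG'.congr (h₄.nat .lamLen (by decide)) (h₄.natArr .lamCut (by decide))
        (h₄.realArr .lamGain (by decide))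
    · intro r' hr'
      rcases Nat.lt_succ_iff_lt_or_eq.1 hr' with hr' | rfl
      -- A later trial only appends, so the chains of earlier trials persist.
      · have heq : ∀ i < n - 1, G' (r' * (n - 1) + i) = G (r' * (n - 1) + i) := fun i hi => by
          have : (r' + 1) * (n - 1) ≤ r * (n - 1) := Nat.mul_le_mul_right _ hr'
          rw [add_mul, one_mul] at this
          exact hGG' _ (by omega)
        intro i hi
        have hi' : i < n - 1 := hi.trans_le (min_le_right _ _)
        rw [heq i hi']
        obtain ⟨a₁, a₂, a₃, a₄⟩ := hch r' hr' i hi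
        exact ⟨a₁, a₂, a₃, fun i' hi'' => by rw [heq i' (by omega)]; exact a₄ i' hi''⟩
      · exact hch'
    · have : 3 - r = 3 - (r + 1) + 1 := by omega
      rw [this, Nat.mul_succ]
      simp only [BExp.cost, NExp.cost]
      omega
  · rintro t τ - ⟨hnot, φ, ⟨r, hr, hrr, hR, ⟨G, hG, hch⟩, rfl⟩, ht⟩
    simp only [BExp.Holds, NExp.eval, hrr] at hnot
    obtain rfl : r = 3 := by omega
    refine ⟨?_, hR, G, hG, hch⟩
    have : 0 < n * (n + k) := Nat.mul_pos hn (by omega)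
    simp only [BExp.cost, NExp.cost] at ht
    omega

end Problem

theorem runs_msCutBendRand (F : Floorplan n) (st : StairType) (bt : BalType)
    (N : Fin k → Finset (Fin n)) (γ β : ℝ) {s : Fin n} (hs : F.IsSource st s)
    {E : List (Fin n × Fin n)} (hE : IsEdgeList F st E) :
    Runs ω msCutBendRand (input F s E N γ β bt) fun t τ =>
      t ≤ 50000 * (n ^ 2 + n * k) ∧ τ.nat .nCorner = (F.corners st).card ∧
      τ.nat .lamLen = 3 * (n - 1) ∧
      ∃ L : Fin 3 → Fin (n - 1) → Finset (Fin n),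
        (∀ r i, F.IsMSCut st (L r i) ∧ (L r i).card = i + 1 ∧
          HoldsRow τ .lamCut (r * (n - 1) + i) (L r i) ∧
          τ.realArr .lamGain (r * (n - 1) + i) 0 = F.gain st bt N γ β (L r i)) ∧
        (∀ r, Monotone (L r)) ∧
        (2 ≤ n → ∃ r i, Outputs τ (L r i) ∧
          ∀ r' i', F.gain st bt N γ β (L r' i') ≤ F.gain st bt N γ β (L r i)) := by
  have hn : 0 < n := s.pos
  have e₁ : n ≤ n * (n + k) := Nat.le_mul_of_pos_right _ (by omega)
  have e₂ : n ^ 2 + n * k = n * (n + k) := by ring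
  -- Regroups the program into preparation, trials and selection; costs add, so regrouping changes
  -- neither time nor result.
  have hassoc : Runs ω ((prepWeights ;; prepNets ;; prepCorners) ;;
      ((.lamLen ≔ .lit 0 ;; .r ≔ .lit 0 ;;
        .loop (.nlt (.var .r) (.lit 3)) (trial ;; incr .r)) ;; selectBest))
      (input F s E N γ β bt) = Runs ω msCutBendRand (input F s E N γ β bt) := by
    funext Q
    simp only [msCutBendRand, runs_seq, add_assoc]
  rw [← hassoc]
  refine Runs.seq (runs_prep F st bt N γ β hs hE) ?_
  rintro t₁ τ₁ - ⟨ht₁, hR₁⟩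
  refine Runs.seq (Problem.runs_trials hR₁) ?_
  rintro t₂ τ₂ - ⟨ht₂, hR₂, G, hG, hch⟩
  refine (runs_selectBest τ₂).mono ?_
  rintro t₃ τ₃ h₃ ⟨ht₃, b, hb, hmax, hout⟩
  have hlen := hG.lamLen
  rw [hlen] at ht₃ hb hmax
  rw [hR₂.nBlk] at ht₃ hout
  have hlt : ∀ (r : Fin 3) (i : Fin (n - 1)), (r : ℕ) * (n - 1) + i < 3 * (n - 1) := fun r i => by
    have : ((r : ℕ) + 1) * (n - 1) ≤ 3 * (n - 1) := Nat.mul_le_mul_right _ r.2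
    rw [add_mul, one_mul] at this
    omega
  have hchain : ∀ (r : Fin 3) (i : Fin (n - 1)), _ := fun r i =>
    hch r r.2 i (by simp)
  refine ⟨by rw [e₂]; omega, ?_, ?_, fun r i => G (r * (n - 1) + i), fun r i => ?_,
    fun r i j hij => ?_, fun hn₂ => ?_⟩
  · rw [h₃.nat .nCorner (by decide)]
    exact (card_eq_of_bijOn hR₂.corners).symm
  · rw [h₃.nat .lamLen (by decide), hlen]
  · refine ⟨(hchain r i).1, (hchain r i).2.1, fun v => ?_, ?_⟩
    · rw [h₃.natArr .lamCut (by decide)]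
      exact hG.lamCut _ (hlt r i) v
    · rw [h₃.realArr .lamGain (by decide)]
      exact hG.lamGain _ (hlt r i)
  · exact (hchain r j).2.2.2 i hij
  · have hb := hb (by omega)
    -- Quotient and remainder by `n - 1` recover the trial and the position in it from the index in
    -- the stored list.
    have hdiv : b / (n - 1) < 3 := Nat.div_lt_of_lt_mul (by rwa [mul_comm])
    have hmod : b % (n - 1) < n - 1 := Nat.mod_lt _ (by omega)
    have hbeq : b / (n - 1) * (n - 1) + b % (n - 1) = b := by
      rw [mul_comm]
      exact Nat.div_add_mod b (n - 1)
    refine ⟨⟨_, hdiv⟩, ⟨_, hmod⟩, fun v => ?_, fun r i => ?_⟩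
    · simp only [hbeq]
      rw [hout v v.2]
      exact hG.lamCut b hb v
    · have := hmax _ (hlt r i)
      rw [hG.lamGain _ (hlt r i), hG.lamGain b hb] at this
      simp only [hbeq]
      exact this

end MSCut

theorem mainTheorem2 :
    ∃ C : ℕ, ∀ (n k : ℕ) (F : Floorplan n) (st : StairType) (bt : BalType)
      (N : Fin k → Finset (Fin n)) (γ β : ℝ),
      -- the block adjacency graph has `O(n)` edges, and `O(n)` places where a bend can occur
      (F.edges st).card ≤ C * n ∧
      (F.corners st).card ≤ C * n ∧
      -- in a dissected rectangle, the block in the proper corner is the source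
      (∀ X₀ X₁ Y₀ Y₁ : ℝ, F.Dissects X₀ X₁ Y₀ Y₁ →
        ∃ s, Floorplan.sourceCorner X₀ Y₀ Y₁ st ∈ F.block s ∧ F.IsSource st s) ∧
      ∀ (s : Fin n), F.IsSource st s →
      ∀ (E : List (Fin n × Fin n)), MSCut.IsEdgeList F st E →
      ∀ ω : RealRAM.Random,
        -- per staircase, net partitioning takes `O(k)` and bend counting takes `O(n)` time
        (∀ σ : RealRAM.Store, σ.nat .nNet = k →
          ∃ t τ, RealRAM.Exec ω MSCut.netPartition σ t τ ∧ t ≤ C * (k + 1)) ∧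
        (∀ σ : RealRAM.Store, σ.nat .nEdge = E.length → σ.nat .nCorner = (F.corners st).card →
          ∃ t τ, RealRAM.Exec ω MSCut.countBends σ t τ ∧ t ≤ C * n) ∧
        -- the whole run
        ∃ t τ, RealRAM.Exec ω MSCut.msCutBendRand (MSCut.input F s E N γ β bt) t τ ∧
          t ≤ C * (n ^ 2 + n * k) ∧
          τ.nat .nCorner = (F.corners st).card ∧
          τ.nat .lamLen = 3 * (n - 1) ∧
          -- `L r i` is the staircase number `i` of trial number `r`
          ∃ L : Fin 3 → Fin (n - 1) → Finset (Fin n),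
            (∀ r i, F.IsMSCut st (L r i) ∧ (L r i).card = i + 1 ∧
              MSCut.HoldsRow τ .lamCut (r * (n - 1) + i) (L r i) ∧
              τ.realArr .lamGain (r * (n - 1) + i) 0 = F.gain st bt N γ β (L r i)) ∧
            (∀ r, Monotone (L r)) ∧
            (2 ≤ n → ∃ r i, MSCut.Outputs τ (L r i) ∧
              ∀ r' i', F.gain st bt N γ β (L r' i') ≤ F.gain st bt N γ β (L r i)) := by
  -- The whole run dominates: 3000 for the preparation, 30100 for the trials and about 120 for the
  -- selection; the rest is slack.
  refine ⟨50000, fun n k F st bt N γ β => ⟨?_, ?_, fun X₀ X₁ Y₀ Y₁ h => h.exists_isSource st,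
    fun s hs E hE ω => ⟨fun σ hσ => ?_, fun σ hσ hσ' => ?_, ?_⟩⟩⟩
  · linarith [F.card_edges_le st]
  · linarith [F.card_corners_le st]
  · obtain ⟨t, τ, h, ht, -⟩ := MSCut.runs_netPartition (ω := ω) σ
    exact ⟨t, τ, h, by omega⟩
  · obtain ⟨t, τ, h, ht, -⟩ := MSCut.runs_countBends (ω := ω) σ
    have hn := s.pos
    have hE := (MSCut.problem F st bt N γ β hs hE).m_le
    have hc := F.card_corners_le st
    have hE : E.length ≤ 4 * n := hE
    exact ⟨t, τ, h, by omega⟩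
  · exact MSCut.runs_msCutBendRand F st bt N γ β hs hE
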